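/- **Conventions.** All graphs are finite and simple. For a graph $\Gamma$, $\deg_\Gamma(v,U)$ is the number of neighbours of $v$ in $U$ and $\deg_\Gamma(v)$ its degree; $e_\Gamma(X,Y)$ is the number of ordered pairs $(x,y)\in X\times Y$ with $xy\in E(\Gamma)$, $e_\Gamma(X)$ the number of edges inside $X$, and $\mathrm d_\Gamma(X,Y)=e_\Gamma(X,Y)/(|X||Y|)$ (and $0$ if $X$ or $Y$ is empty). $\Gamma[X,Y]$ consists of the edges with one end in $X$ and the other in $Y$. $\mathrm{shadow}_\Gamma(U,\ell)=\{v:\deg_\Gamma(v,U)>\ell\}$. $\mathrm{supp}(\Gamma)$ is the set of non-isolated vertices. Disjoint sets $U,W$ form an *$\epsilon$-regular pair* of $\Gamma$ if $|\mathrm d_\Gamma(U,W)-\mathrm d_\Gamma(U',W')|<\epsilon$ for all $U'\subseteq U$, $W'\subseteq W$ with $|U'|\ge\epsilon|U|$, $|W'|\ge\epsilon|W|$; the pair is *$(\epsilon,d)$-super-regular* if moreover $\deg_\Gamma(u,W)\ge d|W|$ for $u\in U$ and $\deg_\Gamma(w,U)\ge d|U|$ for $w\in W$. An *$(\epsilon,d,\ell)$-regularized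 matching* of $\Gamma$ is a set $\mathcal N$ of ordered pairs $(X,Y)$ of vertex sets with $|X|=|Y|\ge\ell$, each an $\epsilon$-regular pair of $\Gamma$ with $\mathrm d_\Gamma(X,Y)\ge d$, any two different pairs being vertex-disjoint; $V_1(\mathcal N)$, $V_2(\mathcal N)$ are the unions of the first and of the second sides, $V(\mathcal N)=V_1(\mathcal N)\cup V_2(\mathcal N)$. $\mathcal N$ is *absorbed* by $\mathcal N'$ if every $(X,Y)\in\mathcal N$ has some $(X',Y')\in\mathcal N'$ with $X\subseteq X'$, $Y\subseteq Y'$. An *$\mathcal N$-cover* is a family $\mathcal F$ of sides of pairs of $\mathcal N$ containing at least one side of every pair. An *$(m,\gamma)$-dense spot* of $\Gamma$ is a non-empty bipartite subgraph $D=(U,W;F)$ of $\Gamma$ with $\mathrm d_F(U,W)>\gamma$ and minimum degree greater than $m$; $V(D)=U\cup W$. $\Gamma$ is *$(m,\gamma)$-nowhere-dense* if it has no $(m,\gamma)$-dense spot. For a family $\mathcal D$ of spots, $G_{\mathcal D}$ is the union of their edge sets. Sets $X,Y$ *lie in the two sides of* $D$ if one is contained in $U$ and the other one in $W$. A regularized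 matching is *absorbed by* $\mathcal D$ if the two sides of each of its pairs lie in the two sides of some $D\in\mathcal D$. **Constants.** We write $c>\eta\gg\frac1{\Omega^*}\gg\frac1{\Omega^{**}}\gg\rho\gg\gamma\gg d\ge\frac1\Lambda\gg\epsilon\ge\pi\ge\widehat\alpha\gg\epsilon'\ge\nu\gg\tau\gg\frac1{k_0}>0$ with respect to $c>0$ and non-decreasing functions $f_i:(0,c)^i\to(0,c)$, where the chain also asserts $\frac1\Lambda\ge\epsilon$ and $\widehat\alpha\ge\epsilon'$, and where $a\gg b$ means that $b<f_i(\dots)$, the arguments being the $i$ constants of the chain up to and including $a$. **The common setting.** Let $k\ge k_0$ be a natural number and $G$ a graph on $n\ge1$ vertices. For a graph $\Gamma$ let $\mathbb L_{a}(\Gamma)$ be the set of vertices of degree at least $(1+a)k$, and put $\mathbb L=\mathbb L_\eta(G)$, $\mathbb S=V(G)\setminus\mathbb L$. Assume that $|\mathbb L|\ge(\frac12+\eta)n$; that all neighbours of a vertex of degree greater than $\lceil(1+2\eta)k\rceil$ have degree at most $\lceil(1+2\eta)k\rceil$; that all neighbours of vertices of $\mathbb S$ have degree exactly $\lceil(1+\eta)k\rceil$;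 and that $e(G)\le kn$. Let $\nabla=(\mathbb H,\mathbf V,\mathcal D,G_{\rm reg},G_{\rm exp},\mathbb E)$ be a $(k,\Omega^{**},\Omega^*,\Lambda,\gamma,\epsilon',\nu,\rho)$-sparse decomposition of $G$ with respect to $\{\mathbb S,\mathbb L\}$, that is: $\deg_G(v)\ge\Omega^{**}k$ for $v\in\mathbb H$; every $v\notin\mathbb H$ has degree at most $\Omega^*k$ in $G_{\mathcal D}\cup G_{\rm exp}\cup G[\mathbb H,V(G)]$; and, with $G'=G-\mathbb H$, (a) $G_{\rm exp}\subseteq G'$ is $(\gamma k,\gamma)$-nowhere-dense and its non-isolated vertices have degree greater than $\rho k$ in it; $V(G_{\rm exp})=\mathrm{supp}(G_{\rm exp})$; (b) $\mathbf V$ is a family of pairwise disjoint subsets (clusters) of $V(G')$, all of the same size, which is between $\nu k$ and $\epsilon'k$; (c) $G_{\rm reg}\subseteq G'-E(G_{\rm exp})$, and each edge $xy$ of $G_{\rm reg}$ has $x\in C$, $y\in C'$ for distinct $C,C'\in\mathbf V$ such that $G_{\rm reg}[C,C']=G'[C,C']$, and $(C,C')$ is $\epsilon'$-regular with density at least $\gamma^2$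 in $G'$; we put $V(G_{\rm reg})=\bigcup\mathbf V$; (d) $\mathcal D$ is a family of edge-disjoint $(\gamma k,\gamma)$-dense spots of $G'-E(G_{\rm exp})$, and for $(U,W;F)\in\mathcal D$ all edges of $G'[U,W]$ belong to $G_{\mathcal D}$; (e) if $G_{\rm reg}$ has an edge between clusters $C,C'$, then $C,C'$ lie in the two sides of some $D\in\mathcal D$; (f) each cluster is contained in one of the sets $\mathbb S\cap V(G_{\rm exp})$, $\mathbb S\setminus V(G_{\rm exp})$, $\mathbb L\cap V(G_{\rm exp})$, $\mathbb L\setminus V(G_{\rm exp})$, and for every $D\in\mathcal D$ it is contained in or disjoint from $V(D)$; (g) $\mathbb E\subseteq V(G')\setminus\bigcup\mathbf V$ is $(\Lambda,\epsilon',\gamma,k)$-avoiding: $\mathbb E\subseteq\bigcup_{D\in\mathcal D}V(D)$, and for each $U\subseteq V(G')$ with $|U|\le\Lambda k$ all but at most $\epsilon'k$ vertices $v\in\mathbb E$ have some $D\in\mathcal D$ with $v\in V(D)$ and $|U\cap V(D)|\le\gamma^2k$. Moreover, for each cluster $C$, either all $v\in C$ have $\deg_{G'}(v,\mathbb E)\le\frac{\rho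 k}{100\Omega^*}$, or all $v\in C$ have $\deg_{G'}(v,\mathbb E)>\frac{\rho k}{100\Omega^*}$. Let $\mathfrak c$ be the size of the clusters. The graph of captured edges is $$G_\nabla=G_{\rm reg}\cup G_{\rm exp}\cup G[\mathbb H,V(G)]\cup G_{\mathcal D}[\mathbb E,\mathbb E\cup\textstyle\bigcup\mathbf V].$$ Let $\mathcal M_A,\mathcal M_B$ be $(\epsilon,d,\pi\mathfrak c)$-regularized matchings of $G_{\mathcal D}$. Write $V_{AB}=V(\mathcal M_A\cup\mathcal M_B)$ and put - $\mathbb S^0=\mathbb S\setminus(V(G_{\rm exp})\cup\mathbb E)$, $\ \mathbb{XA}=\mathbb L\setminus V(\mathcal M_B)$, - $\mathbb{XB}=\{v\in V(\mathcal M_B)\cap\mathbb L:\deg_G(v,\mathbb S^0\setminus V_{AB})<\frac{(1+\eta)k}2\}$, - $\mathcal M_{\rm good}=\{(X,Y)\in\mathcal M_A:X\cup Y\subseteq\mathbb{XA}\}$, $\ \mathcal N_{\mathbb E}=\{(X,Y)\in\mathcal M_A\cup\mathcal M_B:(X\cup Y)\cap\mathbb E\ne\emptyset\}$. Assume: (1)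 $V(\mathcal M_A)\cap V(\mathcal M_B)=\emptyset$; (2) $V_1(\mathcal M_B)\subseteq\mathbb S^0$; (3) for each $(X,Y)\in\mathcal M_A\cup\mathcal M_B$, $X,Y$ lie in the two sides of some $D\in\mathcal D$, and each of $X$, $Y$ is contained in $\mathbb S$ or in $\mathbb L$; (4) for each $(X,Y)\in\mathcal M_A\cup\mathcal M_B$, $X$ is contained in a cluster, and $Y$ is contained in a cluster or in $\mathbb L\cap\mathbb E$; (5) for each $(X,Y)\in\mathcal M_{\rm good}$ there are distinct clusters $C\supseteq X$, $C'\supseteq Y$ with $\mathrm d_{G_{\rm reg}}(C,C')\ge\gamma^2$; (6) $e_{G_\nabla}(\mathbb{XA},\mathbb S^0\setminus V(\mathcal M_A))\le\gamma kn$; (7) $e_{G_{\rm reg}}(V(G)\setminus V_{AB})\le\gamma^2kn$; (8) $e_{G_{\rm reg}}(V(G)\setminus V_{AB},V(\mathcal N_{\mathbb E}))\le\gamma^2kn$; (9) $|E(G)\setminus E(G_\nabla)|\le2\rho kn$; (10) $|E(G_{\mathcal D})\setminus(E(G_{\rm reg})\cup E(G[\mathbb E,\mathbb E\cup\bigcup\mathbf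 V]))|\le\frac54\gamma kn$. Further put - $V_{\leadsto\mathbb E}=\mathrm{shadow}_{G_\nabla-\mathbb H}(\mathbb E,\frac{\rho k}{100\Omega^*})$, $\ V_+=V(G)\setminus(\mathbb S^0\setminus V_{AB})$, $\ L_\#=\mathbb L\setminus\mathbb L_{\frac9{10}\eta}(G_\nabla)$, $\ V_{\rm good}=V_+\setminus(\mathbb H\cup L_\#)$, - $\mathbb{YA}=\mathrm{shadow}_{G_\nabla}(V_+\setminus L_\#,(1+\frac\eta{10})k)\setminus\mathrm{shadow}_{G-E(G_\nabla)}(V(G),\frac{\eta k}{100})$, - $\mathbb{YB}=\mathrm{shadow}_{G_\nabla}(V_+\setminus L_\#,(1+\frac\eta{10})\frac k2)\setminus\mathrm{shadow}_{G-E(G_\nabla)}(V(G),\frac{\eta k}{100})$, - $V_{\not\leadsto\mathbb H}=(\mathbb{XA}\cup\mathbb{XB})\cap\mathrm{shadow}_G(\mathbb H,\frac{\eta k}{100})$, - $\mathbb J_{\mathbb E}=\mathrm{shadow}_{G_{\rm reg}}(V(\mathcal N_{\mathbb E}),\gamma k)\setminus V_{AB}$, $\ \mathbb J_1=\mathrm{shadow}_{G_{\rm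 reg}}(V(G)\setminus V_{AB},\gamma k)\setminus V_{AB}$, - $\mathbb J=(\mathbb{XA}\setminus\mathbb{YA})\cup((\mathbb{XA}\cup\mathbb{XB})\setminus\mathbb{YB})\cup V_{\not\leadsto\mathbb H}\cup L_\#\cup\mathbb J_1\cup\mathrm{shadow}_{G_{\mathcal D}\cup G_\nabla}(V_{\not\leadsto\mathbb H}\cup L_\#\cup\mathbb J_{\mathbb E}\cup\mathbb J_1,\frac{\eta^2k}{10^5})$, - $\mathbb J_2=\mathbb{XA}\cap\mathrm{shadow}_{G_\nabla}(\mathbb S^0\setminus V(\mathcal M_A),\sqrt\gamma k)$, $\ \mathbb J_3=\mathbb{XA}\cap\mathrm{shadow}_{G_\nabla}(\mathbb{XA},\frac{\eta^3k}{10^3})$. **The splitting setting.** Let $B_1,\dots,B_{12}$ be the sets $V_{\rm good}$, $\mathbb{XA}\setminus(\mathbb H\cup\mathbb J)$, $\mathbb{XB}\setminus\mathbb J$, $V(G_{\rm exp})$, $\mathbb E$, $V_{\leadsto\mathbb E}$, $\mathbb J_{\mathbb E}$, $\mathbb L$, $L_\#$, $V_{\not\leadsto\mathbb H}$, $V_{AB}$,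 $\mathbb J_1$. For $I\subseteq\{1,\dots,12\}$ let $B_I$ be the set of vertices outside $\mathbb H$ that lie in $B_j$ exactly for $j\in I$. Let $\mathfrak p_0,\mathfrak p_1,\mathfrak p_2\ge\frac\eta{100}$, let $\mathfrak P_0,\mathfrak P_1,\mathfrak P_2$ be a partition of $V(G)\setminus\mathbb H$, let $\bar V\subseteq V(G)\setminus\mathbb H$, let $\bar{\mathcal V}$ be a set of sides of pairs of $\mathcal M_A\cup\mathcal M_B$, and $\bar{\mathbf V}\subseteq\mathbf V$, such that for some $q_i\ge\mathfrak p_i$ with $q_0+q_1+q_2=1$ the following holds for all $i,i'\in\{0,1,2\}$, all $j,j'$, and each $\Gamma\in\{(G_\nabla-\mathbb H)\cup G_{\mathcal D},\,G_\nabla-\mathbb H,\,G_{\rm exp},\,G_{\mathcal D}\}$: - $|\bar V|\le e^{-k^{0.1}}n$, $|\bigcup\bar{\mathcal V}|\le e^{-k^{0.1}}n$, $|\bigcup\bar{\mathbf V}|<e^{-k^{0.1}}n$; - $|C\cap\mathfrak P_i|\ge q_i|C|-k^{0.9}$ for $C\in\mathbf V\setminus\bar{\mathbf V}$, and likewise for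 each side $C\notin\bar{\mathcal V}$ of a pair of $\mathcal M_A\cup\mathcal M_B$; - for $(U,W;F)\in\mathcal D$, $\deg_F(v,W\cap\mathfrak P_i)\ge q_i\gamma k-k^{0.9}$ for $v\in U\setminus\bar V$, and $\deg_F(v,U\cap\mathfrak P_i)\ge q_i\gamma k-k^{0.9}$ for $v\in W\setminus\bar V$; - $|\mathfrak P_i\cap B_j|\ge q_i|B_j\setminus\mathbb H|-n^{0.9}$; - $\deg_\Gamma(v,\mathfrak P_i\cap B_I)\ge q_i\deg_\Gamma(v,B_I)-2^{-12}k^{0.9}$ for all $I$ and $v\in V(G)\setminus(\mathbb H\cup\bar V)$; - $e_\Gamma(\mathfrak P_i\cap B_j,\mathfrak P_{i'}\cap B_{j'})\ge q_iq_{i'}e_\Gamma(B_j,B_{j'})-k^{0.6}n^{0.6}$ if $j\ne j'$; $\ e_\Gamma(\mathfrak P_i\cap B_j,\mathfrak P_{i'}\cap B_j)\ge q_iq_{i'}e_\Gamma(B_j)-k^{0.6}n^{0.6}$ if $i\ne i'$; $\ e_\Gamma(\mathfrak P_i\cap B_j)\ge q_i^2e_\Gamma(B_j)-k^{0.6}n^{0.6}$.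 Let $\bar{\mathcal V}^*$ be the set of partners, in the pairs of $\mathcal M_A\cup\mathcal M_B$, of the sets in $\bar{\mathcal V}$; $\mathbb F=\mathrm{shadow}_{G_{\mathcal D}}(\bigcup\bar{\mathcal V}\cup\bigcup\bar{\mathcal V}^*\cup\bigcup\bar{\mathbf V},\frac{\eta^2k}{10^{10}})$; and $\mathfrak P_0^*=\mathfrak P_0\setminus(\mathbb F\cup\mathrm{shadow}_{G_{\mathcal D}}(V_{\not\leadsto\mathbb H},\frac{\eta^2k}{10^5}))$. **Preconfigurations** for non-empty sets $V_0,V_1$: - $(\heartsuit1)(\gamma',h)$, with cover $\mathcal F$: $V_0,V_1\subseteq\mathfrak P_0^*$, $\deg_{G_\nabla}(v,V_{\rm good}\cap\mathfrak P_2)\ge\frac h2$ for $v\in V_0$ and $\ge h$ for $v\in V_1$, and $\mathcal F$ is an $(\mathcal M_A\cup\mathcal M_B)$-cover with $\deg_{G_\nabla}(v,\bigcup\mathcal F)\le\gamma'k$ for $v\in V_1$. - $(\heartsuit2)(h)$: $V_0,V_1\subseteq\mathfrak P_0^*$ and $\deg_{G_\nabla}(v,V_{\rm good}\cap\mathfrak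 P_2)\ge h$ for $v\in V_0\cup V_1$. - $(\mathbf{exp})(\beta)$: $V_0,V_1\subseteq\mathfrak P_0$, $\deg_{G_{\rm exp}}(v,V_1)\ge\beta k$ for $v\in V_0$, and $\deg_{G_{\rm exp}}(v,V_0)\ge\beta k$ for $v\in V_1$. - $(\mathbf{reg})(\tilde\epsilon,d',\mu)$: $V_0,V_1\subseteq\mathfrak P_0$, and there is a non-empty family of vertex-disjoint $(\tilde\epsilon,d')$-super-regular pairs $(Q_0^{(j)},Q_1^{(j)})$ of $G$ with $V_0=\bigcup_jQ_0^{(j)}$, $V_1=\bigcup_jQ_1^{(j)}$, all sides having at least $\mu k$ vertices. **Configurations.** Below, the sets $V_i$ are non-empty (except $V_2$ in $(\diamond9)$), "$\deg_\Gamma(V_i,V_j)\ge x$" means $\deg_\Gamma(v,V_j)\ge x$ for all $v\in V_i$, and similarly for $<$. - $(\diamond6)(\delta,\tilde\epsilon,d',\mu,\gamma',h_2)$: there are $V_0,V_1\subseteq\mathfrak P_0$, $V_2,V_3\subseteq\mathfrak P_1$ such that $V_0,V_1$ satisfy $(\mathbf{reg})(\tilde\epsilon,d',\mu)$ or $(\mathbf{exp})(\delta)$,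 and $(\heartsuit1)(\gamma',h_2)$ or $(\heartsuit2)(h_2)$; $\deg_G(V_1,V_2),\deg_G(V_2,V_1),\deg_{G_{\rm exp}}(V_2,V_3),\deg_{G_{\rm exp}}(V_3,V_2)\ge\delta k$. - $(\diamond7)(\delta,\rho',\tilde\epsilon,d',\mu,\gamma',h_2)$: there are $V_0,V_1\subseteq\mathfrak P_0$, $V_2\subseteq(\mathbb E\cap\mathfrak P_1)\setminus\bar V$, $V_3\subseteq\mathfrak P_1$ such that $V_0,V_1$ satisfy $(\mathbf{reg})(\tilde\epsilon,d',\mu)$ and $(\heartsuit1)(\gamma',h_2)$ or $(\heartsuit2)(h_2)$; $\deg_G(V_1,V_2),\deg_G(V_2,V_1),\deg_{G_{\mathcal D}}(V_3,V_2)\ge\delta k$; $\deg_{G_{\mathcal D}}(V_2,\mathfrak P_1\setminus V_3)<\rho'k$. - $(\diamond8)(\delta,\rho',\epsilon_1,\epsilon_2,d_1,d_2,\mu_1,\mu_2,h_1,h_2)$: there are $V_0,V_1,V_2\subseteq\mathfrak P_0$, $V_3\subseteq(\mathbb E\cap\mathfrak P_1)\setminus\bar V$, $V_4\subseteq\mathfrak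 P_1$ and an $(\epsilon_1,d_1,\mu_1k)$-regularized matching $\mathcal N$ of $G_{\mathcal D}$ absorbed by $(\mathcal M_A\cup\mathcal M_B)\setminus\mathcal N_{\mathbb E}$ with $V(\mathcal N)\subseteq\mathfrak P_1\setminus V_3$, such that $V_0,V_1$ satisfy $(\mathbf{reg})(\epsilon_2,d_2,\mu_2)$ and $(\heartsuit2)(h_2)$; $\deg_G(V_1,V_2),\deg_G(V_2,V_1),\deg_{G_\nabla}(V_2,V_3),\deg_{G_\nabla}(V_3,V_2),\deg_{G_{\mathcal D}}(V_4,V_3)\ge\delta k$; $\deg_{G_{\mathcal D}}(V_3,\mathfrak P_1\setminus V_4)<\rho'k$; and $\deg_{G_{\mathcal D}}(v,V_3)+\deg_{G_{\rm reg}}(v,V(\mathcal N))\ge h_1$ for $v\in V_2$. - $(\diamond9)(\delta,\gamma',h_1,h_2,\epsilon_1,d_1,\mu_1,\epsilon_2,d_2,\mu_2)$: there are $V_0,V_1\subseteq\mathfrak P_0$ satisfying $(\mathbf{reg})(\epsilon_2,d_2,\mu_2)$ and $(\heartsuit1)(\gamma',h_2)$ with a cover $\mathcal F$, an $(\epsilon_1,d_1,\mu_1k)$-regularized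 matching $\mathcal N$ of $G_{\mathcal D}$ absorbed by $\mathcal M_A\cup\mathcal M_B$ with $V(\mathcal N)\subseteq\mathfrak P_1$, and a set $V_2\subseteq V(\mathcal N)\setminus\bigcup\mathcal F\subseteq\bigcup\mathbf V$ such that $\deg_{G_{\mathcal D}}(V_1,V_2)\ge h_1$ and $\deg_{G_{\mathcal D}}(V_2,V_1)\ge\delta k$. - $(\diamond10)(\tilde\epsilon,d',\ell_1,\ell_2,\eta')$: there are a subgraph $\widetilde G\subseteq G$ and a partition $\mathcal V$ of $V(\widetilde G)$ into sets that are independent in $\widetilde G$ and have at least $\ell_1$ vertices, any two of which form an $\tilde\epsilon$-regular pair of $\widetilde G$ of density $0$ or at least $d'$, and such that for each $X\in\mathcal V$ the union of the members of $\mathcal V$ joined to $X$ by an edge of $\widetilde G$ has at most $\ell_2$ vertices; there are an $(\tilde\epsilon,d',\ell_1)$-regularized matching $\mathcal N$ of $\widetilde G$ all of whose sides belong to $\mathcal V$, a family $\mathcal L^*\subseteq\mathcal V$, and distinct $A,B\in\mathcal V$ joined by an edge of $\widetilde G$, such that all but at most $\tilde\epsilon|X|$ vertices $v\in X$ satisfy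 $\deg_{\widetilde G}(v,V(\mathcal N)\cup\bigcup\mathcal L^*)\ge(1+\eta')k$ for $X\in\{A,B\}$, and $\deg_{\widetilde G}(v)\ge(1+\eta')k$ for $X\in\mathcal L^*$. **Lemma.** There are $c>0$ and non-decreasing functions $f_i:(0,c)^i\to(0,c)$ such that the following holds whenever the constants satisfy the above chain with respect to $c$ and the $f_i$, and we are in the common setting and in the splitting setting. Suppose that there is an $(\bar\epsilon,\bar d,\beta k)$-regularized matching $\mathcal M$ of $G$ with $V(\mathcal M)\subseteq\mathfrak P_0$ and $|V(\mathcal M)|\ge\frac{\rho n}{\Omega^*}$ such that - **(M1)** up to interchanging the two sides of pairs, $\mathcal M$ is absorbed by $\mathcal M_{\rm good}$, and $\bar\epsilon=\frac{10^5\epsilon'}{\eta^2}$, $\bar d=\frac{\gamma^2}4$, $\beta=\frac{\eta^2\mathfrak c}{8\cdot10^3k}$; or - **(M2)** $\bar\epsilon=\pi$, $\bar d=\frac{\gamma^3\rho}{32\Omega^*}$, $\beta=\frac{\widehat\alpha\rho}{\Omega^*}$, and $\mathcal M$ is absorbed by $\mathcal D_\nabla$ and all edges of $G$ between the two sides of pairs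 of $\mathcal M$ lie in $G_{\mathcal D_\nabla}$, for some family $\mathcal D_\nabla$ of edge-disjoint $(\frac{\gamma^3k}4,\frac\gamma2)$-dense spots of $G$, each being a subgraph of a member of $\mathcal D$, with $|E(G_{\mathcal D})\setminus E(G_{\mathcal D_\nabla})|\le\rho kn$ and $G_{\mathcal D_\nabla}\subseteq G_{\rm reg}\cup G[\mathbb E,\mathbb E\cup\bigcup\mathbf V]$. Put $W=\mathrm{shadow}_{G_\nabla}(V(G_{\rm exp}),\rho k)$ and $R=\mathrm{shadow}_{G_\nabla}\big((V_{\leadsto\mathbb E}\cap\mathbb L)\setminus V_{AB},\frac{2\eta^2k}{10^5}\big)$. Suppose further that - **(cA)** $V(\mathcal M)\subseteq(\mathbb{XA}\cap\mathfrak P_0)\setminus(\mathbb J\cup\bar V\cup\mathbb F)$, and one of **(t1)** $V_1(\mathcal M)\subseteq W$; **(t2)** $V_1(\mathcal M)\subseteq V_{\leadsto\mathbb E}$; **(t3)** $V_1(\mathcal M)\subseteq R\setminus(W\cup V_{\leadsto\mathbb E})$; **(t5)** $V(\mathcal M)\subseteq V(G_{\rm reg})\setminus(W\cup V_{\leadsto\mathbb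 E}\cup R)$ holds; or - **(cB)** $V_1(\mathcal M)\subseteq(\mathbb{XA}\cap\mathfrak P_0)\setminus(\mathbb J\cup\mathbb J_2\cup\mathbb J_3\cup\bar V\cup\mathbb F)$ and $V_2(\mathcal M)\subseteq(\mathbb{XB}\cap\mathfrak P_0)\setminus(\mathbb J\cup\bar V\cup\mathbb F)$, and one of **(t1)** $V_1(\mathcal M)\subseteq W$; **(t2)** $V_1(\mathcal M)\subseteq V_{\leadsto\mathbb E}$; **(t3–5)** $V_1(\mathcal M)\cap(W\cup V_{\leadsto\mathbb E})=\emptyset$ holds. Let $d'=\frac{\gamma^3\rho}{32\Omega^*}$ in case (M1) and $d'=\frac{\gamma^3\rho}{128\Omega^*}$ in case (M2). Then at least one of the following occurs: - $(\diamond6)\big(\frac{\eta^3\rho^4}{10^{12}(\Omega^*)^4},4\pi,d',\frac{\eta^2\nu}{2\cdot10^4},\frac{3\eta^3}{2000},\mathfrak p_2(1+\frac\eta{20})k\big)$, - $(\diamond7)\big(\frac{\eta^3\gamma^3\rho}{10^{12}(\Omega^*)^4},\frac{\eta\gamma}{400},4\pi,d',\frac{\eta^2\nu}{2\cdot10^4},\frac{3\eta^3}{2000},\mathfrak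 p_2(1+\frac\eta{20})k\big)$, - $(\diamond8)\big(\frac{\eta^4\gamma^4\rho}{10^{15}(\Omega^*)^5},\frac{\eta\gamma}{400},\frac{400\epsilon}\eta,4\pi,\frac d2,d',\frac{\eta\pi\mathfrak c}{200k},\frac{\eta^2\nu}{2\cdot10^4},\mathfrak p_1(1+\frac\eta{20})k,\mathfrak p_2(1+\frac\eta{20})k\big)$, - $(\diamond9)\big(\frac{\rho\eta^8}{10^{27}(\Omega^*)^3},\frac{2\eta^3}{10^3},\mathfrak p_1(1+\frac\eta{40})k,\mathfrak p_2(1+\frac\eta{20})k,\frac{400\epsilon}\eta,\frac d2,\frac{\eta\pi\mathfrak c}{200k},4\pi,d',\frac{\eta^2\nu}{2\cdot10^4}\big)$, - $(\diamond10)\big(\epsilon,\frac{\gamma^2d}2,\pi\sqrt{\epsilon'}\nu k,\frac{(\Omega^*)^2k}{\gamma^2},\frac\eta{40}\big)$. -/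

import Mathlib

namespace LKS

/-! ### Degrees, edge counts, shadows -/

section Graphs

variable {V : Type*}

/-- Number of neighbours of `v` in `U`. -/
noncomputable def deg (G : SimpleGraph V) (v : V) (U : Set V) : ℕ :=
  {u | u ∈ U ∧ G.Adj v u}.ncard

/-- `e(X,Y)`: number of ordered pairs `(x,y) ∈ X × Y` that are adjacent. -/
noncomputable def ePair (G : SimpleGraph V) (X Y : Set V) : ℕ :=
  {p : V × V | p.1 ∈ X ∧ p.2 ∈ Y ∧ G.Adj p.1 p.2}.ncard

/-- `e(X)`: number of edges induced by `X`. -/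
noncomputable def eInside (G : SimpleGraph V) (X : Set V) : ℕ :=
  {e | e ∈ G.edgeSet ∧ ∀ v ∈ e, v ∈ X}.ncard

/-- `G - U` for a vertex set `U`; the deleted vertices are kept as isolated vertices. -/
def deleteVerts (G : SimpleGraph V) (U : Set V) : SimpleGraph V where
  Adj x y := G.Adj x y ∧ x ∉ U ∧ y ∉ U
  symm := ⟨fun _ _ h => ⟨h.1.symm, h.2.2, h.2.1⟩⟩
  loopless := ⟨fun _ h => G.loopless.irrefl _ h.1⟩

/-- The subgraph of `G` formed by its edges with one end in `X` and the other in `Y`. -/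
def between (G : SimpleGraph V) (X Y : Set V) : SimpleGraph V where
  Adj x y := G.Adj x y ∧ ((x ∈ X ∧ y ∈ Y) ∨ (x ∈ Y ∧ y ∈ X))
  symm := ⟨fun _ _ h => ⟨h.1.symm, h.2.symm.imp (fun q => ⟨q.2, q.1⟩) (fun q => ⟨q.2, q.1⟩)⟩⟩
  loopless := ⟨fun _ h => G.loopless.irrefl _ h.1⟩

/-- `shadow_G(U,ℓ)`: vertices with more than `ℓ` neighbours in `U`. -/
def shadow (G : SimpleGraph V) (U : Set V) (l : ℝ) : Set V :=
  {v | l < (deg G v U : ℝ)}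

/-- Vertices of degree at least `(1+η)k`. -/
def largeVerts (η : ℝ) (k : ℕ) (G : SimpleGraph V) : Set V :=
  {v | (1 + η) * k ≤ (deg G v Set.univ : ℝ)}

/-- Vertices of degree less than `(1+η)k`. -/
def smallVerts (η : ℝ) (k : ℕ) (G : SimpleGraph V) : Set V :=
  {v | (deg G v Set.univ : ℝ) < (1 + η) * k}

/-- The class `LKSsmall(n,k,η)`, where `n` is the number of vertices. -/
structure LKSSmall (k : ℕ) (η : ℝ) (G : SimpleGraph V) : Prop where
  many_large : (1 / 2 + η) * (Nat.card V : ℝ) ≤ ((largeVerts η k G).ncard : ℝ)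
  huge_nbr : ∀ v w, G.Adj v w → ⌈(1 + 2 * η) * (k : ℝ)⌉₊ < deg G v Set.univ →
    deg G w Set.univ ≤ ⌈(1 + 2 * η) * (k : ℝ)⌉₊
  small_nbr : ∀ v w, G.Adj v w → v ∈ smallVerts η k G →
    deg G w Set.univ = ⌈(1 + η) * (k : ℝ)⌉₊
  edges_le : G.edgeSet.ncard ≤ k * Nat.card V

/-! ### Regular pairs and regularized matchings -/

noncomputable def density (G : SimpleGraph V) (U W : Set V) : ℝ :=
  (ePair G U W : ℝ) / ((U.ncard : ℝ) * (W.ncard : ℝ))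

def RegularPair (G : SimpleGraph V) (ε : ℝ) (U W : Set V) : Prop :=
  Disjoint U W ∧ ∀ U' W' : Set V, U' ⊆ U → W' ⊆ W →
    ε * (U.ncard : ℝ) ≤ (U'.ncard : ℝ) → ε * (W.ncard : ℝ) ≤ (W'.ncard : ℝ) →
    |density G U W - density G U' W'| < ε

def SuperRegularPair (G : SimpleGraph V) (ε γ : ℝ) (A B : Set V) : Prop :=
  RegularPair G ε A B ∧ (∀ a ∈ A, γ * (B.ncard : ℝ) ≤ (deg G a B : ℝ)) ∧
    ∀ b ∈ B, γ * (A.ncard : ℝ) ≤ (deg G b A : ℝ)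

/-- `V₁(M)`: union of the first sides. -/
def verts1 (M : Set (Set V × Set V)) : Set V := {v | ∃ p ∈ M, v ∈ p.1}

/-- `V₂(M)`: union of the second sides. -/
def verts2 (M : Set (Set V × Set V)) : Set V := {v | ∃ p ∈ M, v ∈ p.2}

/-- `V(M)`. -/
def vertsOf (M : Set (Set V × Set V)) : Set V := verts1 M ∪ verts2 M

/-- The family of all sides of the pairs of `M`. -/
def sidesOf (M : Set (Set V × Set V)) : Set (Set V) := {X | ∃ p ∈ M, X = p.1 ∨ X = p.2}

/-- `(ε,d,ℓ)`-regularized matching of the graph `G`. -/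
structure RegMatching (G : SimpleGraph V) (ε d l : ℝ) (M : Set (Set V × Set V)) : Prop where
  card_eq : ∀ p ∈ M, p.1.ncard = p.2.ncard
  card_ge : ∀ p ∈ M, l ≤ (p.1.ncard : ℝ)
  regular : ∀ p ∈ M, RegularPair G ε p.1 p.2
  dense : ∀ p ∈ M, d ≤ density G p.1 p.2
  disj : ∀ p ∈ M, ∀ q ∈ M, p ≠ q →
    Disjoint p.1 q.1 ∧ Disjoint p.2 q.2 ∧ Disjoint p.1 q.2

/-- `N` is absorbed by `M`, sides respected. -/
def AbsorbedBy (N M : Set (Set V × Set V)) : Prop :=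
  ∀ p ∈ N, ∃ q ∈ M, p.1 ⊆ q.1 ∧ p.2 ⊆ q.2

/-- `N` is absorbed by `M`, where the two sides of a pair may be interchanged. -/
def AbsorbedUpToSwap (N M : Set (Set V × Set V)) : Prop :=
  ∀ p ∈ N, ∃ q ∈ M, (p.1 ⊆ q.1 ∧ p.2 ⊆ q.2) ∨ (p.1 ⊆ q.2 ∧ p.2 ⊆ q.1)

/-- An `M`-cover. -/
def IsCover (M : Set (Set V × Set V)) (F : Set (Set V)) : Prop :=
  F ⊆ sidesOf M ∧ ∀ p ∈ M, p.1 ∈ F ∨ p.2 ∈ F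

/-! ### Dense spots and sparse decompositions -/

/-- A bipartite graph `(U,W;F)` on a subset of the vertices. -/
@[ext]
structure Spot (V : Type*) where
  U : Set V
  W : Set V
  F : SimpleGraph V
  disj : Disjoint U W
  cross : ∀ x y, F.Adj x y → (x ∈ U ∧ y ∈ W) ∨ (x ∈ W ∧ y ∈ U)

/-- Vertex set of a spot. -/
def Spot.verts (D : Spot V) : Set V := D.U ∪ D.W

/-- `D` is an `(m,γ)`-dense spot in `G`. -/
structure IsDenseSpot (G : SimpleGraph V) (m γ : ℝ) (D : Spot V) : Prop where
  le : D.F ≤ G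
  nonempty : D.verts.Nonempty
  dense : γ < density D.F D.U D.W
  minDeg : ∀ v ∈ D.verts, m < (deg D.F v Set.univ : ℝ)

/-- `X` lies in one side of `D` and `Y` in the other one (spots are not oriented). -/
def Spot.Sees (D : Spot V) (X Y : Set V) : Prop :=
  (X ⊆ D.U ∧ Y ⊆ D.W) ∨ (X ⊆ D.W ∧ Y ⊆ D.U)

def NowhereDense (G : SimpleGraph V) (m γ : ℝ) : Prop := ∀ D : Spot V, ¬ IsDenseSpot G m γ D

def EdgeDisjoint (𝒟 : Set (Spot V)) : Prop :=
  ∀ D ∈ 𝒟, ∀ D' ∈ 𝒟, D ≠ D' → ∀ x y, D.F.Adj x y → ¬ D'.F.Adj x y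

/-- The graph formed by the edges of all spots of the family. -/
def spotGraph (𝒟 : Set (Spot V)) : SimpleGraph V where
  Adj x y := ∃ D ∈ 𝒟, D.F.Adj x y
  symm := ⟨fun _ _ ⟨D, hD, h⟩ => ⟨D, hD, h.symm⟩⟩
  loopless := ⟨fun _ ⟨D, _, h⟩ => D.F.loopless.irrefl _ h⟩

/-- `(Λ,ε,γ,k)`-avoiding set, in a graph with vertex set `VG`. -/
def Avoiding (VG : Set V) (𝒟 : Set (Spot V)) (Λ ε γ : ℝ) (k : ℕ) (E : Set V) : Prop :=
  (∀ v ∈ E, ∃ D ∈ 𝒟, v ∈ D.verts) ∧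
  ∀ U : Set V, U ⊆ VG → (U.ncard : ℝ) ≤ Λ * k →
    ({v | v ∈ E ∧ ¬ ∃ D ∈ 𝒟, v ∈ D.verts ∧ ((U ∩ D.verts).ncard : ℝ) ≤ γ ^ 2 * k}.ncard : ℝ)
      ≤ ε * k

/-- `(k,Λ,γ,ε,ν,ρ)`-bounded decomposition of the graph with vertex set `VG` and edges `G` with
respect to the partition `parts` of `VG`. As the minimum degree of `Gexp` is positive, its vertex
set is its support. -/
structure BoundedDecomposition (VG : Set V) (G : SimpleGraph V) (parts : Set (Set V))
    (k : ℕ) (Λ γ ε ν ρ : ℝ) (clusters : Set (Set V)) (𝒟 : Set (Spot V))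
    (Greg Gexp : SimpleGraph V) (E : Set V) : Prop where
  exp_le : Gexp ≤ G
  exp_nowhereDense : NowhereDense Gexp (γ * k) γ
  exp_minDeg : ∀ v ∈ Gexp.support, ρ * k < (deg Gexp v Set.univ : ℝ)
  clusters_sub : ∀ C ∈ clusters, C ⊆ VG
  clusters_disj : ∀ C ∈ clusters, ∀ C' ∈ clusters, C ≠ C' → Disjoint C C'
  reg_le : Greg ≤ G \ Gexp
  reg_edge : ∀ x y, Greg.Adj x y → ∃ C ∈ clusters, ∃ C' ∈ clusters, C ≠ C' ∧ x ∈ C ∧ y ∈ C' ∧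
    (∀ a ∈ C, ∀ b ∈ C', G.Adj a b ↔ Greg.Adj a b) ∧
    RegularPair G ε C C' ∧ γ ^ 2 ≤ density G C C'
  cluster_size : ∀ C ∈ clusters, ∀ C' ∈ clusters,
    ν * k ≤ (C.ncard : ℝ) ∧ C.ncard = C'.ncard ∧ (C.ncard : ℝ) ≤ ε * k
  spots_disj : EdgeDisjoint 𝒟
  spots_dense : ∀ D ∈ 𝒟, IsDenseSpot (G \ Gexp) (γ * k) γ D
  spots_cover : ∀ D ∈ 𝒟, ∀ x ∈ D.U, ∀ y ∈ D.W, G.Adj x y → (spotGraph 𝒟).Adj x y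
  reg_spot : ∀ C ∈ clusters, ∀ C' ∈ clusters, (∃ x ∈ C, ∃ y ∈ C', Greg.Adj x y) →
    ∃ D ∈ 𝒟, D.Sees C C'
  cluster_part : ∀ C ∈ clusters, ∃ P ∈ parts, C ⊆ P ∩ Gexp.support ∨ C ⊆ P \ Gexp.support
  cluster_spot : ∀ C ∈ clusters, ∀ D ∈ 𝒟, Disjoint C D.verts ∨ C ⊆ D.verts
  avoid_sub : E ⊆ VG \ ⋃₀ clusters
  avoid : Avoiding VG 𝒟 Λ ε γ k E

/-- `(k,Ω**,Ω*,Λ,γ,ε,ν,ρ)`-sparse decomposition of `G` with respect to `parts`. -/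
structure SparseDecomposition (G : SimpleGraph V) (parts : Set (Set V))
    (k : ℕ) (Ωss Ωs Λ γ ε ν ρ : ℝ) (H : Set V) (clusters : Set (Set V)) (𝒟 : Set (Spot V))
    (Greg Gexp : SimpleGraph V) (E : Set V) : Prop where
  huge_minDeg : ∀ v ∈ H, Ωss * k ≤ (deg G v Set.univ : ℝ)
  rest_maxDeg : ∀ v, v ∉ H →
    (deg (spotGraph 𝒟 ⊔ Gexp ⊔ between G H Set.univ) v Set.univ : ℝ) ≤ Ωs * k
  bounded : BoundedDecomposition Hᶜ (deleteVerts G H) ((fun P => P \ H) '' parts) k Λ γ ε ν ρ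
    clusters 𝒟 Greg Gexp E

/-- The decomposition respects the avoiding threshold `b`. -/
def RespectsThreshold (G : SimpleGraph V) (clusters : Set (Set V)) (E : Set V) (b : ℝ) : Prop :=
  ∀ C ∈ clusters, (∀ v ∈ C, (deg G v E : ℝ) ≤ b) ∨ (∀ v ∈ C, b < (deg G v E : ℝ))

end Graphs

/-! ### Constants and their hierarchy -/

/-- The constants; `Ωs`, `Ωss`, `αh`, `εp` stand for `Ω*`, `Ω**`, `α` with a hat, `ε` prime. -/
structure Constants where
  (η Ωs Ωss ρ γ d Λ ε π αh εp ν τ k0 : ℝ)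

/-- Non-decreasing functions `f i : (0,c)^i → (0,c)`. -/
structure ThresholdFamily (c : ℝ) (f : (i : ℕ) → (Fin i → ℝ) → ℝ) : Prop where
  maps : ∀ i x, (∀ j, x j ∈ Set.Ioo 0 c) → f i x ∈ Set.Ioo 0 c
  mono : ∀ i x y, (∀ j, x j ∈ Set.Ioo 0 c) → (∀ j, y j ∈ Set.Ioo 0 c) → x ≤ y → f i x ≤ f i y

/-- The chain
`c > η ≫ 1/Ω* ≫ 1/Ω** ≫ ρ ≫ γ ≫ d ≥ 1/Λ ≫ ε ≥ π ≥ αh ≫ εp ≥ ν ≫ τ ≫ 1/k0 > 0`,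
where `a ≫ b` bounds `b` by the given function of all constants up to and including `a`. -/
structure Constants.Hierarchy (K : Constants) (c : ℝ) (f : (i : ℕ) → (Fin i → ℝ) → ℝ) : Prop where
  Ωs_pos : 0 < K.Ωs
  Ωss_pos : 0 < K.Ωss
  Λ_pos : 0 < K.Λ
  k0_pos : 0 < K.k0
  ρ_pos : 0 < K.ρ
  γ_pos : 0 < K.γ
  η_pos : 0 < K.η
  ν_pos : 0 < K.ν
  τ_pos : 0 < K.τ
  η_lt : K.η < c
  Ωs_lt : 1 / K.Ωs < f 1 ![K.η]
  Ωss_lt : 1 / K.Ωss < f 2 ![K.η, 1 / K.Ωs]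
  ρ_lt : K.ρ < f 3 ![K.η, 1 / K.Ωs, 1 / K.Ωss]
  γ_lt : K.γ < f 4 ![K.η, 1 / K.Ωs, 1 / K.Ωss, K.ρ]
  d_lt : K.d < f 5 ![K.η, 1 / K.Ωs, 1 / K.Ωss, K.ρ, K.γ]
  Λ_le : 1 / K.Λ ≤ K.d
  ε_lt : K.ε < f 7 ![K.η, 1 / K.Ωs, 1 / K.Ωss, K.ρ, K.γ, K.d, 1 / K.Λ]
  ε_le : K.ε ≤ 1 / K.Λ
  π_le : K.π ≤ K.ε
  αh_le : K.αh ≤ K.π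
  εp_lt : K.εp < f 10 ![K.η, 1 / K.Ωs, 1 / K.Ωss, K.ρ, K.γ, K.d, 1 / K.Λ, K.ε, K.π, K.αh]
  εp_le : K.εp ≤ K.αh
  ν_le : K.ν ≤ K.εp
  τ_lt : K.τ < f 12 ![K.η, 1 / K.Ωs, 1 / K.Ωss, K.ρ, K.γ, K.d, 1 / K.Λ, K.ε, K.π, K.αh, K.εp, K.ν]
  k0_lt : 1 / K.k0 < f 13 ![K.η, 1 / K.Ωs, 1 / K.Ωss, K.ρ, K.γ, K.d, 1 / K.Λ, K.ε, K.π, K.αh,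
    K.εp, K.ν, K.τ]

/-! ### The common setting -/

/-- The objects of the common setting, without their properties: the graph `G`, the components
`H, clusters, spots, Greg, Gexp, E` of a sparse decomposition, the matchings `MA`, `MB`, and
the size `𝔠` of the clusters. The properties are in `CommonSetting`. -/
structure Setup (V : Type*) extends Constants where
  k : ℕ
  𝔠 : ℕ
  G : SimpleGraph V
  H : Set V
  clusters : Set (Set V)
  spots : Set (Spot V)
  Greg : SimpleGraph V
  Gexp : SimpleGraph V
  E : Set V
  MA : Set (Set V × Set V)
  MB : Set (Set V × Set V)

namespace Setup

variable {V : Type*} (S : Setup V)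

/-- The order `n` of the graph. -/
noncomputable def n (_ : Setup V) : ℝ := (Nat.card V : ℝ)

def L : Set V := largeVerts S.η S.k S.G

def Sm : Set V := smallVerts S.η S.k S.G

/-- The matching `M_A ∪ M_B`. -/
def MAB : Set (Set V × Set V) := S.MA ∪ S.MB

/-- The graph `G_𝒟` of the edges of the dense spots. -/
def GD : SimpleGraph V := spotGraph S.spots

/-- The captured edges: those of `Greg` and `Gexp`, the edges of `G` at `H`, and the
edges of `G_𝒟` between `E` and `E ∪ ⋃ clusters`. -/
def Gcap : SimpleGraph V :=
  S.Greg ⊔ S.Gexp ⊔ between S.G S.H Set.univ ⊔ between S.GD S.E (S.E ∪ ⋃₀ S.clusters)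

/-- The set of vertices with many captured neighbours in `E`. -/
def VtoE : Set V := shadow (deleteVerts S.Gcap S.H) S.E (S.ρ * S.k / (100 * S.Ωs))

def S0 : Set V := S.Sm \ (S.Gexp.support ∪ S.E)

def XA : Set V := S.L \ vertsOf S.MB

noncomputable def hatDeg (v : V) : ℕ :=
  deg S.G v (S.Sm \ (S.Gexp.support ∪ S.E ∪ vertsOf S.MAB))

def XB : Set V := {v | v ∈ vertsOf S.MB ∩ S.L ∧ (S.hatDeg v : ℝ) < (1 + S.η) * S.k / 2}

/-- The pairs of `M_A` inside `XA`. -/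
def Mgood : Set (Set V × Set V) := {p | p ∈ S.MA ∧ p.1 ∪ p.2 ⊆ S.XA}

/-- The pairs of `M_A ∪ M_B` that meet `E`. -/
def Natom : Set (Set V × Set V) := {p | p ∈ S.MAB ∧ ((p.1 ∪ p.2) ∩ S.E).Nonempty}

def Vplus : Set V := (S.S0 \ vertsOf S.MAB)ᶜ

def Lsharp : Set V := S.L \ largeVerts (9 / 10 * S.η) S.k S.Gcap

def Vgood : Set V := S.Vplus \ (S.H ∪ S.Lsharp)

def YA : Set V := shadow S.Gcap (S.Vplus \ S.Lsharp) ((1 + S.η / 10) * S.k) \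
  shadow (S.G \ S.Gcap) Set.univ (S.η / 100 * S.k)

def YB : Set V := shadow S.Gcap (S.Vplus \ S.Lsharp) ((1 + S.η / 10) * S.k / 2) \
  shadow (S.G \ S.Gcap) Set.univ (S.η / 100 * S.k)

/-- The vertices of `XA ∪ XB` with many neighbours in `H`. -/
def VnoH : Set V := (S.XA ∪ S.XB) ∩ shadow S.G S.H (S.η / 100 * S.k)

def Jatom : Set V := shadow S.Greg (vertsOf S.Natom) (S.γ * S.k) \ vertsOf S.MAB

def J1 : Set V := shadow S.Greg (vertsOf S.MAB)ᶜ (S.γ * S.k) \ vertsOf S.MAB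

def J : Set V :=
  (S.XA \ S.YA) ∪ ((S.XA ∪ S.XB) \ S.YB) ∪ S.VnoH ∪ S.Lsharp ∪ S.J1 ∪
    shadow (S.GD ⊔ S.Gcap) (S.VnoH ∪ S.Lsharp ∪ S.Jatom ∪ S.J1) (S.η ^ 2 * S.k / 10 ^ 5)

noncomputable def J2 : Set V :=
  S.XA ∩ shadow S.Gcap (S.S0 \ vertsOf S.MA) (Real.sqrt S.γ * S.k)

def J3 : Set V := S.XA ∩ shadow S.Gcap S.XA (S.η ^ 3 * S.k / 10 ^ 3)

/-- The properties of the common setting (the hierarchy of the constants is stated apart). -/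
structure CommonSetting : Prop where
  k_ge : S.k0 ≤ (S.k : ℝ)
  lks : LKSSmall S.k S.η S.G
  sparse : SparseDecomposition S.G {S.Sm, S.L} S.k S.Ωss S.Ωs S.Λ S.γ S.εp S.ν S.ρ
    S.H S.clusters S.spots S.Greg S.Gexp S.E
  threshold : RespectsThreshold (deleteVerts S.G S.H) S.clusters S.E (S.ρ * S.k / (100 * S.Ωs))
  cluster_card : ∀ C ∈ S.clusters, C.ncard = S.𝔠
  matchA : RegMatching S.GD S.ε S.d (S.π * S.𝔠) S.MA
  matchB : RegMatching S.GD S.ε S.d (S.π * S.𝔠) S.MB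
  disjAB : Disjoint (vertsOf S.MA) (vertsOf S.MB)
  MB_small : verts1 S.MB ⊆ S.S0
  pair_spot : ∀ p ∈ S.MAB, (∃ D ∈ S.spots, D.Sees p.1 p.2) ∧
    (p.1 ⊆ S.Sm ∨ p.1 ⊆ S.L) ∧ (p.2 ⊆ S.Sm ∨ p.2 ⊆ S.L)
  pair_cluster : ∀ p ∈ S.MAB, (∃ C ∈ S.clusters, p.1 ⊆ C) ∧
    ((∃ C ∈ S.clusters, p.2 ⊆ C) ∨ p.2 ⊆ S.L ∩ S.E)
  good_edge : ∀ p ∈ S.Mgood, ∃ C ∈ S.clusters, ∃ C' ∈ S.clusters, C ≠ C' ∧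
    p.1 ⊆ C ∧ p.2 ⊆ C' ∧ S.γ ^ 2 ≤ density S.Greg C C'
  XA_S0 : (ePair S.Gcap S.XA (S.S0 \ vertsOf S.MA) : ℝ) ≤ S.γ * S.k * S.n
  reg_outside : (eInside S.Greg (vertsOf S.MAB)ᶜ : ℝ) ≤ S.γ ^ 2 * S.k * S.n
  reg_atom : (ePair S.Greg (vertsOf S.MAB)ᶜ (vertsOf S.Natom) : ℝ) ≤ S.γ ^ 2 * S.k * S.n
  captured : ((S.G.edgeSet \ S.Gcap.edgeSet).ncard : ℝ) ≤ 2 * S.ρ * S.k * S.n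
  dense_captured : ((S.GD.edgeSet \ (S.Greg.edgeSet ∪
    (between S.G S.E (S.E ∪ ⋃₀ S.clusters)).edgeSet)).ncard : ℝ) ≤ 5 / 4 * S.γ * S.k * S.n

/-- `𝒟'` is a cleaned version of the family of dense spots. -/
structure CleanedSpots (𝒟' : Set (Spot V)) : Prop where
  disj : EdgeDisjoint 𝒟'
  dense : ∀ D ∈ 𝒟', IsDenseSpot S.G (S.γ ^ 3 * S.k / 4) (S.γ / 2) D
  absorbed : ∀ D' ∈ 𝒟', ∃ D ∈ S.spots, D'.verts ⊆ D.verts ∧ D'.F ≤ D.F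
  few_lost : ((S.GD.edgeSet \ (spotGraph 𝒟').edgeSet).ncard : ℝ) ≤ S.ρ * S.k * S.n
  sub : spotGraph 𝒟' ≤ S.Greg ⊔ between S.G S.E (S.E ∪ ⋃₀ S.clusters)

/-! ### Proportional splittings -/

/-- The twelve vertex sets that a splitting has to split proportionally. -/
def splitSets : Fin 12 → Set V :=
  ![S.Vgood, S.XA \ (S.H ∪ S.J), S.XB \ S.J, S.Gexp.support, S.E, S.VtoE, S.Jatom, S.L, S.Lsharp,
    S.VnoH, vertsOf S.MAB, S.J1]

/-- Vertices outside `H` that lie in exactly those of the twelve sets whose index is in `I`. -/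
def splitAtom (I : Set (Fin 12)) : Set V := {v | v ∉ S.H ∧ ∀ j, v ∈ S.splitSets j ↔ j ∈ I}

/-- The graphs whose degrees and edges are split. -/
def splitGraphs : Set (SimpleGraph V) :=
  {deleteVerts S.Gcap S.H ⊔ S.GD, deleteVerts S.Gcap S.H, S.Gexp, S.GD}

/-- A partition `P 0, P 1, P 2` of `V(G) \ H`, together with the exceptional vertices `exV`, the
exceptional sides of matching pairs `exSides`, and the exceptional clusters `exClusters`, splits
everything in the proportions `q 0, q 1, q 2`. -/
structure SplitsWith (P : Fin 3 → Set V) (exV : Set V) (exSides exClusters : Set (Set V))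
    (q : Fin 3 → ℝ) : Prop where
  disj : ∀ i j, i ≠ j → Disjoint (P i) (P j)
  cover : ⋃ i, P i = S.Hᶜ
  exV_sub : exV ⊆ S.Hᶜ
  exSides_sub : exSides ⊆ sidesOf S.MAB
  exClusters_sub : exClusters ⊆ S.clusters
  exV_small : (exV.ncard : ℝ) ≤ Real.exp (-(S.k : ℝ) ^ (0.1 : ℝ)) * S.n
  exSides_small : ((⋃₀ exSides).ncard : ℝ) ≤ Real.exp (-(S.k : ℝ) ^ (0.1 : ℝ)) * S.n
  exClusters_small : ((⋃₀ exClusters).ncard : ℝ) < Real.exp (-(S.k : ℝ) ^ (0.1 : ℝ)) * S.n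
  cluster : ∀ i, ∀ C ∈ S.clusters \ exClusters,
    q i * (C.ncard : ℝ) - (S.k : ℝ) ^ (0.9 : ℝ) ≤ ((C ∩ P i).ncard : ℝ)
  side : ∀ i, ∀ X ∈ sidesOf S.MAB \ exSides,
    q i * (X.ncard : ℝ) - (S.k : ℝ) ^ (0.9 : ℝ) ≤ ((X ∩ P i).ncard : ℝ)
  spot : ∀ i, ∀ D ∈ S.spots,
    (∀ v ∈ D.U \ exV, q i * S.γ * S.k - (S.k : ℝ) ^ (0.9 : ℝ) ≤ (deg D.F v (D.W ∩ P i) : ℝ)) ∧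
    (∀ v ∈ D.W \ exV, q i * S.γ * S.k - (S.k : ℝ) ^ (0.9 : ℝ) ≤ (deg D.F v (D.U ∩ P i) : ℝ))
  size : ∀ i j, q i * ((S.splitSets j \ S.H).ncard : ℝ) - S.n ^ (0.9 : ℝ) ≤
    ((P i ∩ S.splitSets j).ncard : ℝ)
  degree : ∀ i, ∀ I : Set (Fin 12), ∀ v, v ∉ S.H → v ∉ exV → ∀ Γ ∈ S.splitGraphs,
    q i * (deg Γ v (S.splitAtom I) : ℝ) - (2 ^ 12)⁻¹ * (S.k : ℝ) ^ (0.9 : ℝ) ≤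
      (deg Γ v (P i ∩ S.splitAtom I) : ℝ)
  edges : ∀ Γ ∈ S.splitGraphs, ∀ i i' j j', j ≠ j' →
    q i * q i' * (ePair Γ (S.splitSets j) (S.splitSets j') : ℝ)
        - (S.k : ℝ) ^ (0.6 : ℝ) * S.n ^ (0.6 : ℝ) ≤
      (ePair Γ (P i ∩ S.splitSets j) (P i' ∩ S.splitSets j') : ℝ)
  edges_same : ∀ Γ ∈ S.splitGraphs, ∀ i i' j, i ≠ i' →
    q i * q i' * (eInside Γ (S.splitSets j) : ℝ) - (S.k : ℝ) ^ (0.6 : ℝ) * S.n ^ (0.6 : ℝ) ≤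
      (ePair Γ (P i ∩ S.splitSets j) (P i' ∩ S.splitSets j) : ℝ)
  edges_inside : ∀ Γ ∈ S.splitGraphs, ∀ i j,
    q i ^ 2 * (eInside Γ (S.splitSets j) : ℝ) - (S.k : ℝ) ^ (0.6 : ℝ) * S.n ^ (0.6 : ℝ) ≤
      (eInside Γ (P i ∩ S.splitSets j) : ℝ)

end Setup

/-- The objects of the splitting setting: the proportions `p`, the partition `P`, and the
exceptional objects. -/
structure Splitting (V : Type*) where
  p : Fin 3 → ℝ
  P : Fin 3 → Set V
  exV : Set V
  exSides : Set (Set V)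
  exClusters : Set (Set V)

/-- The splitting setting. All requirements of `SplitsWith` are lower bounds; they hold for
proportions that are at least `p 0, p 1, p 2` and add up to one. -/
structure SplittingSetting {V : Type*} (S : Setup V) (T : Splitting V) : Prop where
  p_ge : ∀ i, S.η / 100 ≤ T.p i
  splits : ∃ q : Fin 3 → ℝ, (∀ i, T.p i ≤ q i) ∧ ∑ i, q i = 1 ∧
    S.SplitsWith T.P T.exV T.exSides T.exClusters q

section Configurations

variable {V : Type*} (S : Setup V) (T : Splitting V)

/-- The partners of the exceptional sides. -/
def exPartners : Set (Set V) :=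
  {Y | ∃ p ∈ S.MAB, (p.1 ∈ T.exSides ∧ Y = p.2) ∨ (p.2 ∈ T.exSides ∧ Y = p.1)}

/-- The set `𝔽`. -/
def FF : Set V :=
  shadow S.GD (⋃₀ T.exSides ∪ ⋃₀ exPartners S T ∪ ⋃₀ T.exClusters) (S.η ^ 2 * S.k / 10 ^ 10)

/-- The part of `P 0` in which the sets of the preconfigurations have to lie. -/
def P0clean : Set V :=
  T.P 0 \ (FF S T ∪ shadow S.GD S.VnoH (S.η ^ 2 * S.k / 10 ^ 5))

/-- Preconfiguration (heart 1), with its cover as an argument. -/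
structure Heart1With (γ' h : ℝ) (V0 V1 : Set V) (F : Set (Set V)) : Prop where
  ne0 : V0.Nonempty
  ne1 : V1.Nonempty
  sub0 : V0 ⊆ P0clean S T
  sub1 : V1 ⊆ P0clean S T
  deg0 : ∀ v ∈ V0, h / 2 ≤ (deg S.Gcap v (S.Vgood ∩ T.P 2) : ℝ)
  deg1 : ∀ v ∈ V1, h ≤ (deg S.Gcap v (S.Vgood ∩ T.P 2) : ℝ)
  cover : IsCover S.MAB F
  deg_cover : ∀ v ∈ V1, (deg S.Gcap v (⋃₀ F) : ℝ) ≤ γ' * S.k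

def Heart1 (γ' h : ℝ) (V0 V1 : Set V) : Prop := ∃ F, Heart1With S T γ' h V0 V1 F

/-- Preconfiguration (heart 2). -/
structure Heart2 (h : ℝ) (V0 V1 : Set V) : Prop where
  ne0 : V0.Nonempty
  ne1 : V1.Nonempty
  sub0 : V0 ⊆ P0clean S T
  sub1 : V1 ⊆ P0clean S T
  deg : ∀ v ∈ V0 ∪ V1, h ≤ (deg S.Gcap v (S.Vgood ∩ T.P 2) : ℝ)

/-- Preconfiguration (exp). -/
structure PreExp (β : ℝ) (V0 V1 : Set V) : Prop where
  ne0 : V0.Nonempty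
  ne1 : V1.Nonempty
  sub0 : V0 ⊆ T.P 0
  sub1 : V1 ⊆ T.P 0
  deg0 : ∀ v ∈ V0, β * S.k ≤ (deg S.Gexp v V1 : ℝ)
  deg1 : ∀ v ∈ V1, β * S.k ≤ (deg S.Gexp v V0 : ℝ)

/-- Preconfiguration (reg); super-regularity is with respect to all edges of `G`. -/
def PreReg (ε d μ : ℝ) (V0 V1 : Set V) : Prop :=
  V0.Nonempty ∧ V1.Nonempty ∧ V0 ⊆ T.P 0 ∧ V1 ⊆ T.P 0 ∧
  ∃ Q : Set (Set V × Set V), Q.Nonempty ∧ V0 = verts1 Q ∧ V1 = verts2 Q ∧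
    (∀ p ∈ Q, ∀ q ∈ Q, p ≠ q → Disjoint (p.1 ∪ p.2) (q.1 ∪ q.2)) ∧
    (∀ p ∈ Q, SuperRegularPair S.G ε d p.1 p.2) ∧
    ∀ p ∈ Q, μ * S.k ≤ (p.1.ncard : ℝ) ∧ μ * S.k ≤ (p.2.ncard : ℝ)

/-- Configuration (diamond 6). -/
def Conf6 (δ ε d μ γ' h2 : ℝ) : Prop :=
  ∃ V0 V1 V2 V3 : Set V,
    (PreReg S T ε d μ V0 V1 ∨ PreExp S T δ V0 V1) ∧
    (Heart1 S T γ' h2 V0 V1 ∨ Heart2 S T h2 V0 V1) ∧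
    V2.Nonempty ∧ V3.Nonempty ∧ V2 ⊆ T.P 1 ∧ V3 ⊆ T.P 1 ∧
    (∀ v ∈ V1, δ * S.k ≤ (deg S.G v V2 : ℝ)) ∧
    (∀ v ∈ V2, δ * S.k ≤ (deg S.G v V1 : ℝ)) ∧
    (∀ v ∈ V2, δ * S.k ≤ (deg S.Gexp v V3 : ℝ)) ∧
    (∀ v ∈ V3, δ * S.k ≤ (deg S.Gexp v V2 : ℝ))

/-- Configuration (diamond 7). -/
def Conf7 (δ ρ' ε d μ γ' h2 : ℝ) : Prop :=
  ∃ V0 V1 V2 V3 : Set V,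
    PreReg S T ε d μ V0 V1 ∧
    (Heart1 S T γ' h2 V0 V1 ∨ Heart2 S T h2 V0 V1) ∧
    V2.Nonempty ∧ V3.Nonempty ∧ V2 ⊆ (S.E ∩ T.P 1) \ T.exV ∧ V3 ⊆ T.P 1 ∧
    (∀ v ∈ V1, δ * S.k ≤ (deg S.G v V2 : ℝ)) ∧
    (∀ v ∈ V2, δ * S.k ≤ (deg S.G v V1 : ℝ)) ∧
    (∀ v ∈ V2, (deg S.GD v (T.P 1 \ V3) : ℝ) < ρ' * S.k) ∧
    (∀ v ∈ V3, δ * S.k ≤ (deg S.GD v V2 : ℝ))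

/-- Configuration (diamond 8). -/
def Conf8 (δ ρ' ε1 ε2 d1 d2 μ1 μ2 h1 h2 : ℝ) : Prop :=
  ∃ V0 V1 V2 V3 V4 : Set V, ∃ N : Set (Set V × Set V),
    PreReg S T ε2 d2 μ2 V0 V1 ∧ Heart2 S T h2 V0 V1 ∧
    V2.Nonempty ∧ V3.Nonempty ∧ V4.Nonempty ∧
    V2 ⊆ T.P 0 ∧ V3 ⊆ T.P 1 ∧ V4 ⊆ T.P 1 ∧ V3 ⊆ S.E \ T.exV ∧
    RegMatching S.GD ε1 d1 (μ1 * S.k) N ∧ AbsorbedBy N (S.MAB \ S.Natom) ∧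
    vertsOf N ⊆ T.P 1 \ V3 ∧
    (∀ v ∈ V1, δ * S.k ≤ (deg S.G v V2 : ℝ)) ∧
    (∀ v ∈ V2, δ * S.k ≤ (deg S.G v V1 : ℝ)) ∧
    (∀ v ∈ V2, δ * S.k ≤ (deg S.Gcap v V3 : ℝ)) ∧
    (∀ v ∈ V3, δ * S.k ≤ (deg S.Gcap v V2 : ℝ)) ∧
    (∀ v ∈ V3, (deg S.GD v (T.P 1 \ V4) : ℝ) < ρ' * S.k) ∧
    (∀ v ∈ V4, δ * S.k ≤ (deg S.GD v V3 : ℝ)) ∧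
    (∀ v ∈ V2, h1 ≤ (deg S.GD v V3 : ℝ) + (deg S.Greg v (vertsOf N) : ℝ))

/-- Configuration (diamond 9). -/
def Conf9 (δ γ' h1 h2 ε1 d1 μ1 ε2 d2 μ2 : ℝ) : Prop :=
  ∃ V0 V1 V2 : Set V, ∃ F : Set (Set V), ∃ N : Set (Set V × Set V),
    Heart1With S T γ' h2 V0 V1 F ∧
    RegMatching S.GD ε1 d1 (μ1 * S.k) N ∧ AbsorbedBy N S.MAB ∧ vertsOf N ⊆ T.P 1 ∧
    PreReg S T ε2 d2 μ2 V0 V1 ∧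
    V2 ⊆ vertsOf N \ ⋃₀ F ∧ vertsOf N \ ⋃₀ F ⊆ ⋃₀ S.clusters ∧
    (∀ v ∈ V1, h1 ≤ (deg S.GD v V2 : ℝ)) ∧
    (∀ v ∈ V2, δ * S.k ≤ (deg S.GD v V1 : ℝ))

/-- `(Γ, 𝒱)` is an `(ε,d,ℓ₁,ℓ₂)`-regularized graph, with vertex set `⋃ 𝒱`. In the last condition
the neighbourhood of `X` is taken as the union of all members of `𝒱` that send an edge to `X`. -/
structure RegularizedGraph (Γ : SimpleGraph V) (𝒱 : Set (Set V)) (ε d l1 l2 : ℝ) : Prop where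
  supp : Γ.support ⊆ ⋃₀ 𝒱
  disj : ∀ X ∈ 𝒱, ∀ Y ∈ 𝒱, X ≠ Y → Disjoint X Y
  size : ∀ X ∈ 𝒱, l1 ≤ (X.ncard : ℝ)
  indep : ∀ X ∈ 𝒱, ∀ x ∈ X, ∀ y ∈ X, ¬ Γ.Adj x y
  regular : ∀ X ∈ 𝒱, ∀ Y ∈ 𝒱, X ≠ Y →
    RegularPair Γ ε X Y ∧ (density Γ X Y = 0 ∨ d ≤ density Γ X Y)
  nbhd : ∀ X ∈ 𝒱, ((⋃₀ {Y | Y ∈ 𝒱 ∧ ∃ x ∈ X, ∃ y ∈ Y, Γ.Adj x y}).ncard : ℝ) ≤ l2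

/-- Configuration (diamond 10). -/
def Conf10 (ε d l1 l2 η' : ℝ) : Prop :=
  ∃ (Γ : SimpleGraph V) (𝒱 : Set (Set V)) (N : Set (Set V × Set V)) (𝓛 : Set (Set V))
    (A B : Set V),
    Γ ≤ S.G ∧ RegularizedGraph Γ 𝒱 ε d l1 l2 ∧
    RegMatching Γ ε d l1 N ∧ sidesOf N ⊆ 𝒱 ∧
    𝓛 ⊆ 𝒱 ∧ A ∈ 𝒱 ∧ B ∈ 𝒱 ∧ A ≠ B ∧
    (∃ a ∈ A, ∃ b ∈ B, Γ.Adj a b) ∧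
    (∀ X, X = A ∨ X = B →
      ({v | v ∈ X ∧ (deg Γ v (vertsOf N ∪ ⋃₀ 𝓛) : ℝ) < (1 + η') * S.k}.ncard : ℝ)
        ≤ ε * (X.ncard : ℝ)) ∧
    (∀ X ∈ 𝓛,
      ({v | v ∈ X ∧ (deg Γ v Set.univ : ℝ) < (1 + η') * S.k}.ncard : ℝ) ≤ ε * (X.ncard : ℝ))

/-! ### The hypotheses on the matching -/

/-- Type (M1). -/
def TypeM1 (M : Set (Set V × Set V)) : Prop :=
  RegMatching S.G (10 ^ 5 * S.εp / S.η ^ 2) (S.γ ^ 2 / 4)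
    (S.η ^ 2 * S.𝔠 / (8 * 10 ^ 3 * S.k) * S.k) M ∧
  AbsorbedUpToSwap M S.Mgood

/-- Type (M2): all edges of `G` inside the pairs of `M` belong to a cleaned family of dense
spots that absorbs `M`. -/
def TypeM2 (M : Set (Set V × Set V)) : Prop :=
  RegMatching S.G S.π (S.γ ^ 3 * S.ρ / (32 * S.Ωs)) (S.αh * S.ρ / S.Ωs * S.k) M ∧
  ∃ 𝒟' : Set (Spot V), S.CleanedSpots 𝒟' ∧
    (∀ p ∈ M, ∀ x ∈ p.1, ∀ y ∈ p.2, S.G.Adj x y → (spotGraph 𝒟').Adj x y) ∧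
    ∀ p ∈ M, ∃ D ∈ 𝒟', D.Sees p.1 p.2

/-- The vertices with more than `ρk` captured neighbours in `V(Gexp)`. -/
def expShadow : Set V := shadow S.Gcap S.Gexp.support (S.ρ * S.k)

def RR : Set V :=
  shadow S.Gcap ((S.VtoE ∩ S.L) \ vertsOf S.MAB) (2 * S.η ^ 2 * S.k / 10 ^ 5)

/-- Condition (cA) with one of (t1), (t2), (t3), (t5). -/
def CaseA (M : Set (Set V × Set V)) : Prop :=
  vertsOf M ⊆ (S.XA ∩ T.P 0) \ (S.J ∪ T.exV ∪ FF S T) ∧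
  (verts1 M ⊆ expShadow S ∨
   verts1 M ⊆ S.VtoE ∨
   verts1 M ⊆ RR S \ (expShadow S ∪ S.VtoE) ∨
   vertsOf M ⊆ ⋃₀ S.clusters \ (expShadow S ∪ S.VtoE ∪ RR S))

/-- Condition (cB) with one of (t1), (t2), (t3-5). -/
def CaseB (M : Set (Set V × Set V)) : Prop :=
  verts1 M ⊆ (S.XA ∩ T.P 0) \ (S.J ∪ S.J2 ∪ S.J3 ∪ T.exV ∪ FF S T) ∧
  verts2 M ⊆ (S.XB ∩ T.P 0) \ (S.J ∪ T.exV ∪ FF S T) ∧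
  (verts1 M ⊆ expShadow S ∨
   verts1 M ⊆ S.VtoE ∨
   verts1 M ∩ (expShadow S ∪ S.VtoE) = ∅)

end Configurations

end LKS

/-! Every vertex of `verts1 M` lies in `XA` and outside `J`, so it has at least
$(1+\frac{9\eta}{100})k$ captured neighbours in `Vgood` (`deg_Vgood_of_XA`). Where these neighbours
lie decides the configuration. Many of them in the support of `Gexp` give (◇6), and many in the
avoiding set `E` give (◇7). If `E` is reached only through large vertices outside the matchings,
these vertices form an additional layer and (◇8) appears. Otherwise, in case (cB), neighbours in
`XA` are negligible as well, so almost the whole degree goes to $V_{AB}$, and little of it to a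
suitable cover: this is (◇9). In case (cA) with (t5) almost the whole degree is regular and goes to
$V_{AB}$ or to large vertices that themselves send more than $k$ regular edges to $V_{AB}$: this is
(◇10).

Configurations (◇6)–(◇9) need a super-regular beginning inside `M` together with forward and
backward minimum degrees along a chain of sets. Both are obtained at once in `exists_cleaning`, by
an extremal choice of the removed sets. A weighted count of edges pointing forward into removed
vertices, plus a charge for each vertex removed from `M`, stays below a budget that grows only
slightly. Hence less than half of the relevant vertices of `M` can be lost, and some pair of `M`
survives with more than half of its typical vertices. `RegMatching.preReg_survivors` makes the
surviving pairs super-regular, and `UsableMatching.exists_chain` combines the two. What remains in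
each case is a degree count showing that the sets of the chain are seen strongly enough. The
splitting hypotheses transfer these counts to the parts `P 0`, `P 1`, `P 2`. The degrees in (♡1) and
(♡2) come from the part of `Vgood` in `P 2`, and the cover for (♡1) is `coverFamily`, which vertices
outside `J2` and `J3` hardly see.

For (◇10) no cleaning is needed. The regularized graph has as its parts the sides of the matching
pairs and the large remainders of clusters (`pieces`). By regularity the degree into a fixed set is
nearly constant on a cluster (`cluster_homogeneous`), so a few vertices of large degree force almost
all vertices of their piece to have large degree. An edge of `M` between two vertices whose pieces
meet `V(M)` substantially supplies the two parts `A` and `B` (`exists_rich_edge`).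

The two types (M1) and (M2) are used only through `UsableMatching` and through the description of
the edges inside pairs by `adj_of_typeM1` and `adj_of_typeM2`. The hierarchy is used only through
the fact that every $\gg$ gains a hundredth power and a factor $10^{-40}$. -/

namespace LKS

/-! ### Double counting of degrees and edges. -/

section Counting

set_option linter.unusedSectionVars false

variable {V : Type*} [Finite V]

theorem deg_le_deg {Γ Γ' : SimpleGraph V} {v : V} {U U' : Set V}
    (h : ∀ u ∈ U, Γ.Adj v u → u ∈ U' ∧ Γ'.Adj v u) : deg Γ v U ≤ deg Γ' v U' :=
  Set.ncard_le_ncard (fun u hu => h u hu.1 hu.2) (Set.toFinite _)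

theorem deg_mono_right {Γ : SimpleGraph V} {v : V} {U U' : Set V} (h : U ⊆ U') :
    deg Γ v U ≤ deg Γ v U' :=
  deg_le_deg fun _ hu ha => ⟨h hu, ha⟩

theorem deg_mono_left {Γ Γ' : SimpleGraph V} {v : V} {U : Set V} (h : Γ ≤ Γ') :
    deg Γ v U ≤ deg Γ' v U :=
  deg_le_deg fun _ hu ha => ⟨hu, h ha⟩

theorem deg_le_add {Γ Γ₁ Γ₂ : SimpleGraph V} {v : V} {U U₁ U₂ : Set V}
    (h : ∀ u ∈ U, Γ.Adj v u → (u ∈ U₁ ∧ Γ₁.Adj v u) ∨ (u ∈ U₂ ∧ Γ₂.Adj v u)) :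
    deg Γ v U ≤ deg Γ₁ v U₁ + deg Γ₂ v U₂ := by
  refine (Set.ncard_le_ncard (t := {u | u ∈ U₁ ∧ Γ₁.Adj v u} ∪ {u | u ∈ U₂ ∧ Γ₂.Adj v u})
    (fun u hu => h u hu.1 hu.2) (Set.toFinite _)).trans (Set.ncard_union_le _ _)

theorem deg_le_sdiff_add (Γ : SimpleGraph V) (v : V) (A Y : Set V) :
    (deg Γ v A : ℝ) ≤ deg Γ v (A \ Y) + deg Γ v Y := by
  exact_mod_cast deg_le_add fun u hu hadj => by
    by_cases hb : u ∈ Y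
    · exact Or.inr ⟨hb, hadj⟩
    · exact Or.inl ⟨⟨hu, hb⟩, hadj⟩

theorem deg_union_le (Γ : SimpleGraph V) (v : V) (A B : Set V) :
    (deg Γ v (A ∪ B) : ℝ) ≤ deg Γ v A + deg Γ v B := by
  have : deg Γ v (A ∪ B) ≤ deg Γ v A + deg Γ v B :=
    deg_le_add fun u hu hadj => hu.imp (fun h => ⟨h, hadj⟩) fun h => ⟨h, hadj⟩
  exact_mod_cast this

theorem nonempty_of_deg_pos {Γ : SimpleGraph V} {v : V} {A : Set V} (h : 0 < (deg Γ v A : ℝ)) :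
    A.Nonempty := by
  rw [Set.nonempty_iff_ne_empty]
  rintro rfl
  simp [deg] at h

theorem deg_le_ncard (Γ : SimpleGraph V) (v : V) (U : Set V) : deg Γ v U ≤ U.ncard :=
  Set.ncard_le_ncard (fun _ hu => hu.1) (Set.toFinite _)

theorem ncard_setOf_prod (X : Set V) (r : V → Set V) :
    {p : V × V | p.1 ∈ X ∧ p.2 ∈ r p.1}.ncard = ∑ x ∈ X.toFinite.toFinset, (r x).ncard := by
  classical
  have := Fintype.ofFinite V
  rw [Set.ncard_eq_toFinset_card _ (Set.toFinite _),
    Finset.card_eq_sum_card_fiberwise (f := Prod.fst) (t := X.toFinite.toFinset)]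
  · refine Finset.sum_congr rfl fun x hx => ?_
    rw [Set.ncard_eq_toFinset_card _ (Set.toFinite _)]
    symm
    refine Finset.card_bij (fun y _ => (x, y)) ?_ ?_ ?_
    · intro y hy
      simp at hx hy ⊢
      exact ⟨hx, hy⟩
    · intro a _ b _ hab
      exact (Prod.mk.inj hab).2
    · rintro ⟨a, b⟩ hab
      simp at hab ⊢
      obtain ⟨⟨_, h2⟩, rfl⟩ := hab
      exact ⟨rfl, h2⟩
  · intro p hp
    simp at hp ⊢
    exact hp.1

theorem ePair_eq_sum (Γ : SimpleGraph V) (X Y : Set V) :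
    ePair Γ X Y = ∑ x ∈ X.toFinite.toFinset, deg Γ x Y :=
  ncard_setOf_prod X fun x => {y | y ∈ Y ∧ Γ.Adj x y}

theorem ePair_comm (Γ : SimpleGraph V) (X Y : Set V) : ePair Γ X Y = ePair Γ Y X := by
  unfold ePair
  rw [← Set.ncard_image_of_injective _ Prod.swap_injective]
  congr 1
  ext ⟨a, b⟩
  simp only [Set.mem_image, Set.mem_ofPred_eq, Prod.exists, Prod.swap_prod_mk, Prod.mk.injEq]
  constructor
  · rintro ⟨x, y, ⟨h1, h2, h3⟩, rfl, rfl⟩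
    exact ⟨h2, h1, h3.symm⟩
  · rintro ⟨h1, h2, h3⟩
    exact ⟨b, a, ⟨h2, h1, h3.symm⟩, rfl, rfl⟩

theorem ePair_mono {Γ Γ' : SimpleGraph V} {X X' Y Y' : Set V}
    (h : ∀ x ∈ X, ∀ y ∈ Y, Γ.Adj x y → x ∈ X' ∧ y ∈ Y' ∧ Γ'.Adj x y) :
    ePair Γ X Y ≤ ePair Γ' X' Y' :=
  Set.ncard_le_ncard (fun p hp => h p.1 hp.1 p.2 hp.2.1 hp.2.2) (Set.toFinite _)

theorem ePair_congr {Γ Γ' : SimpleGraph V} {X Y : Set V}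
    (h : ∀ x ∈ X, ∀ y ∈ Y, Γ.Adj x y ↔ Γ'.Adj x y) : ePair Γ X Y = ePair Γ' X Y :=
  le_antisymm (ePair_mono fun x hx y hy ha => ⟨hx, hy, (h x hx y hy).1 ha⟩)
    (ePair_mono fun x hx y hy ha => ⟨hx, hy, (h x hx y hy).2 ha⟩)

theorem ePair_le_mul {Γ : SimpleGraph V} {X Y : Set V} {m : ℝ}
    (h : ∀ x ∈ X, (deg Γ x Y : ℝ) ≤ m) : (ePair Γ X Y : ℝ) ≤ X.ncard * m := by
  rw [ePair_eq_sum, Nat.cast_sum, Set.ncard_eq_toFinset_card X, ← nsmul_eq_mul]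
  exact Finset.sum_le_card_nsmul _ _ _ fun x hx => h x (by simpa using hx)

theorem mul_le_ePair {Γ : SimpleGraph V} {X Y : Set V} {m : ℝ}
    (h : ∀ x ∈ X, m ≤ (deg Γ x Y : ℝ)) : X.ncard * m ≤ (ePair Γ X Y : ℝ) := by
  rw [ePair_eq_sum, Nat.cast_sum, Set.ncard_eq_toFinset_card X, ← nsmul_eq_mul]
  exact Finset.card_nsmul_le_sum _ _ _ fun x hx => h x (by simpa using hx)

/-- `X'` may miss more than `v`: removing one vertex can discard a whole pair from `survivors`, and
only the edges at `v` have to be counted. -/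
theorem ePair_add_deg_le {Γ : SimpleGraph V} {X X' Y : Set V} {v : V} (hv : v ∈ X)
    (hv' : v ∉ X') (hX : X' ⊆ X) : ePair Γ X' Y + deg Γ v Y ≤ ePair Γ X Y := by
  classical
  rw [ePair_eq_sum, ePair_eq_sum, add_comm,
    ← Finset.sum_insert (f := fun x => deg Γ x Y) (by simpa using hv')]
  refine Finset.sum_le_sum_of_subset fun x hx => ?_
  simp at hx ⊢
  rcases hx with rfl | hx
  exacts [hv, hX hx]

theorem ePair_insert_le (Γ : SimpleGraph V) (X Y : Set V) (v : V) :
    ePair Γ X (insert v Y) ≤ ePair Γ X Y + deg Γ v X := by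
  classical
  rw [ePair_comm, ePair_comm Γ X Y, ePair_eq_sum, ePair_eq_sum]
  by_cases hv : v ∈ Y
  · rw [Set.insert_eq_of_mem hv]; omega
  · rw [add_comm, ← Finset.sum_insert (f := fun x => deg Γ x X) (by simpa using hv)]
    refine le_of_eq (Finset.sum_congr ?_ fun _ _ => rfl)
    ext; simp

/-- Few vertices have many neighbours in a small set. -/
theorem ncard_many_nbrs_mul_le {Γ : SimpleGraph V} {X Y : Set V} {m Δ : ℝ}
    (hX : ∀ x ∈ X, m ≤ (deg Γ x Y : ℝ)) (hY : ∀ y ∈ Y, (deg Γ y X : ℝ) ≤ Δ) :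
    X.ncard * m ≤ Y.ncard * Δ :=
  (mul_le_ePair hX).trans ((by rw [ePair_comm] : (ePair Γ X Y : ℝ) = ePair Γ Y X).le.trans
    (ePair_le_mul hY))

/-- If every `B i` is at most `c` times as large as `A i`, and the `A i` are disjoint subsets of
`Z`, then the union of the `B i` is at most `c` times as large as `Z`. -/
theorem ncard_biUnion_le_mul {ι : Type*} [Finite ι] (I : Set ι) (A B : ι → Set V) (Z : Set V)
    {c : ℝ} (hc : 0 ≤ c) (hA : ∀ i ∈ I, ∀ j ∈ I, i ≠ j → Disjoint (A i) (A j))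
    (hZ : ∀ i ∈ I, A i ⊆ Z) (h : ∀ i ∈ I, ((B i).ncard : ℝ) ≤ c * (A i).ncard) :
    ((⋃ i ∈ I, B i).ncard : ℝ) ≤ c * Z.ncard := by
  classical
  have := Fintype.ofFinite V
  have := Fintype.ofFinite ι
  have h1 : (⋃ i ∈ I, B i).ncard ≤ ∑ i ∈ I.toFinset, (B i).ncard := by
    have : (⋃ i ∈ I, B i) = ↑(I.toFinset.biUnion fun i => (B i).toFinset) := by
      ext; simp
    rw [this, Set.ncard_coe_finset]
    refine Finset.card_biUnion_le.trans (Finset.sum_le_sum fun i _ => ?_)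
    rw [Set.ncard_eq_toFinset_card']
  have h2 : ∑ i ∈ I.toFinset, (A i).ncard ≤ Z.ncard := by
    have e : ∑ i ∈ I.toFinset, (A i).ncard
        = (I.toFinset.biUnion fun i => (A i).toFinset).card := by
      rw [Finset.card_biUnion]
      · simp [Set.ncard_eq_toFinset_card']
      · intro i hi j hj hij
        rw [Function.onFun, Set.disjoint_toFinset]
        exact hA i (by simpa using hi) j (by simpa using hj) hij
    rw [e, Set.ncard_eq_toFinset_card']
    refine Finset.card_le_card fun x hx => ?_
    simp at hx ⊢
    obtain ⟨i, hi, hx⟩ := hx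
    exact hZ i hi hx
  calc ((⋃ i ∈ I, B i).ncard : ℝ) ≤ ∑ i ∈ I.toFinset, ((B i).ncard : ℝ) := by exact_mod_cast h1
    _ ≤ ∑ i ∈ I.toFinset, c * ((A i).ncard : ℝ) :=
        Finset.sum_le_sum fun i hi => h i (by simpa using hi)
    _ = c * ((∑ i ∈ I.toFinset, (A i).ncard : ℕ) : ℝ) := by rw [Nat.cast_sum, Finset.mul_sum]
    _ ≤ c * Z.ncard := by gcongr

end Counting

end LKS

namespace LKS

/-! ### The cleaning lemma. -/

section Cleaning

set_option linter.unusedSectionVars false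

variable {V : Type*} [Finite V]

/-- The vertices of the first sides that survive the removal of `Z`, where a pair is discarded as
soon as at least half of its first side has been removed. -/
def survivors (M : Set (Set V × Set V)) (Z : Set V) : Set V :=
  {x | ∃ p ∈ M, 2 * (p.1 ∩ Z).ncard < p.1.ncard ∧ x ∈ p.1 ∧ x ∉ Z}

theorem survivors_anti {M : Set (Set V × Set V)} {Z Z' : Set V} (h : Z ⊆ Z') :
    survivors M Z' ⊆ survivors M Z := by
  rintro x ⟨p, hp, hc, hx, hxZ⟩
  have := Set.ncard_le_ncard (Set.inter_subset_inter_right p.1 h) (Set.toFinite _)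
  exact ⟨p, hp, by omega, hx, fun hh => hxZ (h hh)⟩

theorem survivors_subset {M : Set (Set V × Set V)} {Z : Set V} : survivors M Z ⊆ verts1 M := by
  rintro x ⟨p, hp, -, hx, -⟩
  exact ⟨p, hp, hx⟩

/-- Cleaning of a chain `verts1 M`, `X₁`, `X₂`, `X₃` of vertex sets: the sets `Zᵢ` are enlarged to
sets `Yᵢ` such that the surviving vertices send few edges forward to removed vertices, and at
least a given number of edges backward to surviving vertices. -/
theorem exists_cleaning (M : Set (Set V × Set V)) (X₁ X₂ X₃ Z₁ Z₂ Z₃ : Set V)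
    (Γ₀ Γ₁ Γ₂ : SimpleGraph V) (Δ w₁ w₂ g₀ g₁ g₂ δ₁ δ₂ δ₃ B : ℝ)
    (hM : ∀ p ∈ M, ∀ q ∈ M, p ≠ q → Disjoint p.1 q.1)
    (hw₁ : 0 ≤ w₁) (hw₂ : 0 ≤ w₂) (hg₁ : Δ ≤ w₁ * g₁) (hg₂ : w₁ * Δ ≤ w₂ * g₂)
    (hg₀ : 0 ≤ g₀)
    (hδ₁ : 0 ≤ δ₁) (hδ₂ : 0 ≤ δ₂) (hδ₃ : 0 ≤ δ₃)
    (hX₁ : ∀ v ∈ X₁, (deg Γ₀ v Set.univ : ℝ) ≤ Δ) (hX₂ : ∀ v ∈ X₂, (deg Γ₁ v Set.univ : ℝ) ≤ Δ)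
    (hB : (ePair Γ₀ (verts1 M) Z₁ : ℝ) + w₁ * ePair Γ₁ X₁ Z₂ + w₂ * ePair Γ₂ X₂ Z₃ ≤ B)
    (hsmall : B + (δ₁ + w₁ * δ₂ + w₂ * δ₃) * Nat.card V < g₀ * ((verts1 M).ncard / 2)) :
    ∃ Y₀ Y₁ Y₂ Y₃ : Set V, Z₁ ⊆ Y₁ ∧ Z₂ ⊆ Y₂ ∧ Z₃ ⊆ Y₃ ∧
      (∃ p ∈ M, 2 * (p.1 ∩ Y₀).ncard < p.1.ncard) ∧
      (∀ v ∈ survivors M Y₀, (deg Γ₀ v Y₁ : ℝ) < g₀) ∧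
      (∀ v ∈ X₁ \ Y₁, (deg Γ₁ v Y₂ : ℝ) < g₁) ∧
      (∀ v ∈ X₂ \ Y₂, (deg Γ₂ v Y₃ : ℝ) < g₂) ∧
      (∀ v ∈ X₁ \ Y₁, δ₁ ≤ (deg Γ₀ v (survivors M Y₀) : ℝ)) ∧
      (∀ v ∈ X₂ \ Y₂, δ₂ ≤ (deg Γ₁ v (X₁ \ Y₁) : ℝ)) ∧
      (∀ v ∈ X₃ \ Y₃, δ₃ ≤ (deg Γ₂ v (X₂ \ Y₂) : ℝ)) := by
  classical
  -- The left side counts, with weights, the edges from kept vertices forward into removed ones, and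
  -- charges `g₀` per vertex removed from `M`. The right side is the budget, raised by each vertex
  -- removed from the later sets. If a vertex violates one of the required degree conditions,
  -- removing it preserves the inequality.
  let P : Set (Set V × Set V × Set V × Set V) := {Z |
    (ePair Γ₀ (survivors M Z.1) Z.2.1 : ℝ) + w₁ * ePair Γ₁ (X₁ \ Z.2.1) Z.2.2.1
      + w₂ * ePair Γ₂ (X₂ \ Z.2.2.1) Z.2.2.2 + g₀ * Z.1.ncard
      ≤ B + δ₁ * Z.2.1.ncard + w₁ * δ₂ * Z.2.2.1.ncard + w₂ * δ₃ * Z.2.2.2.ncard}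
  have h0 : ((∅, Z₁, Z₂, Z₃) : Set V × Set V × Set V × Set V) ∈ P := by
    have e0 : (ePair Γ₀ (survivors M ∅) Z₁ : ℝ) ≤ ePair Γ₀ (verts1 M) Z₁ := by
      exact_mod_cast ePair_mono fun x hx y hy h => ⟨survivors_subset hx, hy, h⟩
    have e1 : (ePair Γ₁ (X₁ \ Z₁) Z₂ : ℝ) ≤ ePair Γ₁ X₁ Z₂ := by
      exact_mod_cast ePair_mono fun x (hx : x ∈ X₁ \ Z₁) y hy h => ⟨hx.1, hy, h⟩
    have e2 : (ePair Γ₂ (X₂ \ Z₂) Z₃ : ℝ) ≤ ePair Γ₂ X₂ Z₃ := by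
      exact_mod_cast ePair_mono fun x (hx : x ∈ X₂ \ Z₂) y hy h => ⟨hx.1, hy, h⟩
    have e3 := mul_le_mul_of_nonneg_left e1 hw₁
    have e4 := mul_le_mul_of_nonneg_left e2 hw₂
    have e5 : 0 ≤ δ₁ * Z₁.ncard + w₁ * δ₂ * Z₂.ncard + w₂ * δ₃ * Z₃.ncard := by positivity
    rw [Set.mem_ofPred_eq]
    simp only [Set.ncard_empty, Nat.cast_zero, mul_zero, add_zero]
    linarith
  -- By maximality no single vertex can be added to any of the four sets; every degree condition
  -- below is proved by adding the offending vertex.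
  obtain ⟨⟨Y₀, Y₁, Y₂, Y₃⟩, hle, hmax⟩ := (Set.toFinite P).exists_le_maximal h0
  have hY : (ePair Γ₀ (survivors M Y₀) Y₁ : ℝ) + w₁ * ePair Γ₁ (X₁ \ Y₁) Y₂
      + w₂ * ePair Γ₂ (X₂ \ Y₂) Y₃ + g₀ * Y₀.ncard
      ≤ B + δ₁ * Y₁.ncard + w₁ * δ₂ * Y₂.ncard + w₂ * δ₃ * Y₃.ncard := hmax.1
  have hins : ∀ (Y : Set V) v, v ∉ Y → ((insert v Y).ncard : ℝ) = Y.ncard + 1 := fun Y v hv => by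
    rw [Set.ncard_insert_of_notMem hv]; push_cast; rfl
  have hdiff : ∀ X Y : Set V, ∀ v, X \ insert v Y ⊆ X \ Y := fun X Y v x hx =>
    ⟨hx.1, fun h => hx.2 (Set.mem_insert_of_mem v h)⟩
  have hrem : ∀ (Γ : SimpleGraph V) (X Y W : Set V) v, v ∈ X \ Y →
      (ePair Γ (X \ insert v Y) W : ℝ) + deg Γ v W ≤ ePair Γ (X \ Y) W := fun Γ X Y W v hv => by
    have := ePair_add_deg_le (Γ := Γ) (Y := W) hv (fun h => h.2 (Set.mem_insert v Y)) (hdiff X Y v)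
    exact_mod_cast this
  have hadd : ∀ (Γ : SimpleGraph V) (X Y : Set V) v,
      (ePair Γ X (insert v Y) : ℝ) ≤ ePair Γ X Y + deg Γ v X := fun Γ X Y v => by
    exact_mod_cast ePair_insert_le Γ X Y v
  have huniv : ∀ (Γ : SimpleGraph V) (X : Set V) v, (deg Γ v X : ℝ) ≤ deg Γ v Set.univ :=
    fun Γ X v => by exact_mod_cast deg_mono_right (Set.subset_univ X)
  have n0 : ∀ v ∉ Y₀, (insert v Y₀, Y₁, Y₂, Y₃) ∉ P := fun v hv hP =>
    hv ((hmax.2 hP ⟨Set.subset_insert _ _, le_rfl⟩).1 (Set.mem_insert v Y₀))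
  have n1 : ∀ v ∉ Y₁, (Y₀, insert v Y₁, Y₂, Y₃) ∉ P := fun v hv hP =>
    hv ((hmax.2 hP ⟨le_rfl, Set.subset_insert _ _, le_rfl⟩).2.1 (Set.mem_insert v Y₁))
  have n2 : ∀ v ∉ Y₂, (Y₀, Y₁, insert v Y₂, Y₃) ∉ P := fun v hv hP =>
    hv ((hmax.2 hP ⟨le_rfl, le_rfl, Set.subset_insert _ _, le_rfl⟩).2.2.1 (Set.mem_insert v Y₂))
  have n3 : ∀ v ∉ Y₃, (Y₀, Y₁, Y₂, insert v Y₃) ∉ P := fun v hv hP =>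
    hv ((hmax.2 hP ⟨le_rfl, le_rfl, le_rfl, Set.subset_insert _ _⟩).2.2.2 (Set.mem_insert v Y₃))
  refine ⟨Y₀, Y₁, Y₂, Y₃, hle.2.1, hle.2.2.1, hle.2.2.2, ?_, ?_, ?_, ?_, ?_, ?_, ?_⟩
  -- If every pair lost at least half of its first side, then `Y₀` would contain at least half of
  -- `verts1 M`, and the charge `g₀ * Y₀.ncard` alone would exceed the largest possible budget.
  · by_contra! hcon
    have hb : ∀ Y : Set V, (Y.ncard : ℝ) ≤ Nat.card V := fun Y => by
      rw [← Set.ncard_univ]; exact_mod_cast Set.ncard_le_ncard (Set.subset_univ _) (Set.toFinite _)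
    have hv : ((verts1 M).ncard : ℝ) ≤ 2 * Y₀.ncard := by
      have := ncard_biUnion_le_mul M (fun p => p.1 ∩ Y₀) (fun p => p.1) Y₀ (c := 2) (by norm_num)
        (fun p hp q hq hpq => (hM p hp q hq hpq).mono Set.inter_subset_left Set.inter_subset_left)
        (fun p _ => Set.inter_subset_right) (fun p hp => by exact_mod_cast hcon p hp)
      convert this using 4
      ext; simp [verts1]
    have e1 := mul_le_mul_of_nonneg_left (hb Y₁) hδ₁
    have e2 := mul_le_mul_of_nonneg_left (hb Y₂) (mul_nonneg hw₁ hδ₂)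
    have e3 := mul_le_mul_of_nonneg_left (hb Y₃) (mul_nonneg hw₂ hδ₃)
    have e4 := mul_le_mul_of_nonneg_left hv hg₀
    have e5 : (0 : ℝ) ≤ ePair Γ₀ (survivors M Y₀) Y₁ + w₁ * ePair Γ₁ (X₁ \ Y₁) Y₂
      + w₂ * ePair Γ₂ (X₂ \ Y₂) Y₃ := by positivity
    linarith
  -- Removing `v` deletes at least `g₀` forward edges, which pays for its charge `g₀`.
  · intro v hv
    by_contra! hcon
    obtain ⟨p, hp, hpc, hvp, hvY⟩ := hv
    refine n0 v hvY ?_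
    have e0 : (ePair Γ₀ (survivors M (insert v Y₀)) Y₁ : ℝ) + deg Γ₀ v Y₁
        ≤ ePair Γ₀ (survivors M Y₀) Y₁ := by
      have hv : v ∈ survivors M Y₀ := ⟨p, hp, hpc, hvp, hvY⟩
      have hv' : v ∉ survivors M (insert v Y₀) := fun ⟨q, _, _, _, h⟩ => h (Set.mem_insert v Y₀)
      exact_mod_cast ePair_add_deg_le hv hv' (survivors_anti (Set.subset_insert v Y₀))
    rw [Set.mem_ofPred_eq]
    simp only [hins Y₀ v hvY]
    linarith
  -- Putting `v` into `Y₁` creates at most `Δ` edges into `Y₁` and deletes edges of total weight at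
  -- least `w₁ * g₁`, which is at least `Δ`. The weights are chosen for this comparison and for its
  -- analogue one level further.
  · intro v hv
    by_contra! hcon
    refine n1 v hv.2 ?_
    have e0 := hadd Γ₀ (survivors M Y₀) Y₁ v
    have e1 := mul_le_mul_of_nonneg_left (hrem Γ₁ X₁ Y₁ Y₂ v hv) hw₁
    have e2 := (huniv Γ₀ (survivors M Y₀) v).trans (hX₁ v hv.1)
    have e3 := mul_le_mul_of_nonneg_left hcon hw₁
    rw [Set.mem_ofPred_eq]
    simp only [hins Y₁ v hv.2]
    linarith
  · intro v hv
    by_contra! hcon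
    refine n2 v hv.2 ?_
    have e0 := mul_le_mul_of_nonneg_left (hadd Γ₁ (X₁ \ Y₁) Y₂ v) hw₁
    have e1 := mul_le_mul_of_nonneg_left (hrem Γ₂ X₂ Y₂ Y₃ v hv) hw₂
    have e2 := mul_le_mul_of_nonneg_left ((huniv Γ₁ (X₁ \ Y₁) v).trans (hX₂ v hv.1)) hw₁
    have e3 := mul_le_mul_of_nonneg_left hcon hw₂
    have e4 := mul_nonneg hw₁ hδ₂
    rw [Set.mem_ofPred_eq]
    simp only [hins Y₂ v hv.2]
    linarith
  -- With fewer than `δ₁` surviving neighbours behind it, `v` creates fewer than `δ₁` edges into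
  -- `Y₁`, and the budget grows by `δ₁`. The two levels below are analogous, with the weights `w₁`
  -- and `w₂`.
  · intro v hv
    by_contra! hcon
    refine n1 v hv.2 ?_
    have e0 := hadd Γ₀ (survivors M Y₀) Y₁ v
    have e1 := mul_le_mul_of_nonneg_left (hrem Γ₁ X₁ Y₁ Y₂ v hv) hw₁
    have e2 : 0 ≤ w₁ * deg Γ₁ v Y₂ := by positivity
    rw [Set.mem_ofPred_eq]
    simp only [hins Y₁ v hv.2]
    linarith
  · intro v hv
    by_contra! hcon
    refine n2 v hv.2 ?_
    have e0 := mul_le_mul_of_nonneg_left (hadd Γ₁ (X₁ \ Y₁) Y₂ v) hw₁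
    have e1 := mul_le_mul_of_nonneg_left (hrem Γ₂ X₂ Y₂ Y₃ v hv) hw₂
    have e2 := mul_le_mul_of_nonneg_left hcon.le hw₁
    have e3 : 0 ≤ w₂ * deg Γ₂ v Y₃ := by positivity
    rw [Set.mem_ofPred_eq]
    simp only [hins Y₂ v hv.2]
    linarith
  · intro v hv
    by_contra! hcon
    refine n3 v hv.2 ?_
    have e0 := mul_le_mul_of_nonneg_left (hadd Γ₂ (X₂ \ Y₂) Y₃ v) hw₂
    have e2 := mul_le_mul_of_nonneg_left hcon.le hw₂
    rw [Set.mem_ofPred_eq]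
    simp only [hins Y₃ v hv.2]
    linarith

end Cleaning

end LKS

namespace LKS

/-! ### Regular pairs, and super-regular pairs inside a regularized matching. -/

section Regularity

variable {V : Type*} [Finite V]

set_option linter.unusedSectionVars false

theorem density_comm (Γ : SimpleGraph V) (U W : Set V) : density Γ U W = density Γ W U := by
  rw [density, density, ePair_comm, mul_comm]

theorem density_nonneg (Γ : SimpleGraph V) (U W : Set V) : 0 ≤ density Γ U W := by
  unfold density; positivity

theorem RegularPair.symm {Γ : SimpleGraph V} {ε : ℝ} {U W : Set V} (h : RegularPair Γ ε U W) :
    RegularPair Γ ε W U := by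
  refine ⟨h.1.symm, fun W' U' hW hU hWc hUc => ?_⟩
  rw [density_comm, density_comm Γ W']
  exact h.2 U' W' hU hW hUc hWc

theorem density_congr {Γ Γ' : SimpleGraph V} {X Y : Set V}
    (h : ∀ x ∈ X, ∀ y ∈ Y, Γ.Adj x y ↔ Γ'.Adj x y) : density Γ X Y = density Γ' X Y := by
  rw [density, density, ePair_congr h]

theorem RegularPair.congr {Γ Γ' : SimpleGraph V} {ε : ℝ} {X Y : Set V} (hr : RegularPair Γ ε X Y)
    (h : ∀ x ∈ X, ∀ y ∈ Y, Γ.Adj x y ↔ Γ'.Adj x y) : RegularPair Γ' ε X Y := by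
  refine ⟨hr.1, fun U' W' hU hW hUc hWc => ?_⟩
  rw [← density_congr h, ← density_congr fun x hx y hy => h x (hU hx) y (hW hy)]
  exact hr.2 U' W' hU hW hUc hWc

theorem RegularPair.sub_density {Γ : SimpleGraph V} {ε c : ℝ} {U W U' W' : Set V}
    (h : RegularPair Γ ε U W) (hc : ε ≤ c) (hU : U' ⊆ U) (hW : W' ⊆ W)
    (hUc : c * U.ncard ≤ U'.ncard) (hWc : c * W.ncard ≤ W'.ncard) :
    |density Γ U W - density Γ U' W'| < ε :=
  h.2 U' W' hU hW (le_trans (by gcongr) hUc) (le_trans (by gcongr) hWc)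

/-- Large subsets of the sides of a regular pair form a regular pair. -/
theorem RegularPair.sub {Γ : SimpleGraph V} {ε ε' c : ℝ} {U W U' W' : Set V}
    (h : RegularPair Γ ε U W) (hε : 0 ≤ ε') (hc : ε ≤ c) (hU : U' ⊆ U) (hW : W' ⊆ W)
    (hUc : c * U.ncard ≤ U'.ncard) (hWc : c * W.ncard ≤ W'.ncard)
    (h2 : 2 * ε ≤ ε') (hε' : ε ≤ ε' * c) : RegularPair Γ ε' U' W' := by
  refine ⟨h.1.mono hU hW, fun U'' W'' hU'' hW'' hUc'' hWc'' => ?_⟩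
  have aux : ∀ {X X' X'' : Set V}, c * X.ncard ≤ X'.ncard → ε' * X'.ncard ≤ X''.ncard →
      ε * X.ncard ≤ X''.ncard := fun {X X' X''} h1 h2 => by
    have e1 := mul_le_mul_of_nonneg_left h1 hε
    have e2 := mul_le_mul_of_nonneg_right hε' (Nat.cast_nonneg (α := ℝ) X.ncard)
    nlinarith
  have h3 := h.2 U'' W'' (hU''.trans hU) (hW''.trans hW) (aux hUc hUc'') (aux hWc hWc'')
  have h4 := h.sub_density hc hU hW hUc hWc
  rw [abs_lt] at *
  constructor <;> linarith

/-- Few vertices of one side of a regular pair have small degree into a large subset of the other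
side. -/
theorem RegularPair.few_small_deg {Γ : SimpleGraph V} {ε d : ℝ} {U W W' : Set V}
    (h : RegularPair Γ ε U W) (hε : 0 < ε) (hd : d ≤ density Γ U W) (hU : U.Nonempty)
    (hW : W.Nonempty) (hW' : W' ⊆ W) (hWc : ε * W.ncard ≤ W'.ncard) :
    ({u | u ∈ U ∧ (deg Γ u W' : ℝ) < (d - ε) * W'.ncard}.ncard : ℝ) < ε * U.ncard := by
  by_contra! hcon
  set B := {u | u ∈ U ∧ (deg Γ u W' : ℝ) < (d - ε) * W'.ncard} with hB
  have h1 := h.2 B W' (fun u hu => hu.1) hW' hcon hWc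
  have hUp : (0 : ℝ) < U.ncard := by exact_mod_cast hU.ncard_pos
  have hWp : (0 : ℝ) < W.ncard := by exact_mod_cast hW.ncard_pos
  have hBp : (0 : ℝ) < B.ncard := lt_of_lt_of_le (by positivity) hcon
  have hW'p : (0 : ℝ) < W'.ncard := lt_of_lt_of_le (by positivity) hWc
  have h2 : (ePair Γ B W' : ℝ) ≤ B.ncard * ((d - ε) * W'.ncard) :=
    ePair_le_mul fun x hx => hx.2.le
  have h3 : density Γ B W' ≤ d - ε := by
    unfold density
    rw [div_le_iff₀ (by positivity)]
    linarith
  rw [abs_lt] at h1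
  linarith [h1.2]

theorem ncard_sdiff_add {X Y : Set V} (h : Y ⊆ X) :
    ((X \ Y).ncard : ℝ) + Y.ncard = X.ncard := by
  exact_mod_cast Set.ncard_sdiff_add_ncard_of_subset h (Set.toFinite _)

/-- The vertices of `A'` are already typical towards `B`, so only `B` has to be cleaned. It loses
fewer than `ε * B.ncard` vertices that see little of `A'`; this costs each vertex of `A'` at most `ε
* B.ncard` more, whence the `2 * ε` between `d'` and `d`. -/
theorem RegularPair.exists_superRegular {Γ : SimpleGraph V} {ε ε' d d' : ℝ} {A B A' : Set V}
    (h : RegularPair Γ ε A B) (hε : 0 < ε) (hε1 : ε ≤ 1 / 10) (hε' : 4 * ε ≤ ε')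
    (hd : d ≤ density Γ A B) (hd0 : 0 ≤ d') (hd' : d' + 2 * ε ≤ d)
    (hA : A.Nonempty) (hB : B.Nonempty)
    (hA' : ∀ a ∈ A', a ∈ A ∧ (d - ε) * B.ncard ≤ (deg Γ a B : ℝ))
    (hAc : 2 / 5 * (A.ncard : ℝ) ≤ A'.ncard) :
    ∃ B' ⊆ B, 2 / 5 * (B.ncard : ℝ) ≤ B'.ncard ∧ SuperRegularPair Γ ε' d' B' A' := by
  have hA'A : A' ⊆ A := fun a ha => (hA' a ha).1
  have hεA : ε * (A.ncard : ℝ) ≤ A'.ncard := le_trans (by gcongr; linarith) hAc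
  set Bad := {b | b ∈ B ∧ (deg Γ b A' : ℝ) < (d - ε) * A'.ncard} with hBad
  have hbad : (Bad.ncard : ℝ) < ε * B.ncard :=
    h.symm.few_small_deg hε (by rwa [density_comm]) hB hA hA'A hεA
  have hsub : Bad ⊆ B := fun b hb => hb.1
  have hc := ncard_sdiff_add hsub
  have hBpos : (0 : ℝ) < B.ncard := by exact_mod_cast hB.ncard_pos
  have hεB : ε * (B.ncard : ℝ) ≤ 1 / 10 * B.ncard := by gcongr
  have hBc : 2 / 5 * (B.ncard : ℝ) ≤ (B \ Bad).ncard := by linarith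
  refine ⟨B \ Bad, Set.sdiff_subset, hBc, ?_, ?_, ?_⟩
  · exact h.symm.sub (c := 2 / 5) (by linarith) (by linarith) Set.sdiff_subset hA'A hBc hAc
      (by linarith) (by linarith)
  · intro b hb
    have : ¬ (deg Γ b A' : ℝ) < (d - ε) * A'.ncard := fun hh => hb.2 ⟨hb.1, hh⟩
    have h2 : d' * (A'.ncard : ℝ) ≤ (d - ε) * A'.ncard := by gcongr; linarith
    linarith
  · intro a ha
    have h1 : (deg Γ a B : ℝ) ≤ deg Γ a (B \ Bad) + deg Γ a Bad := by
      exact_mod_cast deg_le_add fun u hu hadj => by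
        by_cases hb : u ∈ Bad
        · exact Or.inr ⟨hb, hadj⟩
        · exact Or.inl ⟨⟨hu, hb⟩, hadj⟩
    have h2 : (deg Γ a Bad : ℝ) ≤ Bad.ncard := by exact_mod_cast deg_le_ncard Γ a Bad
    have h3 := (hA' a ha).2
    have h4 : d' * ((B \ Bad).ncard : ℝ) ≤ d' * B.ncard := by
      gcongr
      · exact Set.toFinite _
      · exact Set.sdiff_subset
    have h5 : (d' + 2 * ε) * (B.ncard : ℝ) ≤ d * B.ncard := by gcongr
    linarith

/-- The pairs of `M`, with the vertices of small degree removed from the first sides. -/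
def typicalPairs (Γ : SimpleGraph V) (ε d : ℝ) (M : Set (Set V × Set V)) : Set (Set V × Set V) :=
  (fun p => ({a | a ∈ p.1 ∧ (d - ε) * p.2.ncard ≤ (deg Γ a p.2 : ℝ)}, p.2)) '' M

theorem verts1_typicalPairs_subset {Γ : SimpleGraph V} {ε d : ℝ} {M : Set (Set V × Set V)} :
    verts1 (typicalPairs Γ ε d M) ⊆ verts1 M := by
  rintro x ⟨_, ⟨p, hp, rfl⟩, hx⟩
  exact ⟨p, hp, hx.1⟩

theorem RegMatching.nonempty_sides {Γ : SimpleGraph V} {ε d l : ℝ} {M : Set (Set V × Set V)}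
    (hM : RegMatching Γ ε d l M) (hd : 0 < d) {p : Set V × Set V} (hp : p ∈ M) :
    p.1.Nonempty ∧ p.2.Nonempty := by
  have h := hd.trans_le (hM.dense p hp)
  constructor <;> rw [Set.nonempty_iff_ne_empty] <;> intro h0 <;> simp [density, h0] at h

theorem RegMatching.few_atypical {Γ : SimpleGraph V} {ε d l : ℝ} {M : Set (Set V × Set V)}
    (hM : RegMatching Γ ε d l M) (hε : 0 < ε) (hd : 0 < d) {p : Set V × Set V} (hp : p ∈ M) :
    (1 - ε) * (p.1.ncard : ℝ) ≤
      {a | a ∈ p.1 ∧ (d - ε) * p.2.ncard ≤ (deg Γ a p.2 : ℝ)}.ncard := by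
  obtain ⟨h1, h2⟩ := hM.nonempty_sides hd hp
  by_cases hε1 : ε ≤ 1
  · have h3 := (hM.regular p hp).few_small_deg hε (hM.dense p hp) h1 h2 (subset_refl _)
      (by nlinarith [(Nat.cast_nonneg p.2.ncard : (0 : ℝ) ≤ _)])
    have h4 : {a | a ∈ p.1 ∧ (d - ε) * p.2.ncard ≤ (deg Γ a p.2 : ℝ)} =
        p.1 \ {a | a ∈ p.1 ∧ (deg Γ a p.2 : ℝ) < (d - ε) * p.2.ncard} := by
      ext a
      simp only [Set.mem_ofPred_eq, Set.mem_sdiff, not_and, not_lt]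
      tauto
    rw [h4]
    have h5 := ncard_sdiff_add (X := p.1)
      (Y := {a | a ∈ p.1 ∧ (deg Γ a p.2 : ℝ) < (d - ε) * p.2.ncard}) fun a ha => ha.1
    linarith
  · have : (1 - ε) * (p.1.ncard : ℝ) ≤ 0 :=
      mul_nonpos_of_nonpos_of_nonneg (by linarith) (by positivity)
    exact this.trans (by positivity)

theorem RegMatching.typicalPairs_disj {Γ : SimpleGraph V} {ε d l : ℝ} {M : Set (Set V × Set V)}
    (hM : RegMatching Γ ε d l M) :
    ∀ p ∈ typicalPairs Γ ε d M, ∀ q ∈ typicalPairs Γ ε d M, p ≠ q → Disjoint p.1 q.1 := by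
  rintro _ ⟨p, hp, rfl⟩ _ ⟨q, hq, rfl⟩ hpq
  have : p ≠ q := by rintro rfl; exact hpq rfl
  exact (hM.disj p hp q hq this).1.mono (fun a ha => ha.1) (fun a ha => ha.1)

/-- At least a fifth of the vertices of `M` are in first sides of the pairs of typical vertices. -/
theorem RegMatching.ncard_typical {Γ : SimpleGraph V} {ε d l : ℝ} {M : Set (Set V × Set V)}
    (hM : RegMatching Γ ε d l M) (hε : 0 < ε) (hε1 : ε ≤ 1 / 10) (hd : 0 < d) :
    ((vertsOf M).ncard : ℝ) ≤ 5 * (verts1 (typicalPairs Γ ε d M)).ncard := by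
  have := ncard_biUnion_le_mul M (fun p => {a | a ∈ p.1 ∧ (d - ε) * p.2.ncard ≤ (deg Γ a p.2 : ℝ)})
    (fun p => p.1 ∪ p.2) (verts1 (typicalPairs Γ ε d M)) (c := 5) (by norm_num) ?_ ?_ ?_
  · convert this using 3
    ext x
    simp only [vertsOf, verts1, verts2, Set.mem_union, Set.mem_ofPred_eq, Set.mem_iUnion]
    constructor
    · rintro (⟨p, hp, hx⟩ | ⟨p, hp, hx⟩)
      exacts [⟨p, hp, Or.inl hx⟩, ⟨p, hp, Or.inr hx⟩]
    · rintro ⟨p, hp, hx | hx⟩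
      exacts [Or.inl ⟨p, hp, hx⟩, Or.inr ⟨p, hp, hx⟩]
  · intro p hp q hq hpq
    exact (hM.disj p hp q hq hpq).1.mono (fun a ha => ha.1) (fun a ha => ha.1)
  · intro p hp x hx
    exact ⟨_, ⟨p, hp, rfl⟩, hx⟩
  · intro p hp
    have h1 := hM.few_atypical hε hd hp
    have h2 : ((p.1 ∪ p.2).ncard : ℝ) ≤ p.1.ncard + p.2.ncard := by
      exact_mod_cast Set.ncard_union_le _ _
    rw [← hM.card_eq p hp] at h2
    have h3 : ε * (p.1.ncard : ℝ) ≤ 1 / 10 * p.1.ncard := by gcongr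
    linarith [(Nat.cast_nonneg p.1.ncard : (0 : ℝ) ≤ _)]

/-- The survivors of a cleaning are one side of a preconfiguration (reg). -/
theorem RegMatching.preReg_survivors {S : Setup V} {T : Splitting V} {ε d l ε' d' μ : ℝ}
    {M : Set (Set V × Set V)} {Y : Set V}
    (hM : RegMatching S.G ε d l M) (hε : 0 < ε) (hε1 : ε ≤ 1 / 10) (hε' : 4 * ε ≤ ε')
    (hd0 : 0 ≤ d') (hd' : d' + 2 * ε ≤ d) (hμ : μ * S.k ≤ 2 / 5 * l) (hMP : vertsOf M ⊆ T.P 0)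
    (hY : ∃ p ∈ typicalPairs S.G ε d M, 2 * (p.1 ∩ Y).ncard < p.1.ncard) :
    ∃ V₀ ⊆ verts2 M,
      PreReg S T ε' d' μ V₀ (survivors (typicalPairs S.G ε d M) Y) := by
  classical
  have hd : 0 < d := by linarith
  let A : Set V × Set V → Set V := fun p =>
    {a | a ∈ p.1 ∧ (d - ε) * p.2.ncard ≤ (deg S.G a p.2 : ℝ)}
  let M' := {p | p ∈ M ∧ 2 * (A p ∩ Y).ncard < (A p).ncard}
  have hAsub : ∀ p, A p \ Y ⊆ p.1 := fun p a ha => ha.1.1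
  -- At least nine tenths of the first side are typical and more than half of those survive, that is
  -- more than 9/20 of the side.
  have hcard : ∀ p ∈ M', 2 / 5 * (p.1.ncard : ℝ) ≤ (A p \ Y).ncard := by
    intro p hp
    have h1 : (1 - ε) * (p.1.ncard : ℝ) ≤ (A p).ncard := hM.few_atypical hε hd hp.1
    have h2 : (2 : ℝ) * (A p ∩ Y).ncard < (A p).ncard := by exact_mod_cast hp.2
    have h3 : ((A p \ Y).ncard : ℝ) + (A p ∩ Y).ncard = (A p).ncard := by
      have := Set.ncard_inter_add_ncard_sdiff_eq_ncard (A p) Y (Set.toFinite _)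
      rw [add_comm] at this
      exact_mod_cast this
    have h4 : ε * (p.1.ncard : ℝ) ≤ 1 / 10 * p.1.ncard := by gcongr
    linarith [(Nat.cast_nonneg p.1.ncard : (0 : ℝ) ≤ _)]
  have hex : ∀ p : M', ∃ B' ⊆ p.1.2, 2 / 5 * (p.1.2.ncard : ℝ) ≤ B'.ncard ∧
      SuperRegularPair S.G ε' d' B' (A p.1 \ Y) := by
    rintro ⟨p, hp⟩
    obtain ⟨h1, h2⟩ := hM.nonempty_sides hd hp.1
    exact (hM.regular p hp.1).exists_superRegular hε hε1 hε' (hM.dense p hp.1) hd0 hd' h1 h2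
      (fun a ha => ha.1) (hcard p hp)
  choose B hB1 hB2 hB3 using hex
  -- The sides are interchanged: the survivors lie in the first sides of `M`, and they have to
  -- become the set `V₁` of the preconfiguration, from which the chain continues.
  let Q : Set (Set V × Set V) := Set.range fun p : M' => (B p, A p.1 \ Y)
  have hQ1 : verts1 Q ⊆ verts2 M := by
    rintro x ⟨_, ⟨p, rfl⟩, hx⟩
    exact ⟨p.1, p.2.1, hB1 p hx⟩
  have hQ2 : survivors (typicalPairs S.G ε d M) Y = verts2 Q := by
    ext x
    constructor
    · rintro ⟨_, ⟨p, hp, rfl⟩, hc, hx, hxY⟩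
      exact ⟨_, ⟨⟨p, hp, hc⟩, rfl⟩, hx, hxY⟩
    · rintro ⟨_, ⟨p, rfl⟩, hx⟩
      exact ⟨_, ⟨p.1, p.2.1, rfl⟩, p.2.2, hx.1, hx.2⟩
  have hpos : ∀ {X X' : Set V}, X.Nonempty → 2 / 5 * (X.ncard : ℝ) ≤ X'.ncard → X'.Nonempty := by
    intro X X' hX h
    have h1 : (0 : ℝ) < X.ncard := by exact_mod_cast hX.ncard_pos
    have h2 : (0 : ℝ) < X'.ncard := by linarith
    exact Set.nonempty_of_ncard_ne_zero (by exact_mod_cast h2.ne')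
  obtain ⟨_, ⟨p₀, hp₀, rfl⟩, hc₀⟩ := hY
  have hp₀' : p₀ ∈ M' := ⟨hp₀, hc₀⟩
  obtain ⟨n1, n2⟩ := hM.nonempty_sides hd hp₀
  obtain ⟨a, ha⟩ := hpos n1 (hcard p₀ hp₀')
  obtain ⟨b, hb⟩ := hpos n2 (hB2 ⟨p₀, hp₀'⟩)
  refine ⟨verts1 Q, hQ1, ⟨b, _, ⟨⟨p₀, hp₀'⟩, rfl⟩, hb⟩, ?_, ?_, ?_, Q, ⟨_, ⟨⟨p₀, hp₀'⟩, rfl⟩⟩, rfl,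
    hQ2, ?_, ?_, ?_⟩
  · rw [hQ2]; exact ⟨a, _, ⟨⟨p₀, hp₀'⟩, rfl⟩, ha⟩
  · exact fun x hx => hMP (Or.inr (hQ1 hx))
  · exact fun x hx => hMP (Or.inl (verts1_typicalPairs_subset (survivors_subset hx)))
  · rintro _ ⟨p, rfl⟩ _ ⟨q, rfl⟩ hpq
    have hne : p.1 ≠ q.1 := fun h => hpq (by rw [Subtype.ext h])
    obtain ⟨e1, e2, e3⟩ := hM.disj p.1 p.2.1 q.1 q.2.1 hne
    obtain ⟨-, -, e4⟩ := hM.disj q.1 q.2.1 p.1 p.2.1 hne.symm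
    rw [Set.disjoint_union_left, Set.disjoint_union_right, Set.disjoint_union_right]
    exact ⟨⟨e2.mono (hB1 p) (hB1 q), e4.symm.mono (hB1 p) (hAsub _)⟩,
      e3.mono (hAsub _) (hB1 q), e1.mono (hAsub _) (hAsub _)⟩
  · rintro _ ⟨p, rfl⟩
    exact hB3 p
  · rintro _ ⟨p, rfl⟩
    have h1 := hM.card_ge p.1 p.2.1
    have h2 := hB2 p
    rw [← hM.card_eq p.1 p.2.1] at h2
    exact ⟨by linarith, by linarith [hcard p.1 p.2]⟩

end Regularity

end LKS

namespace LKS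

/-! ### The constants -/

/-- The threshold functions that govern the hierarchy of the constants. -/
noncomputable def thresholds (i : ℕ) (x : Fin i → ℝ) : ℝ := 1 / 10 ^ 40 / 2 * (∏ j, x j) ^ 100

theorem thresholdFamily_thresholds : ThresholdFamily (1 / 10 ^ 40) thresholds := by
  have hc : (1 : ℝ) / 10 ^ 40 ≤ 1 := by norm_num
  constructor
  · intro i x hx
    have h0 : 0 < ∏ j, x j := Finset.prod_pos fun j _ => (hx j).1
    have h1 : ∏ j, x j ≤ 1 := Finset.prod_le_one (fun j _ => (hx j).1.le)
      fun j _ => (hx j).2.le.trans hc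
    refine ⟨by unfold thresholds; positivity, ?_⟩
    unfold thresholds
    have h2 : (∏ j, x j) ^ 100 ≤ 1 := pow_le_one₀ h0.le h1
    calc (1 : ℝ) / 10 ^ 40 / 2 * (∏ j, x j) ^ 100 ≤ 1 / 10 ^ 40 / 2 * 1 := by gcongr
      _ < 1 / 10 ^ 40 := by norm_num
  · intro i x y hx hy hxy
    unfold thresholds
    have : ∏ j, x j ≤ ∏ j, y j := Finset.prod_le_prod (fun j _ => (hx j).1.le) fun j _ => hxy j
    have h0 : 0 ≤ ∏ j, x j := Finset.prod_nonneg fun j _ => (hx j).1.le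
    gcongr

/-- A product of numbers in $(0,1]$ is at most each factor, so a single formula dominates all
previous constants simultaneously. -/
theorem thresholds_le {i : ℕ} {x : Fin i → ℝ} (hx : ∀ j, 0 < x j ∧ x j ≤ 1) (j : Fin i) :
    thresholds i x ≤ x j ^ 100 := by
  have h0 : 0 ≤ ∏ j, x j := Finset.prod_nonneg fun j _ => (hx j).1.le
  have h1 : ∏ j, x j ≤ x j := by
    rw [← Finset.mul_prod_erase _ _ (Finset.mem_univ j)]
    exact mul_le_of_le_one_right (hx j).1.le
      (Finset.prod_le_one (fun j _ => (hx j).1.le) fun j _ => (hx j).2)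
  unfold thresholds
  calc (1 : ℝ) / 10 ^ 40 / 2 * (∏ j, x j) ^ 100 ≤ 1 * (x j) ^ 100 := by
        gcongr
        norm_num
    _ = x j ^ 100 := one_mul _

/-- The consequences of the hierarchy of the constants that are used below. -/
structure SmallConstants (K : Constants) (k : ℕ) (ξ : ℝ) : Prop where
  k_pos : 0 < (k : ℝ)
  η_pos : 0 < K.η
  Ω_pos : 0 < K.Ωs
  ρ_pos : 0 < K.ρ
  γ_pos : 0 < K.γ
  d_pos : 0 < K.d
  ε_pos : 0 < K.ε
  π_pos : 0 < K.π
  αh_pos : 0 < K.αh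
  εp_pos : 0 < K.εp
  ν_pos : 0 < K.ν
  ξ_pos : 0 < ξ
  η_le : K.η ≤ 1 / 10 ^ 40
  Ω_le : K.Ωs⁻¹ ≤ K.η ^ 100
  ρ_le : K.ρ ≤ K.Ωs⁻¹ ^ 100
  γ_le : K.γ ≤ K.ρ ^ 100
  d_le : K.d ≤ K.γ ^ 100
  ε_le : K.ε ≤ K.d ^ 100
  π_le : K.π ≤ K.ε
  αh_le : K.αh ≤ K.π
  εp_le : K.εp ≤ K.αh ^ 100
  ν_le : K.ν ≤ K.εp
  ξ_le : ξ ≤ K.ν ^ 10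
  pow_eq : (k : ℝ) ^ (0.9 : ℝ) = ξ * k
  exp_le : Real.exp (-(k : ℝ) ^ (0.1 : ℝ)) ≤ ξ

/-- With $\xi=k^{-0.1}$ the two error terms of the splitting become $k^{0.9}=\xi k$ and
$e^{-k^{0.1}}\le\xi$, so a single small number replaces them both. -/
theorem Constants.Hierarchy.smallConstants {K : Constants} {k : ℕ}
    (h : K.Hierarchy (1 / 10 ^ 40) thresholds) (hk : K.k0 ≤ (k : ℝ)) :
    SmallConstants K k ((k : ℝ) ^ (-0.1 : ℝ)) := by
  have hη : K.η ≤ 1 := h.η_lt.le.trans (by norm_num)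
  have hΛ0 : 0 < 1 / K.Λ := one_div_pos.2 h.Λ_pos
  have hd0 : 0 < K.d := hΛ0.trans_le h.Λ_le
  have hεp0 : 0 < K.εp := h.ν_pos.trans_le h.ν_le
  have hαh0 : 0 < K.αh := hεp0.trans_le h.εp_le
  have hπ0 : 0 < K.π := hαh0.trans_le h.αh_le
  have hε0 : 0 < K.ε := hπ0.trans_le h.π_le
  have hk0 : 0 < (k : ℝ) := h.k0_pos.trans_le hk
  have one : ∀ {x y : ℝ}, 0 < x → x ≤ 1 → y < x ^ 100 → y ≤ 1 := fun hx0 hx1 hxy =>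
    hxy.le.trans (pow_le_one₀ hx0.le hx1)
  have b1 : ∀ j : Fin 1, 0 < ![K.η] j ∧ ![K.η] j ≤ 1 := by
    intro j; fin_cases j; exact ⟨h.η_pos, hη⟩
  have hΩ := h.Ωs_lt.trans_le (thresholds_le b1 0)
  have hΩp : 0 < 1 / K.Ωs := one_div_pos.2 h.Ωs_pos
  have hΩ1 : 1 / K.Ωs ≤ 1 := one h.η_pos hη hΩ
  have b2 : ∀ j : Fin 2, 0 < ![K.η, 1 / K.Ωs] j ∧ ![K.η, 1 / K.Ωs] j ≤ 1 := by
    intro j; fin_cases j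
    exacts [⟨h.η_pos, hη⟩, ⟨hΩp, hΩ1⟩]
  have hΩs := h.Ωss_lt.trans_le (thresholds_le b2 1)
  have hΩsp : 0 < 1 / K.Ωss := one_div_pos.2 h.Ωss_pos
  have hΩs1 : 1 / K.Ωss ≤ 1 := one hΩp hΩ1 hΩs
  have b3 : ∀ j : Fin 3, 0 < ![K.η, 1 / K.Ωs, 1 / K.Ωss] j ∧
      ![K.η, 1 / K.Ωs, 1 / K.Ωss] j ≤ 1 := by
    intro j; fin_cases j
    exacts [⟨h.η_pos, hη⟩, ⟨hΩp, hΩ1⟩, ⟨hΩsp, hΩs1⟩]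
  have hρ := h.ρ_lt.trans_le (thresholds_le b3 1)
  have hρ1 : K.ρ ≤ 1 := one hΩp hΩ1 hρ
  have b4 : ∀ j : Fin 4, 0 < ![K.η, 1 / K.Ωs, 1 / K.Ωss, K.ρ] j ∧
      ![K.η, 1 / K.Ωs, 1 / K.Ωss, K.ρ] j ≤ 1 := by
    intro j; fin_cases j
    exacts [⟨h.η_pos, hη⟩, ⟨hΩp, hΩ1⟩, ⟨hΩsp, hΩs1⟩, ⟨h.ρ_pos, hρ1⟩]
  have hγ := h.γ_lt.trans_le (thresholds_le b4 3)
  have hγ1 : K.γ ≤ 1 := one h.ρ_pos hρ1 hγ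
  have b5 : ∀ j : Fin 5, 0 < ![K.η, 1 / K.Ωs, 1 / K.Ωss, K.ρ, K.γ] j ∧
      ![K.η, 1 / K.Ωs, 1 / K.Ωss, K.ρ, K.γ] j ≤ 1 := by
    intro j; fin_cases j
    exacts [⟨h.η_pos, hη⟩, ⟨hΩp, hΩ1⟩, ⟨hΩsp, hΩs1⟩, ⟨h.ρ_pos, hρ1⟩, ⟨h.γ_pos, hγ1⟩]
  have hd := h.d_lt.trans_le (thresholds_le b5 4)
  have hd1 : K.d ≤ 1 := one h.γ_pos hγ1 hd
  have hΛ1 : 1 / K.Λ ≤ 1 := h.Λ_le.trans hd1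
  have b7 : ∀ j : Fin 7, 0 < ![K.η, 1 / K.Ωs, 1 / K.Ωss, K.ρ, K.γ, K.d, 1 / K.Λ] j ∧
      ![K.η, 1 / K.Ωs, 1 / K.Ωss, K.ρ, K.γ, K.d, 1 / K.Λ] j ≤ 1 := by
    intro j; fin_cases j
    exacts [⟨h.η_pos, hη⟩, ⟨hΩp, hΩ1⟩, ⟨hΩsp, hΩs1⟩, ⟨h.ρ_pos, hρ1⟩, ⟨h.γ_pos, hγ1⟩, ⟨hd0, hd1⟩,
      ⟨hΛ0, hΛ1⟩]
  have hε := h.ε_lt.trans_le (thresholds_le b7 5)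
  have hε1 : K.ε ≤ 1 := h.ε_le.trans hΛ1
  have hπ1 : K.π ≤ 1 := h.π_le.trans hε1
  have hαh1 : K.αh ≤ 1 := h.αh_le.trans hπ1
  have b10 : ∀ j : Fin 10, 0 < ![K.η, 1 / K.Ωs, 1 / K.Ωss, K.ρ, K.γ, K.d, 1 / K.Λ, K.ε, K.π,
      K.αh] j ∧ ![K.η, 1 / K.Ωs, 1 / K.Ωss, K.ρ, K.γ, K.d, 1 / K.Λ, K.ε, K.π, K.αh] j ≤ 1 := by
    intro j; fin_cases j
    exacts [⟨h.η_pos, hη⟩, ⟨hΩp, hΩ1⟩, ⟨hΩsp, hΩs1⟩, ⟨h.ρ_pos, hρ1⟩, ⟨h.γ_pos, hγ1⟩, ⟨hd0, hd1⟩,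
      ⟨hΛ0, hΛ1⟩, ⟨hε0, hε1⟩, ⟨hπ0, hπ1⟩, ⟨hαh0, hαh1⟩]
  have hεp := h.εp_lt.trans_le (thresholds_le b10 9)
  have hεp1 : K.εp ≤ 1 := h.εp_le.trans hαh1
  have hν1 : K.ν ≤ 1 := h.ν_le.trans hεp1
  have b12 : ∀ j : Fin 12, 0 < ![K.η, 1 / K.Ωs, 1 / K.Ωss, K.ρ, K.γ, K.d, 1 / K.Λ, K.ε, K.π,
      K.αh, K.εp, K.ν] j ∧
      ![K.η, 1 / K.Ωs, 1 / K.Ωss, K.ρ, K.γ, K.d, 1 / K.Λ, K.ε, K.π, K.αh, K.εp, K.ν] j ≤ 1 := by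
    intro j; fin_cases j
    exacts [⟨h.η_pos, hη⟩, ⟨hΩp, hΩ1⟩, ⟨hΩsp, hΩs1⟩, ⟨h.ρ_pos, hρ1⟩, ⟨h.γ_pos, hγ1⟩, ⟨hd0, hd1⟩,
      ⟨hΛ0, hΛ1⟩, ⟨hε0, hε1⟩, ⟨hπ0, hπ1⟩, ⟨hαh0, hαh1⟩, ⟨hεp0, hεp1⟩, ⟨h.ν_pos, hν1⟩]
  have hτ := h.τ_lt.trans_le (thresholds_le b12 11)
  have hτ1 : K.τ ≤ 1 := one h.ν_pos hν1 hτ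
  have b13 : ∀ j : Fin 13, 0 < ![K.η, 1 / K.Ωs, 1 / K.Ωss, K.ρ, K.γ, K.d, 1 / K.Λ, K.ε, K.π,
      K.αh, K.εp, K.ν, K.τ] j ∧
      ![K.η, 1 / K.Ωs, 1 / K.Ωss, K.ρ, K.γ, K.d, 1 / K.Λ, K.ε, K.π, K.αh, K.εp, K.ν, K.τ] j
        ≤ 1 := by
    intro j; fin_cases j
    exacts [⟨h.η_pos, hη⟩, ⟨hΩp, hΩ1⟩, ⟨hΩsp, hΩs1⟩, ⟨h.ρ_pos, hρ1⟩, ⟨h.γ_pos, hγ1⟩, ⟨hd0, hd1⟩,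
      ⟨hΛ0, hΛ1⟩, ⟨hε0, hε1⟩, ⟨hπ0, hπ1⟩, ⟨hαh0, hαh1⟩, ⟨hεp0, hεp1⟩, ⟨h.ν_pos, hν1⟩,
      ⟨h.τ_pos, hτ1⟩]
  have hk1 : 1 / K.k0 < K.ν ^ 100 := h.k0_lt.trans_le (thresholds_le b13 11)
  have hξp : 0 < (k : ℝ) ^ (-0.1 : ℝ) := Real.rpow_pos_of_pos hk0 _
  refine ⟨hk0, h.η_pos, h.Ωs_pos, h.ρ_pos, h.γ_pos, hd0, hε0, hπ0, hαh0, hεp0, h.ν_pos, hξp,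
    h.η_lt.le, by rw [← one_div]; exact hΩ.le, by rw [← one_div]; exact hρ.le, hγ.le, hd.le, hε.le,
    h.π_le, h.αh_le, hεp.le, h.ν_le, ?_, ?_, ?_⟩
  · have h1 : (k : ℝ)⁻¹ ≤ K.ν ^ 100 := by
      rw [← one_div]
      exact (one_div_le_one_div_of_le h.k0_pos hk).trans hk1.le
    have h2 : (k : ℝ) ^ (-0.1 : ℝ) = ((k : ℝ)⁻¹) ^ (0.1 : ℝ) := by
      rw [Real.inv_rpow hk0.le, ← Real.rpow_neg hk0.le]
    rw [h2]
    calc ((k : ℝ)⁻¹) ^ (0.1 : ℝ) ≤ (K.ν ^ 100) ^ (0.1 : ℝ) := by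
          apply Real.rpow_le_rpow (by positivity) h1 (by norm_num)
      _ = K.ν ^ 10 := by
          rw [← Real.rpow_natCast, ← Real.rpow_mul h.ν_pos.le, ← Real.rpow_natCast]
          norm_num
  · rw [← Real.rpow_add_one hk0.ne']
    norm_num
  -- This is $e^x\ge x$ for $x=k^{0.1}$, inverted.
  · rw [show (-0.1 : ℝ) = -(0.1 : ℝ) by norm_num, Real.rpow_neg hk0.le, Real.exp_neg]
    have hp : 0 < (k : ℝ) ^ (0.1 : ℝ) := Real.rpow_pos_of_pos hk0 _
    have := Real.add_one_le_exp ((k : ℝ) ^ (0.1 : ℝ))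
    gcongr
    linarith

/-! ### First consequences of the common setting -/

section Structure

set_option linter.unusedSectionVars false

variable {V : Type*} {S : Setup V}

namespace Setup.CommonSetting

/-- Adjacent clusters lie in the two sides of a dense spot, and every edge of $G-\mathbb H$ between
the two sides of a spot belongs to some spot. -/
theorem Greg_le_GD (hS : S.CommonSetting) : S.Greg ≤ S.GD := by
  intro x y h
  have hb := hS.sparse.bounded
  obtain ⟨C, hC, C', hC', -, hx, hy, hiff, -, -⟩ := hb.reg_edge x y h
  obtain ⟨D, hD, hsee⟩ := hb.reg_spot C hC C' hC' ⟨x, hx, y, hy, h⟩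
  have hG := (hiff x hx y hy).2 h
  rcases hsee with ⟨h1, h2⟩ | ⟨h1, h2⟩
  · exact hb.spots_cover D hD x (h1 hx) y (h2 hy) hG
  · exact (hb.spots_cover D hD y (h2 hy) x (h1 hx) hG.symm).symm

theorem GD_le (hS : S.CommonSetting) : S.GD ≤ deleteVerts S.G S.H := by
  rintro x y ⟨D, hD, h⟩
  exact ((hS.sparse.bounded.spots_dense D hD).le h).1

theorem Gexp_le (hS : S.CommonSetting) : S.Gexp ≤ deleteVerts S.G S.H := hS.sparse.bounded.exp_le

theorem Gcap_le_G (hS : S.CommonSetting) : S.Gcap ≤ S.G := by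
  refine sup_le (sup_le (sup_le ?_ ?_) ?_) ?_
  · exact fun x y h => (hS.GD_le (hS.Greg_le_GD h)).1
  · exact fun x y h => (hS.Gexp_le h).1
  · exact fun x y h => h.1
  · exact fun x y h => (hS.GD_le h.1).1

theorem support_disj (hS : S.CommonSetting) {v : V} (hv : v ∈ S.Gexp.support) : v ∉ S.H := by
  obtain ⟨w, hw⟩ := hv
  exact (hS.Gexp_le hw).2.1

theorem E_disj (hS : S.CommonSetting) {v : V} (hv : v ∈ S.E) : v ∉ S.H := (hS.sparse.bounded.avoid_sub hv).1

theorem E_not_cluster (hS : S.CommonSetting) {v : V} (hv : v ∈ S.E) : v ∉ ⋃₀ S.clusters :=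
  (hS.sparse.bounded.avoid_sub hv).2

theorem cluster_disj (hS : S.CommonSetting) {v : V} (hv : v ∈ ⋃₀ S.clusters) : v ∉ S.H := by
  obtain ⟨C, hC, hv⟩ := hv
  exact hS.sparse.bounded.clusters_sub C hC hv

theorem Greg_cluster (hS : S.CommonSetting) {v w : V} (h : S.Greg.Adj v w) : v ∈ ⋃₀ S.clusters := by
  obtain ⟨C, hC, _, _, -, hx, -⟩ := hS.sparse.bounded.reg_edge v w h
  exact ⟨C, hC, hx⟩

theorem vertsOf_MAB_sub (hS : S.CommonSetting) {v : V} (hv : v ∈ vertsOf S.MAB) :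
    v ∈ ⋃₀ S.clusters ∨ v ∈ S.L ∩ S.E := by
  rcases hv with ⟨p, hp, hv⟩ | ⟨p, hp, hv⟩
  · obtain ⟨C, hC, h⟩ := (hS.pair_cluster p hp).1
    exact Or.inl ⟨C, hC, h hv⟩
  · rcases (hS.pair_cluster p hp).2 with ⟨C, hC, h⟩ | h
    · exact Or.inl ⟨C, hC, h hv⟩
    · exact Or.inr (h hv)

theorem MAB_disj (hS : S.CommonSetting) {v : V} (hv : v ∈ vertsOf S.MAB) : v ∉ S.H := by
  rcases hS.vertsOf_MAB_sub hv with h | h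
  exacts [hS.cluster_disj h, hS.E_disj h.2]

/-- The captured edges outside `H`. -/
theorem Gcap_cases (_ : S.CommonSetting) {v w : V} (h : S.Gcap.Adj v w) (hv : v ∉ S.H) (hw : w ∉ S.H) :
    S.Greg.Adj v w ∨ S.Gexp.Adj v w ∨ S.GD.Adj v w ∧ (v ∈ S.E ∨ w ∈ S.E) := by
  rcases h with ((h | h) | h) | h
  · exact Or.inl h
  · exact Or.inr (Or.inl h)
  · rcases h.2 with h' | h'
    exacts [absurd h'.1 hv, absurd h'.2 hw]
  · exact Or.inr (Or.inr ⟨h.1, h.2.imp (fun h => h.1) fun h => h.2⟩)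

/-- Away from `H`, only the edges of `Gexp` are captured without lying in a dense spot. -/
theorem Gcap_not_support (hS : S.CommonSetting) {v w : V} (h : S.Gcap.Adj v w) (hv : v ∉ S.H) (hw : w ∉ S.H)
    (hs : v ∉ S.Gexp.support ∨ w ∉ S.Gexp.support) : S.GD.Adj v w := by
  rcases hS.Gcap_cases h hv hw with h | h | h
  · exact hS.Greg_le_GD h
  · rcases hs with hs | hs
    exacts [absurd ⟨w, h⟩ hs, absurd ⟨v, h.symm⟩ hs]
  · exact h.1

theorem Gcap_not_E (hS : S.CommonSetting) {v w : V} (h : S.Gcap.Adj v w) (hv : v ∉ S.H) (hw : w ∉ S.H)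
    (hs : v ∉ S.Gexp.support ∨ w ∉ S.Gexp.support) (hvE : v ∉ S.E) (hwE : w ∉ S.E) :
    S.Greg.Adj v w := by
  rcases hS.Gcap_cases h hv hw with h | h | h
  · exact h
  · rcases hs with hs | hs
    exacts [absurd ⟨w, h⟩ hs, absurd ⟨v, h.symm⟩ hs]
  · rcases h.2 with h | h
    exacts [absurd h hvE, absurd h hwE]

variable [Finite V]

theorem deg_le_max (hS : S.CommonSetting) {v : V} (hv : v ∉ S.H) {Γ : SimpleGraph V}
    (hΓ : Γ ≤ S.GD ⊔ S.Gexp ⊔ between S.G S.H Set.univ) (U : Set V) :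
    (deg Γ v U : ℝ) ≤ S.Ωs * S.k := by
  refine le_trans ?_ (hS.sparse.rest_maxDeg v hv)
  exact_mod_cast deg_le_deg fun u _ h => ⟨Set.mem_univ u, hΓ h⟩

theorem Gcap_le_max (hS : S.CommonSetting) : S.Gcap ≤ S.GD ⊔ S.Gexp ⊔ between S.G S.H Set.univ := by
  refine sup_le (sup_le (sup_le ?_ ?_) ?_) ?_
  · exact hS.Greg_le_GD.trans (le_sup_left.trans le_sup_left)
  · exact le_sup_right.trans le_sup_left
  · exact le_sup_right
  · exact fun x y h => Or.inl (Or.inl h.1)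

theorem deg_GD_le (hS : S.CommonSetting) {v : V} (hv : v ∉ S.H) (U : Set V) : (deg S.GD v U : ℝ) ≤ S.Ωs * S.k :=
  hS.deg_le_max hv (le_sup_left.trans le_sup_left) U

theorem deg_Gexp_le (hS : S.CommonSetting) {v : V} (hv : v ∉ S.H) (U : Set V) : (deg S.Gexp v U : ℝ) ≤ S.Ωs * S.k :=
  hS.deg_le_max hv (le_sup_right.trans le_sup_left) U

theorem deleteVerts_Gcap_le (_ : S.CommonSetting) : deleteVerts S.Gcap S.H ≤ S.Gcap := fun _ _ h => h.1

theorem deg_Gcap_le (hS : S.CommonSetting) {v : V} (hv : v ∉ S.H) (U : Set V) :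
    (deg (deleteVerts S.Gcap S.H) v U : ℝ) ≤ S.Ωs * S.k :=
  hS.deg_le_max hv (hS.deleteVerts_Gcap_le.trans hS.Gcap_le_max) U

theorem deg_deleteVerts (_ : S.CommonSetting) {v : V} (hv : v ∉ S.H) {U : Set V} (hU : ∀ u ∈ U, u ∉ S.H) :
    deg (deleteVerts S.Gcap S.H) v U = deg S.Gcap v U :=
  le_antisymm (deg_le_deg fun _ hu h => ⟨hu, h.1⟩) (deg_le_deg fun u hu h => ⟨hu, h, hv, hU u hu⟩)

/-- The vertices of `H` are isolated in `deleteVerts S.Gcap S.H`. -/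
theorem VtoE_disj (_ : S.CommonSetting) (hk : 0 ≤ S.ρ * S.k / (100 * S.Ωs)) {v : V} (hv : v ∈ S.VtoE) : v ∉ S.H := by
  intro hH
  have h : S.ρ * S.k / (100 * S.Ωs) < (deg (deleteVerts S.Gcap S.H) v S.E : ℝ) := hv
  have h0 : deg (deleteVerts S.Gcap S.H) v S.E = 0 := by
    unfold deg
    rw [Set.ncard_eq_zero (Set.toFinite _)]
    ext u
    simp [deleteVerts, hH]
  rw [h0] at h
  norm_num at h
  linarith

end Setup.CommonSetting

end Structure

end LKS

namespace LKS

/-! ### Numerical consequences of the hierarchy. -/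

section NumericBounds

theorem le_pow_of_le_pow {x y : ℝ} {m n : ℕ} (h : x ≤ y ^ n) (h0 : 0 ≤ y) (h1 : y ≤ 1)
    (hm : m ≤ n) : x ≤ y ^ m :=
  h.trans (pow_le_pow_of_le_one h0 h1 hm)

namespace SmallConstants

variable {K : Constants} {k : ℕ} {ξ : ℝ}

theorem η_le_one (sc : SmallConstants K k ξ) : K.η ≤ 1 := sc.η_le.trans (by norm_num)

theorem o_pos (sc : SmallConstants K k ξ) : 0 < K.Ωs⁻¹ := inv_pos.2 sc.Ω_pos

theorem o_le_η (sc : SmallConstants K k ξ) : K.Ωs⁻¹ ≤ K.η := by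
  simpa using le_pow_of_le_pow (m := 1) sc.Ω_le sc.η_pos.le sc.η_le_one (by norm_num)

theorem o_le_one (sc : SmallConstants K k ξ) : K.Ωs⁻¹ ≤ 1 := sc.o_le_η.trans sc.η_le_one

theorem ρ_le_o (sc : SmallConstants K k ξ) : K.ρ ≤ K.Ωs⁻¹ := by
  simpa using le_pow_of_le_pow (m := 1) sc.ρ_le sc.o_pos.le sc.o_le_one (by norm_num)

theorem ρ_le_one (sc : SmallConstants K k ξ) : K.ρ ≤ 1 := sc.ρ_le_o.trans sc.o_le_one

theorem γ_le_ρ (sc : SmallConstants K k ξ) : K.γ ≤ K.ρ := by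
  simpa using le_pow_of_le_pow (m := 1) sc.γ_le sc.ρ_pos.le sc.ρ_le_one (by norm_num)

theorem γ_le_one (sc : SmallConstants K k ξ) : K.γ ≤ 1 := sc.γ_le_ρ.trans sc.ρ_le_one

theorem d_le_γ (sc : SmallConstants K k ξ) : K.d ≤ K.γ := by
  simpa using le_pow_of_le_pow (m := 1) sc.d_le sc.γ_pos.le sc.γ_le_one (by norm_num)

theorem d_le_one (sc : SmallConstants K k ξ) : K.d ≤ 1 := sc.d_le_γ.trans sc.γ_le_one

theorem ε_le_d (sc : SmallConstants K k ξ) : K.ε ≤ K.d := by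
  simpa using le_pow_of_le_pow (m := 1) sc.ε_le sc.d_pos.le sc.d_le_one (by norm_num)

theorem π_le_d (sc : SmallConstants K k ξ) : K.π ≤ K.d := sc.π_le.trans sc.ε_le_d

theorem αh_le_d (sc : SmallConstants K k ξ) : K.αh ≤ K.d := sc.αh_le.trans sc.π_le_d

theorem αh_le_one (sc : SmallConstants K k ξ) : K.αh ≤ 1 := sc.αh_le_d.trans sc.d_le_one

theorem εp_le_αh (sc : SmallConstants K k ξ) : K.εp ≤ K.αh := by
  simpa using le_pow_of_le_pow (m := 1) sc.εp_le sc.αh_pos.le sc.αh_le_one (by norm_num)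

theorem ν_le_αh (sc : SmallConstants K k ξ) : K.ν ≤ K.αh := sc.ν_le.trans sc.εp_le_αh

theorem ν_le_one (sc : SmallConstants K k ξ) : K.ν ≤ 1 := sc.ν_le_αh.trans sc.αh_le_one

theorem d_le_η (sc : SmallConstants K k ξ) : K.d ≤ K.η :=
  sc.d_le_γ.trans (sc.γ_le_ρ.trans (sc.ρ_le_o.trans sc.o_le_η))

theorem ν_le_d (sc : SmallConstants K k ξ) : K.ν ≤ K.d := sc.ν_le_αh.trans sc.αh_le_d

theorem ν_le_η (sc : SmallConstants K k ξ) : K.ν ≤ K.η := sc.ν_le_d.trans sc.d_le_η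

theorem ν_le_π (sc : SmallConstants K k ξ) : K.ν ≤ K.π := sc.ν_le_αh.trans sc.αh_le

theorem ξ_le_η_cube (sc : SmallConstants K k ξ) : ξ ≤ K.η ^ 3 / 10 ^ 40 := by
  have h1 := le_pow_of_le_pow (m := 4) sc.ξ_le sc.ν_pos.le sc.ν_le_one (by norm_num)
  have h2 : K.ν ^ 4 ≤ K.η ^ 4 := by gcongr; exacts [sc.ν_pos.le, sc.ν_le_η]
  have h3 : K.η ^ 4 ≤ K.η ^ 3 / 10 ^ 40 := by
    have := mul_le_mul_of_nonneg_left sc.η_le (pow_nonneg sc.η_pos.le 3)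
    linarith
  linarith

theorem ρ_le_η_cube (sc : SmallConstants K k ξ) : K.ρ ≤ K.η ^ 3 / 10 ^ 40 := by
  have h1 := le_pow_of_le_pow (m := 4) sc.ρ_le sc.o_pos.le sc.o_le_one (by norm_num)
  have h2 : K.Ωs⁻¹ ^ 4 ≤ K.η ^ 4 := by gcongr; exacts [sc.o_pos.le, sc.o_le_η]
  have h3 : K.η ^ 4 ≤ K.η ^ 3 / 10 ^ 40 := by
    have := mul_le_mul_of_nonneg_left sc.η_le (pow_nonneg sc.η_pos.le 3)
    linarith
  linarith

theorem sqrt_γ_le (sc : SmallConstants K k ξ) : √K.γ ≤ K.η ^ 3 / 10 ^ 40 := by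
  have h1 := le_pow_of_le_pow (m := 2) sc.γ_le sc.ρ_pos.le sc.ρ_le_one (by norm_num)
  have h2 : √K.γ ≤ K.ρ := (Real.sqrt_le_left sc.ρ_pos.le).2 h1
  exact h2.trans sc.ρ_le_η_cube

end SmallConstants

end NumericBounds

/-! ### Degrees under the proportional splitting, and the heart preconfigurations. -/

section Splittings

set_option linter.unusedSectionVars false

variable {V : Type*} [Finite V] {S : Setup V} {T : Splitting V}

theorem deg_eq_sum_fiber {ι : Type*} [Fintype ι] (Γ : SimpleGraph V) (v : V) (U : Set V)
    (c : V → ι) : deg Γ v U = ∑ i, deg Γ v (U ∩ c ⁻¹' {i}) := by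
  classical
  have := Fintype.ofFinite V
  unfold deg
  rw [Set.ncard_eq_toFinset_card', Finset.card_eq_sum_card_fiberwise (f := c) (t := Finset.univ)
    (fun _ _ => by simp)]
  refine Finset.sum_congr rfl fun i _ => ?_
  rw [Set.ncard_eq_toFinset_card']
  congr 1
  ext u
  simp
  tauto

/-- The splitting property for the degrees into a union of atoms. -/
theorem Setup.SplitsWith.deg_ge {P : Fin 3 → Set V} {exV : Set V} {exS exC : Set (Set V)}
    {q : Fin 3 → ℝ} (h : S.SplitsWith P exV exS exC q) {Γ : SimpleGraph V} (hΓ : Γ ∈ S.splitGraphs)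
    {v : V} (hvH : v ∉ S.H) (hv : v ∉ exV) {U : Set V} (hUH : ∀ u ∈ U, u ∉ S.H)
    (hU : ∀ u ∈ U, ∀ u' ∉ S.H, (∀ j, u ∈ S.splitSets j ↔ u' ∈ S.splitSets j) → u' ∈ U)
    (i : Fin 3) :
    q i * (deg Γ v U : ℝ) - (S.k : ℝ) ^ (0.9 : ℝ) ≤ (deg Γ v (P i ∩ U) : ℝ) := by
  classical
  -- Each vertex is coloured by the collection of split sets containing it, and `U` is a union of
  -- colour classes outside `H`. There are $2^{12}$ colours, each with an error of $2^{-12}k^{0.9}$,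
  -- so the errors add up to $k^{0.9}$.
  let c : V → Set (Fin 12) := fun u => {j | u ∈ S.splitSets j}
  rw [deg_eq_sum_fiber Γ v U c, deg_eq_sum_fiber Γ v (P i ∩ U) c]
  push_cast
  have hk : (S.k : ℝ) ^ (0.9 : ℝ) =
      ∑ _I : Set (Fin 12), (2 ^ 12)⁻¹ * (S.k : ℝ) ^ (0.9 : ℝ) := by
    rw [Finset.sum_const, Finset.card_univ, Fintype.card_set, Fintype.card_fin, nsmul_eq_mul]
    push_cast
    ring
  rw [hk, Finset.mul_sum, ← Finset.sum_sub_distrib]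
  refine Finset.sum_le_sum fun I _ => ?_
  have hk0 : 0 ≤ (2 ^ 12)⁻¹ * (S.k : ℝ) ^ (0.9 : ℝ) := by positivity
  by_cases hne : (U ∩ c ⁻¹' {I}).Nonempty
  · obtain ⟨u, hu, huI⟩ := hne
    have huI : c u = I := huI
    have hsub : U ∩ c ⁻¹' {I} = S.splitAtom I := by
      ext w
      constructor
      · rintro ⟨hw, hwI⟩
        have hwI : c w = I := hwI
        exact ⟨hUH w hw, fun j => by rw [← hwI]; exact Iff.rfl⟩
      · rintro ⟨hwH, hw⟩
        have hwI : c w = I := by ext j; exact hw j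
        refine ⟨hU u hu w hwH fun j => ?_, hwI⟩
        have := Set.ext_iff.1 (huI.trans hwI.symm) j
        exact this
    rw [Set.inter_assoc, hsub]
    exact h.degree i I v hvH hv Γ hΓ
  · rw [Set.not_nonempty_iff_eq_empty] at hne
    rw [hne]
    have : (deg Γ v ∅ : ℝ) = 0 := by simp [deg]
    rw [this]
    have : (0 : ℝ) ≤ deg Γ v (P i ∩ U ∩ c ⁻¹' {I}) := by positivity
    linarith

theorem Gcap_mem_splitGraphs : deleteVerts S.Gcap S.H ∈ S.splitGraphs := Or.inr (Or.inl rfl)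

theorem Gexp_mem_splitGraphs : S.Gexp ∈ S.splitGraphs := Or.inr (Or.inr (Or.inl rfl))

/-! ### The preconfigurations (heart 1) and (heart 2) -/

/-- Outside `J` the vertex is in `YA` and not in `VnoH`: of its more than $(1+\frac\eta{10})k$
captured neighbours in $V_+\setminus L_\#$, at most $\frac{\eta k}{100}$ lie in `H`. -/
theorem deg_Vgood_of_XA {v : V} (hS : S.CommonSetting) (hv : v ∈ S.XA) (hJ : v ∉ S.J) :
    (1 + 9 * S.η / 100) * S.k ≤ (deg S.Gcap v S.Vgood : ℝ) := by
  simp only [Setup.J, Set.mem_union, not_or] at hJ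
  obtain ⟨⟨⟨⟨⟨h1, h2⟩, h3⟩, h4⟩, h5⟩, h6⟩ := hJ
  have hY : v ∈ S.YA := by by_contra h; exact h1 ⟨hv, h⟩
  have hY1 : (1 + S.η / 10) * S.k < (deg S.Gcap v (S.Vplus \ S.Lsharp) : ℝ) := hY.1
  have hH : (deg S.G v S.H : ℝ) ≤ S.η / 100 * S.k := by
    by_contra! h; exact h3 ⟨Or.inl hv, h⟩
  have hsum : (deg S.Gcap v (S.Vplus \ S.Lsharp) : ℝ) ≤ deg S.Gcap v S.Vgood + deg S.G v S.H := by
    exact_mod_cast deg_le_add fun u (hu : u ∈ S.Vplus \ S.Lsharp) hadj => by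
      by_cases hb : u ∈ S.H
      · exact Or.inr ⟨hb, hS.Gcap_le_G hadj⟩
      · exact Or.inl ⟨⟨hu.1, fun h => h.elim hb hu.2⟩, hadj⟩
  linarith

theorem deg_Vgood_of_XB {v : V} (hS : S.CommonSetting) (hv : v ∈ S.XB) (hJ : v ∉ S.J) :
    (1 / 2 + 4 * S.η / 100) * S.k ≤ (deg S.Gcap v S.Vgood : ℝ) := by
  simp only [Setup.J, Set.mem_union, not_or] at hJ
  obtain ⟨⟨⟨⟨⟨h1, h2⟩, h3⟩, h4⟩, h5⟩, h6⟩ := hJ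
  have hY : v ∈ S.YB := by by_contra h; exact h2 ⟨Or.inr hv, h⟩
  have hY1 : (1 + S.η / 10) * S.k / 2 < (deg S.Gcap v (S.Vplus \ S.Lsharp) : ℝ) := hY.1
  have hH : (deg S.G v S.H : ℝ) ≤ S.η / 100 * S.k := by
    by_contra! h; exact h3 ⟨Or.inr hv, h⟩
  have hsum : (deg S.Gcap v (S.Vplus \ S.Lsharp) : ℝ) ≤ deg S.Gcap v S.Vgood + deg S.G v S.H := by
    exact_mod_cast deg_le_add fun u (hu : u ∈ S.Vplus \ S.Lsharp) hadj => by
      by_cases hb : u ∈ S.H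
      · exact Or.inr ⟨hb, hS.Gcap_le_G hadj⟩
      · exact Or.inl ⟨⟨hu.1, fun h => h.elim hb hu.2⟩, hadj⟩
  linarith

theorem deg_Vgood_split {P : Fin 3 → Set V} {exV : Set V} {exS exC : Set (Set V)}
    {q : Fin 3 → ℝ} (hS : S.CommonSetting) (h : S.SplitsWith P exV exS exC q)
    {v : V} (hvH : v ∉ S.H) (hv : v ∉ exV) (i : Fin 3) :
    q i * (deg S.Gcap v S.Vgood : ℝ) - (S.k : ℝ) ^ (0.9 : ℝ) ≤
      (deg S.Gcap v (S.Vgood ∩ P i) : ℝ) := by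
  have hg : ∀ u ∈ S.Vgood, u ∉ S.H := fun u hu hH => hu.2 (Or.inl hH)
  have := h.deg_ge Gcap_mem_splitGraphs hvH hv hg (fun u hu u' _ hj => (hj 0).1 hu) i
  rw [hS.deg_deleteVerts hvH hg, hS.deg_deleteVerts hvH fun u hu => hg u hu.2, Set.inter_comm] at this
  exact this

/-- The shadow of `VnoH` that `P0clean` excludes is already part of `J`, with the same threshold. -/
theorem mem_P0clean {v : V} (hP : v ∈ T.P 0) (hJ : v ∉ S.J) (hF : v ∉ FF S T) :
    v ∈ P0clean S T := by
  refine ⟨hP, ?_⟩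
  rintro (h | h)
  · exact hF h
  · have h : S.η ^ 2 * S.k / 10 ^ 5 < (deg S.GD v S.VnoH : ℝ) := h
    have h' : deg S.GD v S.VnoH ≤
        deg (S.GD ⊔ S.Gcap) v (S.VnoH ∪ S.Lsharp ∪ S.Jatom ∪ S.J1) :=
      deg_le_deg fun u hu hadj => ⟨Or.inl (Or.inl (Or.inl hu)), Or.inl hadj⟩
    exact hJ (Or.inr (lt_of_lt_of_le h (by exact_mod_cast h')))

/-- The spare $\frac{\eta k}{100}$ in the degree becomes at least $\frac{\eta^2k}{10^4}$ after
multiplication by `p`, which absorbs the splitting error `ξ * k`. -/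
theorem SmallConstants.split_ineq {K : Constants} {k : ℕ} {ξ p q a b D : ℝ}
    (sc : SmallConstants K k ξ) (hp : K.η / 100 ≤ p) (hpq : p ≤ q) (hb : 0 ≤ b)
    (hab : b * k + K.η / 100 * k ≤ a) (hD : a ≤ D) :
    p * b * k ≤ q * D - ξ * k := by
  have h1 : 0 < p := lt_of_lt_of_le (by have := sc.η_pos; positivity) hp
  have h2 := sc.ξ_le_η_cube
  have hk := sc.k_pos
  have hη := sc.η_pos
  have h3 : K.η ^ 3 ≤ K.η ^ 2 * 1 := by
    rw [pow_succ]; exact mul_le_mul_of_nonneg_left sc.η_le_one (by positivity)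
  have h4 : ξ * k ≤ K.η ^ 2 / 10 ^ 4 * k := by
    gcongr
    have : K.η ^ 3 / 10 ^ 40 ≤ K.η ^ 2 / 10 ^ 4 := by
      rw [div_le_div_iff₀ (by norm_num) (by norm_num)]
      nlinarith [pow_pos hη 2]
    linarith
  have h5 : p * (b * k + K.η / 100 * k) ≤ q * D :=
    mul_le_mul hpq (hab.trans hD) (by positivity) (by linarith)
  have h6 : K.η / 100 * (K.η / 100 * k) ≤ p * (K.η / 100 * k) := by gcongr
  nlinarith

theorem heart2_of_caseA {ξ : ℝ} (sc : SmallConstants S.toConstants S.k ξ) (hS : S.CommonSetting)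
    (hT : SplittingSetting S T) {V₀ V₁ : Set V}
    (h0 : V₀.Nonempty) (h1 : V₁.Nonempty)
    (hsub : V₀ ∪ V₁ ⊆ (S.XA ∩ T.P 0) \ (S.J ∪ T.exV ∪ FF S T)) :
    Heart2 S T (T.p 2 * (1 + S.η / 20) * S.k) V₀ V₁ := by
  obtain ⟨q, hq, hq1, hsp⟩ := hT.splits
  have hcl : ∀ v ∈ V₀ ∪ V₁, v ∈ P0clean S T := fun v hv =>
    mem_P0clean (hsub hv).1.2 (fun h => (hsub hv).2 (Or.inl (Or.inl h)))
      fun h => (hsub hv).2 (Or.inr h)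
  refine ⟨h0, h1, fun v hv => hcl v (Or.inl hv), fun v hv => hcl v (Or.inr hv), fun v hv => ?_⟩
  have hvs := hsub hv
  have hvH : v ∉ S.H := by
    have : v ∈ ⋃ i, T.P i := Set.mem_iUnion.2 ⟨0, hvs.1.2⟩
    rw [hsp.cover] at this; exact this
  have e1 := deg_Vgood_of_XA hS hvs.1.1 fun h => hvs.2 (Or.inl (Or.inl h))
  have e2 := deg_Vgood_split hS hsp hvH (fun h => hvs.2 (Or.inl (Or.inr h))) 2
  rw [sc.pow_eq] at e2
  have hη := sc.η_pos
  have hk := sc.k_pos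
  refine (sc.split_ineq (hT.p_ge 2) (hq 2) (by positivity) ?_ e1).trans e2
  nlinarith

/-- The cover of `MAB` used for the preconfiguration (heart 1). -/
def coverFamily (S : Setup V) (E₀ : Set V) : Set (Set V) :=
  {X | (∃ p ∈ S.MB, X = p.1) ∨ (∃ p ∈ S.MA, (X = p.1 ∨ X = p.2) ∧ X ⊆ S.L) ∨
    (X ∈ sidesOf S.MAB ∧ X ⊆ E₀)}

theorem L_of_not_Sm {v : V} (h : v ∉ S.Sm) : v ∈ S.L := by
  have : ¬ (deg S.G v Set.univ : ℝ) < (1 + S.η) * S.k := h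
  exact not_lt.1 this

theorem not_L_of_Sm {v : V} (h : v ∈ S.Sm) : v ∉ S.L := fun h' => by
  have h : (deg S.G v Set.univ : ℝ) < (1 + S.η) * S.k := h
  have h' : (1 + S.η) * S.k ≤ (deg S.G v Set.univ : ℝ) := h'
  linarith

/-- Neighbours of small vertices have degree exactly $\lceil(1+\eta)k\rceil$, so they are large. -/
theorem Sm_independent (hS : S.CommonSetting) {v w : V} (h : S.G.Adj v w) (hv : v ∈ S.Sm) :
    w ∈ S.L := by
  have := hS.lks.small_nbr v w h hv
  have h2 : (1 + S.η) * (S.k : ℝ) ≤ (⌈(1 + S.η) * (S.k : ℝ)⌉₊ : ℝ) := Nat.le_ceil _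
  change (1 + S.η) * (S.k : ℝ) ≤ (deg S.G w Set.univ : ℝ)
  rw [this]; exact h2

theorem exists_adj_of_density_pos {Γ : SimpleGraph V} {X Y : Set V} (h : 0 < density Γ X Y) :
    ∃ x ∈ X, ∃ y ∈ Y, Γ.Adj x y := by
  by_contra! hcon
  have : ePair Γ X Y = 0 := by
    unfold ePair
    rw [Set.ncard_eq_zero (Set.toFinite _)]
    ext p
    simp only [Set.mem_ofPred_eq, Set.mem_empty_iff_false, iff_false]
    exact fun hp => hcon p.1 hp.1 p.2 hp.2.1 hp.2.2
  rw [density, this] at h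
  simp at h

/-- A pair of `MA` has positive density and each of its sides consists of small or of large
vertices. As small vertices are independent, one side is inside `L`. -/
theorem isCover_coverFamily {ξ : ℝ} (sc : SmallConstants S.toConstants S.k ξ)
    (hS : S.CommonSetting) (E₀ : Set V) : IsCover S.MAB (coverFamily S E₀) := by
  constructor
  · rintro X (⟨p, hp, rfl⟩ | ⟨p, hp, hX, -⟩ | h)
    · exact ⟨p, Or.inr hp, Or.inl rfl⟩
    · exact ⟨p, Or.inl hp, hX⟩
    · exact h.1
  · rintro p (hp | hp)
    · by_cases h1 : p.1 ⊆ S.L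
      · exact Or.inl (Or.inr (Or.inl ⟨p, hp, Or.inl rfl, h1⟩))
      by_cases h2 : p.2 ⊆ S.L
      · exact Or.inr (Or.inr (Or.inl ⟨p, hp, Or.inr rfl, h2⟩))
      obtain ⟨-, h3, h4⟩ := hS.pair_spot p (Or.inl hp)
      obtain ⟨x, hx, y, hy, hxy⟩ :=
        exists_adj_of_density_pos (sc.d_pos.trans_le (hS.matchA.dense p hp))
      exact absurd (Sm_independent hS (hS.GD_le hxy).1 (h3.resolve_right h1 hx))
        (not_L_of_Sm (h4.resolve_right h2 hy))
    · exact Or.inl (Or.inl ⟨p, hp, rfl⟩)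

/-- The first sides of `MB` lie in $\mathbb S^0\setminus V(\mathcal M_A)$ and the sides of `MA`
inside `L` lie in `XA`. Membership in `J2` and `J3` is defined by the degrees into exactly these two
sets. -/
theorem deg_coverFamily_le (hS : S.CommonSetting) (E₀ : Set V) {v : V} (hv : v ∈ S.XA)
    (h2 : v ∉ S.J2) (h3 : v ∉ S.J3) :
    (deg S.Gcap v (⋃₀ coverFamily S E₀) : ℝ) ≤
      S.η ^ 3 * S.k / 10 ^ 3 + √S.γ * S.k + deg S.Gcap v E₀ := by
  have e2 : (deg S.Gcap v (S.S0 \ vertsOf S.MA) : ℝ) ≤ √S.γ * S.k := by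
    by_contra! h; exact h2 ⟨hv, h⟩
  have e3 : (deg S.Gcap v S.XA : ℝ) ≤ S.η ^ 3 * S.k / 10 ^ 3 := by
    by_contra! h; exact h3 ⟨hv, h⟩
  have e4 : (deg S.Gcap v (⋃₀ coverFamily S E₀) : ℝ) ≤
      deg S.Gcap v (S.XA ∪ (S.S0 \ vertsOf S.MA)) + deg S.Gcap v E₀ := by
    have := deg_le_add (Γ := S.Gcap) (v := v) (U := ⋃₀ coverFamily S E₀)
      (U₁ := S.XA ∪ (S.S0 \ vertsOf S.MA)) (U₂ := E₀) (Γ₁ := S.Gcap) (Γ₂ := S.Gcap) ?_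
    · exact_mod_cast this
    · rintro u ⟨X, (⟨p, hp, rfl⟩ | ⟨p, hp, hX, hXL⟩ | h), hu⟩ hadj
      · refine Or.inl ⟨Or.inr ⟨hS.MB_small ⟨p, hp, hu⟩, fun h => ?_⟩, hadj⟩
        exact Set.disjoint_left.1 hS.disjAB h (Or.inl ⟨p, hp, hu⟩)
      · refine Or.inl ⟨Or.inl ⟨hXL hu, fun h => ?_⟩, hadj⟩
        refine Set.disjoint_left.1 hS.disjAB ?_ h
        rcases hX with rfl | rfl
        exacts [Or.inl ⟨p, hp, hu⟩, Or.inr ⟨p, hp, hu⟩]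
      · exact Or.inr ⟨h.2 hu, hadj⟩
  have e5 := deg_union_le S.Gcap v S.XA (S.S0 \ vertsOf S.MA)
  linarith

/-- The set `E₀` is a free parameter of the cover: for (◇9) it is `E`, since there the vertices
outside the cover must be in clusters, and otherwise it is empty. -/
theorem heart1_of_caseB {ξ γ' : ℝ} (sc : SmallConstants S.toConstants S.k ξ)
    (hS : S.CommonSetting) (hT : SplittingSetting S T) {V₀ V₁ : Set V} (E₀ : Set V)
    (h0 : V₀.Nonempty) (h1 : V₁.Nonempty)
    (hsub1 : V₁ ⊆ (S.XA ∩ T.P 0) \ (S.J ∪ S.J2 ∪ S.J3 ∪ T.exV ∪ FF S T))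
    (hsub0 : V₀ ⊆ (S.XB ∩ T.P 0) \ (S.J ∪ T.exV ∪ FF S T))
    (hcov : ∀ v ∈ V₁, S.η ^ 3 * S.k / 10 ^ 3 + √S.γ * S.k + deg S.Gcap v E₀ ≤ γ' * S.k) :
    Heart1With S T γ' (T.p 2 * (1 + S.η / 20) * S.k) V₀ V₁ (coverFamily S E₀) := by
  obtain ⟨q, hq, hq1, hsp⟩ := hT.splits
  have hη := sc.η_pos
  have hk := sc.k_pos
  have hH : ∀ v ∈ T.P 0, v ∉ S.H := fun v hv => by
    have : v ∈ ⋃ i, T.P i := Set.mem_iUnion.2 ⟨0, hv⟩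
    rw [hsp.cover] at this; exact this
  refine ⟨h0, h1, fun v hv => ?_, fun v hv => ?_, fun v hv => ?_, fun v hv => ?_,
    isCover_coverFamily sc hS E₀, fun v hv => ?_⟩
  · exact mem_P0clean (hsub0 hv).1.2 (fun h => (hsub0 hv).2 (Or.inl (Or.inl h)))
      fun h => (hsub0 hv).2 (Or.inr h)
  · exact mem_P0clean (hsub1 hv).1.2 (fun h => (hsub1 hv).2 (Or.inl (Or.inl (Or.inl (Or.inl h)))))
      fun h => (hsub1 hv).2 (Or.inr h)
  · have hvs := hsub0 hv
    have e1 := deg_Vgood_of_XB hS hvs.1.1 fun h => hvs.2 (Or.inl (Or.inl h))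
    have e2 := deg_Vgood_split hS hsp (hH v hvs.1.2) (fun h => hvs.2 (Or.inl (Or.inr h))) 2
    rw [sc.pow_eq] at e2
    -- Vertices of `XB` have only about half of the degree, and (♡1) asks for only half of it on
    -- `V₀`.
    have e3 := (sc.split_ineq (b := (1 + S.η / 20) / 2) (hT.p_ge 2) (hq 2) (by positivity)
      (by nlinarith) e1).trans e2
    linarith
  · have hvs := hsub1 hv
    have e1 := deg_Vgood_of_XA hS hvs.1.1 fun h => hvs.2 (Or.inl (Or.inl (Or.inl (Or.inl h))))
    have e2 := deg_Vgood_split hS hsp (hH v hvs.1.2) (fun h => hvs.2 (Or.inl (Or.inr h))) 2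
    rw [sc.pow_eq] at e2
    exact (sc.split_ineq (hT.p_ge 2) (hq 2) (by positivity) (by nlinarith) e1).trans e2
  · have hvs := hsub1 hv
    exact (deg_coverFamily_le hS E₀ hvs.1.1
      (fun h => hvs.2 (Or.inl (Or.inl (Or.inl (Or.inr h)))))
      fun h => hvs.2 (Or.inl (Or.inl (Or.inr h)))).trans (hcov v hv)

end Splittings

end LKS

namespace LKS

namespace SmallConstants

variable {K : Constants} {k : ℕ} {ξ : ℝ}

/-- `γ` is the smallest of the four bases and `ν` is at most $\gamma^{21}$; twenty factors `γ`
dominate the monomial and the last one supplies $10^{-40}$. -/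
theorem ν_pow_le (sc : SmallConstants K k ξ) (a b c d : ℕ) (h : a + b + c + d ≤ 20) :
    K.ν ^ 5 ≤ K.η ^ a * K.Ωs⁻¹ ^ b * K.ρ ^ c * K.γ ^ d / 10 ^ 40 := by
  have hγ := sc.γ_pos
  have hρ := sc.ρ_pos
  have ho := sc.o_pos
  have hη := sc.η_pos
  have hγo : K.γ ≤ K.Ωs⁻¹ := sc.γ_le_ρ.trans sc.ρ_le_o
  have hγη : K.γ ≤ K.η := hγo.trans sc.o_le_η
  have h1 : K.ν ^ 5 ≤ K.ν := pow_le_of_le_one sc.ν_pos.le sc.ν_le_one (by norm_num)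
  have h2 : K.ν ≤ K.γ ^ 21 :=
    le_pow_of_le_pow (sc.ν_le_d.trans sc.d_le) hγ.le sc.γ_le_one (by norm_num)
  have h3 : K.γ ^ 21 ≤ K.γ ^ 20 * (1 / 10 ^ 40) := by
    rw [pow_succ]
    gcongr
    exact hγη.trans sc.η_le
  have h4 : K.γ ^ 20 ≤ K.γ ^ (a + b + c + d) := pow_le_pow_of_le_one hγ.le sc.γ_le_one h
  have h5 : K.γ ^ (a + b + c + d) ≤ K.η ^ a * K.Ωs⁻¹ ^ b * K.ρ ^ c * K.γ ^ d := by
    rw [pow_add, pow_add, pow_add]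
    gcongr
    exact sc.γ_le_ρ
  have h6 : K.γ ^ 20 * (1 / 10 ^ 40) ≤ (K.η ^ a * K.Ωs⁻¹ ^ b * K.ρ ^ c * K.γ ^ d) * (1 / 10 ^ 40) := by
    gcongr
    exact h4.trans h5
  linarith

theorem ξ_le_ν_pow (sc : SmallConstants K k ξ) : ξ ≤ K.ν ^ 5 :=
  le_pow_of_le_pow sc.ξ_le sc.ν_pos.le sc.ν_le_one (by norm_num)

end SmallConstants

/-! ### Cleaned chains of sets, and configuration (◇6). -/

section Chains

set_option linter.unusedSectionVars false

variable {V : Type*} [Finite V] {S : Setup V} {T : Splitting V}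

theorem SplittingSetting.P_not_H (hT : SplittingSetting S T) {i : Fin 3} {v : V} (hv : v ∈ T.P i) :
    v ∉ S.H := by
  obtain ⟨q, -, -, hsp⟩ := hT.splits
  have : v ∈ ⋃ i, T.P i := Set.mem_iUnion.2 ⟨i, hv⟩
  rw [hsp.cover] at this
  exact this

/-- A matching that can be turned into a preconfiguration (reg). -/
structure UsableMatching (S : Setup V) (T : Splitting V) (ε d l d' : ℝ)
    (M : Set (Set V × Set V)) : Prop where
  reg : RegMatching S.G ε d l M
  ε_pos : 0 < ε
  ε_le : ε ≤ 1 / 10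
  ε_le_π : ε ≤ S.π
  d'_nonneg : 0 ≤ d'
  d'_le : d' + 2 * ε ≤ d
  size : S.η ^ 2 * S.ν / (2 * 10 ^ 4) * S.k ≤ 2 / 5 * l
  sub : vertsOf M ⊆ T.P 0
  large : S.ρ * S.n / S.Ωs ≤ ((vertsOf M).ncard : ℝ)

theorem n_pos [Nonempty V] : 0 < S.n := by
  unfold Setup.n
  exact_mod_cast Nat.card_pos

/-- The cleaning of a chain of sets that starts with a usable matching, with all quantities
scaled by `k`. -/
theorem UsableMatching.exists_chain [Nonempty V] {ξ ε d l d' : ℝ} {M : Set (Set V × Set V)}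
    (hM : UsableMatching S T ε d l d' M) (sc : SmallConstants S.toConstants S.k ξ)
    (X₁ X₂ X₃ Z₁ Z₂ : Set V) (Γ₀ Γ₁ Γ₂ : SimpleGraph V) (g₀ g₁ g₂ δ : ℝ)
    (hg₀ : 0 < g₀) (hg₁ : 0 < g₁) (hg₂ : 0 < g₂) (hδ : 0 ≤ δ)
    (hX₁ : ∀ v ∈ X₁, (deg Γ₀ v Set.univ : ℝ) ≤ S.Ωs * S.k)
    (hX₂ : ∀ v ∈ X₂, (deg Γ₁ v Set.univ : ℝ) ≤ S.Ωs * S.k)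
    (hZ₁ : ∀ v ∈ Z₁, (deg Γ₀ v Set.univ : ℝ) ≤ S.Ωs * S.k)
    (hZ₂ : ∀ v ∈ Z₂, (deg Γ₁ v Set.univ : ℝ) ≤ S.Ωs * S.k)
    (cZ₁ : (Z₁.ncard : ℝ) ≤ S.ν ^ 5 * S.n) (cZ₂ : (Z₂.ncard : ℝ) ≤ S.ν ^ 5 * S.n)
    (hsmall : S.ν ^ 5 * S.Ωs * (1 + S.Ωs / g₁) +
      δ * (1 + S.Ωs / g₁ + S.Ωs ^ 2 / (g₁ * g₂)) < g₀ * S.ρ / (10 * S.Ωs)) :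
    ∃ V₀ V₁ Y₁ Y₂ Y₃ : Set V, V₀ ⊆ verts2 M ∧ V₁ ⊆ verts1 M ∧ Z₁ ⊆ Y₁ ∧ Z₂ ⊆ Y₂ ∧
      PreReg S T (4 * S.π) d' (S.η ^ 2 * S.ν / (2 * 10 ^ 4)) V₀ V₁ ∧
      (∀ v ∈ V₁, (deg Γ₀ v Y₁ : ℝ) < g₀ * S.k) ∧
      (∀ v ∈ X₁ \ Y₁, (deg Γ₁ v Y₂ : ℝ) < g₁ * S.k) ∧
      (∀ v ∈ X₂ \ Y₂, (deg Γ₂ v Y₃ : ℝ) < g₂ * S.k) ∧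
      (∀ v ∈ X₁ \ Y₁, δ * S.k ≤ (deg Γ₀ v V₁ : ℝ)) ∧
      (∀ v ∈ X₂ \ Y₂, δ * S.k ≤ (deg Γ₁ v (X₁ \ Y₁) : ℝ)) ∧
      (∀ v ∈ X₃ \ Y₃, δ * S.k ≤ (deg Γ₂ v (X₂ \ Y₂) : ℝ)) := by
  have hk := sc.k_pos
  have hΩ := sc.Ω_pos
  have hn : 0 < S.n := n_pos
  have hd : 0 < d := by linarith [hM.ε_pos, hM.d'_le, hM.d'_nonneg]
  set M' := typicalPairs S.G ε d M with hM'
  have hcard := hM.large.trans (hM.reg.ncard_typical hM.ε_pos hM.ε_le hd)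
  rw [← hM'] at hcard
  have hw₁ : 0 ≤ S.Ωs / g₁ := by positivity
  have hbig : ∀ (Γ : SimpleGraph V) (X Z : Set V),
      (∀ v ∈ Z, (deg Γ v Set.univ : ℝ) ≤ S.Ωs * S.k) → (Z.ncard : ℝ) ≤ S.ν ^ 5 * S.n →
      (ePair Γ X Z : ℝ) ≤ S.ν ^ 5 * S.n * (S.Ωs * S.k) := by
    intro Γ X Z h1 h2
    rw [ePair_comm]
    refine (ePair_le_mul fun v hv => ?_).trans (mul_le_mul_of_nonneg_right h2 (by positivity))
    exact le_trans (by exact_mod_cast deg_mono_right (Set.subset_univ _)) (h1 v hv)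
  -- The weights $\Omega^*/g_1$ and $(\Omega^*)^2/(g_1g_2)$ make both weight conditions of
  -- `exists_cleaning` equalities for $\Delta=\Omega^*k$.
  have key :=
    exists_cleaning M' X₁ X₂ X₃ Z₁ Z₂ ∅ Γ₀ Γ₁ Γ₂ (S.Ωs * S.k) (S.Ωs / g₁)
      (S.Ωs ^ 2 / (g₁ * g₂)) (g₀ * S.k) (g₁ * S.k) (g₂ * S.k) (δ * S.k) (δ * S.k) (δ * S.k)
      (S.ν ^ 5 * S.n * (S.Ωs * S.k) * (1 + S.Ωs / g₁))
      hM.reg.typicalPairs_disj (by positivity) (by positivity)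
      (le_of_eq (by field_simp)) (le_of_eq (by field_simp)) (by positivity) (by positivity)
      (by positivity) (by positivity) hX₁ hX₂ ?_ ?_
  · obtain ⟨Y₀, Y₁, Y₂, Y₃, s1, s2, -, ⟨p, hp, hpc⟩, f0, f1, f2, b1, b2, b3⟩ := key
    obtain ⟨V₀, hV₀, hreg⟩ := hM.reg.preReg_survivors (S := S) (T := T) (ε' := 4 * S.π) (d' := d')
      (μ := S.η ^ 2 * S.ν / (2 * 10 ^ 4)) hM.ε_pos hM.ε_le (by linarith [hM.ε_le_π]) hM.d'_nonneg
      hM.d'_le hM.size hM.sub ⟨p, hp, hpc⟩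
    exact ⟨V₀, survivors M' Y₀, Y₁, Y₂, Y₃, hV₀,
      survivors_subset.trans verts1_typicalPairs_subset, s1, s2, hreg, f0, f1, f2, b1, b2, b3⟩
  · have e0 : (ePair Γ₂ X₂ ∅ : ℝ) = 0 := by simp [ePair]
    have e1 := hbig Γ₀ (verts1 M') Z₁ hZ₁ cZ₁
    have e2 := mul_le_mul_of_nonneg_left (hbig Γ₁ X₁ Z₂ hZ₂ cZ₂) hw₁
    rw [e0]
    linarith
  -- The typical vertices in first sides number at least $\frac{\rho n}{5\Omega^*}$, and the
  -- cleaning may use up half of them; hence the 10 in `hsmall`.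
  · have hnV : (Nat.card V : ℝ) = S.n := rfl
    rw [hnV]
    have e1 := mul_lt_mul_of_pos_right hsmall (mul_pos hk hn)
    have e2 : g₀ * S.ρ / (10 * S.Ωs) * (S.k * S.n) =
        g₀ * S.k * (S.ρ * S.n / S.Ωs / 5 / 2) := by field_simp; ring
    have e3 : g₀ * S.k * (S.ρ * S.n / S.Ωs / 5 / 2) ≤ g₀ * S.k * ((verts1 M').ncard / 2) := by
      gcongr
      linarith
    have e4 : (S.ν ^ 5 * S.Ωs * (1 + S.Ωs / g₁) +
        δ * (1 + S.Ωs / g₁ + S.Ωs ^ 2 / (g₁ * g₂))) * (S.k * S.n) =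
        S.ν ^ 5 * S.n * (S.Ωs * S.k) * (1 + S.Ωs / g₁) + (δ * S.k + S.Ωs / g₁ * (δ * S.k)
          + S.Ωs ^ 2 / (g₁ * g₂) * (δ * S.k)) * S.n := by ring
    linarith

theorem SplittingSetting.exV_ncard {ξ : ℝ} (sc : SmallConstants S.toConstants S.k ξ)
    (hT : SplittingSetting S T) [Nonempty V] : (T.exV.ncard : ℝ) ≤ S.ν ^ 5 * S.n := by
  obtain ⟨q, -, -, hsp⟩ := hT.splits
  have hn : 0 < S.n := n_pos
  refine hsp.exV_small.trans ?_
  gcongr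
  exact sc.exp_le.trans sc.ξ_le_ν_pow

/-- The hypothesis that makes a lower bound on a degree survive the restriction to a part. -/
theorem SmallConstants.half_split {K : Constants} {k : ℕ} {ξ p q a D : ℝ}
    (sc : SmallConstants K k ξ) (hp : K.η / 100 ≤ p) (hpq : p ≤ q) (ha : 0 ≤ a)
    (hξ : ξ ≤ K.η * a / 200) (hD : a * k ≤ D) : K.η * a / 200 * k ≤ q * D - ξ * k := by
  have hk := sc.k_pos
  have hη := sc.η_pos
  have h1 : K.η / 100 * (a * k) ≤ q * D :=
    mul_le_mul (hp.trans hpq) hD (by positivity) (by linarith [div_pos hη (by norm_num : (0 : ℝ) < 100)])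
  have h2 : ξ * k ≤ K.η * a / 200 * k := by gcongr
  linarith

/-- The case where the first sides see the vertices of the nowhere-dense graph. -/
theorem conf6_of_expShadow [Nonempty V] {ξ ε d l d' : ℝ} {M : Set (Set V × Set V)}
    (hM : UsableMatching S T ε d l d' M) (sc : SmallConstants S.toConstants S.k ξ)
    (hS : S.CommonSetting) (hT : SplittingSetting S T)
    (hex : Disjoint (verts1 M) T.exV) (hexp : verts1 M ⊆ expShadow S)
    (heart : ∀ V₀ V₁ : Set V, V₀.Nonempty → V₁.Nonempty → V₀ ⊆ verts2 M → V₁ ⊆ verts1 M →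
      Heart1 S T (3 * S.η ^ 3 / 2000) (T.p 2 * (1 + S.η / 20) * S.k) V₀ V₁ ∨
      Heart2 S T (T.p 2 * (1 + S.η / 20) * S.k) V₀ V₁) :
    Conf6 S T (S.η ^ 3 * S.ρ ^ 4 / (10 ^ 12 * S.Ωs ^ 4)) (4 * S.π) d'
      (S.η ^ 2 * S.ν / (2 * 10 ^ 4)) (3 * S.η ^ 3 / 2000) (T.p 2 * (1 + S.η / 20) * S.k) := by
  obtain ⟨q, hq, hq1, hsp⟩ := hT.splits
  have hη := sc.η_pos
  have hk := sc.k_pos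
  have hρ := sc.ρ_pos
  have hΩ := sc.Ω_pos
  have ho := sc.o_pos
  have hη1 := sc.η_le_one
  have hρ1 := sc.ρ_le_one
  have ho1 := sc.o_le_one
  have hΩo : S.Ωs = S.Ωs⁻¹⁻¹ := (inv_inv _).symm
  set δ := S.η ^ 3 * S.ρ ^ 4 / (10 ^ 12 * S.Ωs ^ 4) with hδ
  have hδ0 : 0 < δ := by positivity
  set X := T.P 1 ∩ S.Gexp.support with hX
  have hXH : ∀ v ∈ X, v ∉ S.H := fun v hv => hT.P_not_H hv.1
  have hexH : ∀ v ∈ T.exV, v ∉ S.H := fun v hv => hsp.exV_sub hv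
  have hξ : ξ ≤ S.η * S.ρ / 200 := by
    have h1 := sc.ξ_le_ν_pow.trans (sc.ν_pow_le 1 0 1 0 (by norm_num))
    have : S.η * S.ρ > 0 := by positivity
    simp only [pow_one, pow_zero, mul_one] at h1
    linarith
  -- The chain is `V₁`, `X`, `X`, with the captured graph and then `Gexp`. The third step is void:
  -- the graph is `⊥`, and `g₂` equal to $\Omega^*$ makes the two weights agree. The vertices of
  -- `exV` are removed at the outset, because their degrees need not split.
  obtain ⟨V₀, V₁, Y₁, Y₂, Y₃, hV₀, hV₁, s1, s2, hreg, f0, f1, -, b1, b2, -⟩ :=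
    hM.exists_chain sc X X ∅ T.exV ∅ (deleteVerts S.Gcap S.H) S.Gexp ⊥
      (S.η * S.ρ / 400) (S.η * S.ρ / 400) S.Ωs δ (by positivity) (by positivity) hΩ hδ0.le
      (fun v hv => hS.deg_Gcap_le (hXH v hv) _) (fun v hv => hS.deg_Gexp_le (hXH v hv) _)
      (fun v hv => hS.deg_Gcap_le (hexH v hv) _) (by simp) (hT.exV_ncard sc)
      (by simp only [Set.ncard_empty, Nat.cast_zero]; have := n_pos (S := S); have := sc.ν_pos; positivity)
      (by
        have h1 := sc.ν_pow_le 2 3 3 0 (by norm_num)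
        simp only [pow_zero, mul_one] at h1
        have hw : 1 ≤ S.Ωs / (S.η * S.ρ / 400) := by
          rw [hΩo]
          rw [le_div_iff₀ (by positivity), one_mul]
          have : 1 ≤ S.Ωs⁻¹⁻¹ := (one_le_inv₀ ho).2 ho1
          nlinarith [mul_le_one₀ hη1 hρ.le hρ1]
        have hw2 : S.Ωs ^ 2 / (S.η * S.ρ / 400 * S.Ωs) = S.Ωs / (S.η * S.ρ / 400) := by field_simp
        rw [hw2]
        have hwd : S.Ωs / (S.η * S.ρ / 400) * δ =
            400 / 10 ^ 12 * (S.η ^ 2 * S.ρ ^ 3 * S.Ωs⁻¹ ^ 3) := by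
          rw [hδ]; field_simp
        have hwn : S.ν ^ 5 * S.Ωs * (S.Ωs / (S.η * S.ρ / 400)) ≤
            400 / 10 ^ 40 * (S.η * S.ρ ^ 2 * S.Ωs⁻¹) := by
          calc S.ν ^ 5 * S.Ωs * (S.Ωs / (S.η * S.ρ / 400)) ≤
              (S.η ^ 2 * S.Ωs⁻¹ ^ 3 * S.ρ ^ 3 / 10 ^ 40) * S.Ωs * (S.Ωs / (S.η * S.ρ / 400)) := by
                gcongr
            _ = 400 / 10 ^ 40 * (S.η * S.ρ ^ 2 * S.Ωs⁻¹) := by field_simp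
        have hcmp : S.η ^ 2 * S.ρ ^ 3 * S.Ωs⁻¹ ^ 3 ≤ S.η * S.ρ ^ 2 * S.Ωs⁻¹ := by
          gcongr ?_ * ?_ * ?_
          · exact pow_le_of_le_one hη.le hη1 (by norm_num)
          · exact pow_le_pow_of_le_one hρ.le hρ1 (by norm_num)
          · exact pow_le_of_le_one ho.le ho1 (by norm_num)
        have hrhs : S.η * S.ρ / 400 * S.ρ / (10 * S.Ωs) = S.η * S.ρ ^ 2 * S.Ωs⁻¹ / 4000 := by
          field_simp; norm_num
        rw [hrhs]
        set Q := S.η * S.ρ ^ 2 * S.Ωs⁻¹ with hQ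
        have hQ0 : 0 < Q := by positivity
        have e1 : S.ν ^ 5 * S.Ωs * 1 ≤ S.ν ^ 5 * S.Ωs * (S.Ωs / (S.η * S.ρ / 400)) := by
          have := sc.ν_pos
          gcongr
        have e2 : δ * 1 ≤ δ * (S.Ωs / (S.η * S.ρ / 400)) := by gcongr
        nlinarith)
  have hV₁deg : ∀ v ∈ V₁, S.η * S.ρ / 200 * S.k ≤ (deg (deleteVerts S.Gcap S.H) v X : ℝ) := by
    intro v hv
    have hvM := hV₁ hv
    have hvH : v ∉ S.H := hT.P_not_H (hM.sub (Or.inl hvM))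
    have h1 : S.ρ * S.k < (deg S.Gcap v S.Gexp.support : ℝ) := hexp hvM
    rw [← hS.deg_deleteVerts hvH fun u hu => hS.support_disj hu] at h1
    have h2 := hsp.deg_ge Gcap_mem_splitGraphs hvH (Set.disjoint_left.1 hex hvM)
      (U := S.Gexp.support) (fun u hu => hS.support_disj hu) (fun u hu u' _ hj => (hj 3).1 hu) 1
    rw [sc.pow_eq] at h2
    exact (sc.half_split (hT.p_ge 1) (hq 1) hρ.le hξ h1.le).trans h2
  have hXdeg : ∀ v ∈ X \ Y₁, S.η * S.ρ / 200 * S.k ≤ (deg S.Gexp v X : ℝ) := by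
    intro v hv
    have hvH : v ∉ S.H := hXH v hv.1
    have h1 : S.ρ * S.k < (deg S.Gexp v Set.univ : ℝ) :=
      hS.sparse.bounded.exp_minDeg v hv.1.2
    -- All neighbours in `Gexp` lie in its support, so the minimum degree of `Gexp` is a degree into
    -- a split set.
    have h1' : (deg S.Gexp v Set.univ : ℝ) ≤ deg S.Gexp v S.Gexp.support := by
      have : deg S.Gexp v Set.univ ≤ deg S.Gexp v S.Gexp.support :=
        deg_le_deg fun u _ h => ⟨⟨v, h.symm⟩, h⟩
      exact_mod_cast this
    have h2 := hsp.deg_ge Gexp_mem_splitGraphs hvH (fun h => hv.2 (s1 h))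
      (U := S.Gexp.support) (fun u hu => hS.support_disj hu) (fun u hu u' _ hj => (hj 3).1 hu) 1
    rw [sc.pow_eq] at h2
    exact (sc.half_split (hT.p_ge 1) (hq 1) hρ.le hξ (h1.le.trans h1')).trans h2
  have hδle : δ ≤ S.η * S.ρ / 400 := by
    have h1 : δ = S.η ^ 3 * S.ρ ^ 4 * S.Ωs⁻¹ ^ 4 / 10 ^ 12 := by rw [hδ]; field_simp
    have h2 : S.η ^ 3 * S.ρ ^ 4 * S.Ωs⁻¹ ^ 4 ≤ S.η * S.ρ * 1 := by
      gcongr ?_ * ?_ * ?_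
      · exact pow_le_of_le_one hη.le hη1 (by norm_num)
      · exact pow_le_of_le_one hρ.le hρ1 (by norm_num)
      · exact pow_le_one₀ ho.le ho1
    have : 0 < S.η * S.ρ := by positivity
    rw [h1]; linarith
  have hδk : δ * S.k ≤ S.η * S.ρ / 400 * S.k := by gcongr
  -- The degree into `X` is at least $\frac{\eta\rho k}{200}$ and less than half of this bound is
  -- lost to `Y₁`; the other half exceeds `δ * S.k`.
  have c1 : ∀ v ∈ V₁, δ * S.k ≤ (deg (deleteVerts S.Gcap S.H) v (X \ Y₁) : ℝ) := fun v hv => by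
    have h1 := hV₁deg v hv
    have h2 := deg_le_sdiff_add (deleteVerts S.Gcap S.H) v X Y₁
    have h3 := f0 v hv
    linarith
  have c2 : ∀ v ∈ X \ Y₁, δ * S.k ≤ (deg S.Gexp v (X \ Y₂) : ℝ) := fun v hv => by
    have h1 := hXdeg v hv
    have h2 := deg_le_sdiff_add S.Gexp v X Y₂
    have h3 := f1 v hv
    linarith
  have hδk0 : 0 < δ * S.k := by positivity
  have hG : deleteVerts S.Gcap S.H ≤ S.G := hS.deleteVerts_Gcap_le.trans hS.Gcap_le_G
  obtain ⟨v₁, hv₁⟩ := hreg.2.1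
  have n2 := nonempty_of_deg_pos (hδk0.trans_le (c1 v₁ hv₁))
  obtain ⟨v₂, hv₂⟩ := id n2
  refine ⟨V₀, V₁, X \ Y₁, X \ Y₂, Or.inl hreg, heart V₀ V₁ hreg.1 hreg.2.1 hV₀ hV₁, n2,
    nonempty_of_deg_pos (hδk0.trans_le (c2 v₂ hv₂)), fun v hv => hv.1.1, fun v hv => hv.1.1, fun v hv => ?_, fun v hv => ?_,
    c2, b2⟩
  · exact (c1 v hv).trans (by exact_mod_cast deg_mono_left hG)
  · exact (b1 v hv).trans (by exact_mod_cast deg_mono_left hG)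

end Chains

end LKS

namespace LKS

/-! ### The avoiding set, and configuration (◇7). -/

section Avoiding

set_option linter.unusedSectionVars false

variable {V : Type*} [Finite V] {S : Setup V} {T : Splitting V}

/-- A vertex of the avoiding set has many neighbours in `P 1` in the dense spots. -/
theorem deg_GD_of_E {ξ : ℝ} (sc : SmallConstants S.toConstants S.k ξ)
    (hS : S.CommonSetting) (hT : SplittingSetting S T) {v : V} (hv : v ∈ S.E) (hex : v ∉ T.exV) :
    S.η * S.γ / 200 * S.k ≤ (deg S.GD v (T.P 1) : ℝ) := by
  obtain ⟨q, hq, -, hsp⟩ := hT.splits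
  -- The avoiding set is covered by dense spots, and the splitting bounds from below the degrees
  -- inside each spot.
  obtain ⟨D, hD, hvD⟩ := hS.sparse.bounded.avoid.1 v hv
  have hξ : ξ ≤ S.η * S.γ / 200 := by
    have h1 := sc.ξ_le_ν_pow.trans (sc.ν_pow_le 1 0 0 1 (by norm_num))
    have : 0 < S.η * S.γ := mul_pos sc.η_pos sc.γ_pos
    simp only [pow_one, pow_zero, mul_one] at h1
    linarith
  have h1 := sc.half_split (hT.p_ge 1) (hq 1) sc.γ_pos.le hξ (le_refl (S.γ * S.k))
  have hle : ∀ U : Set V, (deg D.F v (U ∩ T.P 1) : ℝ) ≤ deg S.GD v (T.P 1) := fun U => by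
    have : deg D.F v (U ∩ T.P 1) ≤ deg S.GD v (T.P 1) :=
      deg_le_deg fun u hu h => ⟨hu.2, D, hD, h⟩
    exact_mod_cast this
  rcases hvD with hv' | hv'
  · have h2 := (hsp.spot 1 D hD).1 v ⟨hv', hex⟩
    rw [sc.pow_eq] at h2
    linarith [hle D.W]
  · have h2 := (hsp.spot 1 D hD).2 v ⟨hv', hex⟩
    rw [sc.pow_eq] at h2
    linarith [hle D.U]

/-- The case where the first sides see the avoiding set. -/
theorem conf7_of_VtoE [Nonempty V] {ξ ε d l d' : ℝ} {M : Set (Set V × Set V)}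
    (hM : UsableMatching S T ε d l d' M) (sc : SmallConstants S.toConstants S.k ξ)
    (hS : S.CommonSetting) (hT : SplittingSetting S T)
    (hex : Disjoint (verts1 M) T.exV) (hexp : verts1 M ⊆ S.VtoE)
    (heart : ∀ V₀ V₁ : Set V, V₀.Nonempty → V₁.Nonempty → V₀ ⊆ verts2 M → V₁ ⊆ verts1 M →
      Heart1 S T (3 * S.η ^ 3 / 2000) (T.p 2 * (1 + S.η / 20) * S.k) V₀ V₁ ∨
      Heart2 S T (T.p 2 * (1 + S.η / 20) * S.k) V₀ V₁) :
    Conf7 S T (S.η ^ 3 * S.γ ^ 3 * S.ρ / (10 ^ 12 * S.Ωs ^ 4)) (S.η * S.γ / 400) (4 * S.π) d'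
      (S.η ^ 2 * S.ν / (2 * 10 ^ 4)) (3 * S.η ^ 3 / 2000) (T.p 2 * (1 + S.η / 20) * S.k) := by
  obtain ⟨q, hq, hq1, hsp⟩ := hT.splits
  have hη := sc.η_pos
  have hk := sc.k_pos
  have hρ := sc.ρ_pos
  have hγ := sc.γ_pos
  have hΩ := sc.Ω_pos
  have ho := sc.o_pos
  have hη1 := sc.η_le_one
  have hρ1 := sc.ρ_le_one
  have hγ1 := sc.γ_le_one
  have ho1 := sc.o_le_one
  have hΩo : S.Ωs = S.Ωs⁻¹⁻¹ := (inv_inv _).symm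
  set δ := S.η ^ 3 * S.γ ^ 3 * S.ρ / (10 ^ 12 * S.Ωs ^ 4) with hδ
  have hδ0 : 0 < δ := by positivity
  set X := S.E ∩ T.P 1 with hX
  have hXH : ∀ v ∈ X, v ∉ S.H := fun v hv => hT.P_not_H hv.2
  have hexH : ∀ v ∈ T.exV, v ∉ S.H := fun v hv => hsp.exV_sub hv
  have hξ : ξ ≤ S.η * (S.ρ / (100 * S.Ωs)) / 200 := by
    have h1 := sc.ξ_le_ν_pow.trans (sc.ν_pow_le 1 1 1 0 (by norm_num))
    have h2 : 0 < S.η * S.Ωs⁻¹ * S.ρ := by positivity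
    have h3 : S.η * (S.ρ / (100 * S.Ωs)) / 200 = S.η * S.Ωs⁻¹ * S.ρ / (2 * 10 ^ 4) := by
      field_simp; norm_num
    simp only [pow_one, pow_zero, mul_one] at h1
    rw [h3]
    linarith
  -- The last set of this chain is the whole of `P 1`, so that the forward condition on `V₂` bounds
  -- its degree into the complement of `V₃` in `P 1`.
  obtain ⟨V₀, V₁, Y₁, Y₂, Y₃, hV₀, hV₁, s1, s2, hreg, f0, f1, -, b1, b2, -⟩ :=
    hM.exists_chain sc X (T.P 1) ∅ T.exV ∅ (deleteVerts S.Gcap S.H) S.GD ⊥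
      (S.η * (S.ρ / (100 * S.Ωs)) / 400) (S.η * S.γ / 400) S.Ωs δ (by positivity) (by positivity)
      hΩ hδ0.le
      (fun v hv => hS.deg_Gcap_le (hXH v hv) _) (fun v hv => hS.deg_GD_le (hT.P_not_H hv) _)
      (fun v hv => hS.deg_Gcap_le (hexH v hv) _) (by simp) (hT.exV_ncard sc)
      (by simp only [Set.ncard_empty, Nat.cast_zero]; have := n_pos (S := S); have := sc.ν_pos; positivity)
      (by
        have h1 := sc.ν_pow_le 2 4 2 1 (by norm_num)
        simp only [pow_one] at h1
        have hw : 1 ≤ S.Ωs / (S.η * S.γ / 400) := by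
          rw [hΩo]
          rw [le_div_iff₀ (by positivity), one_mul]
          have : 1 ≤ S.Ωs⁻¹⁻¹ := (one_le_inv₀ ho).2 ho1
          nlinarith [mul_le_one₀ hη1 hγ.le hγ1]
        have hw2 : S.Ωs ^ 2 / (S.η * S.γ / 400 * S.Ωs) = S.Ωs / (S.η * S.γ / 400) := by field_simp
        rw [hw2]
        have hwd : S.Ωs / (S.η * S.γ / 400) * δ =
            400 / 10 ^ 12 * (S.η ^ 2 * (S.γ ^ 2 * S.ρ) * S.Ωs⁻¹ ^ 3) := by
          rw [hδ]; field_simp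
        have hwn : S.ν ^ 5 * S.Ωs * (S.Ωs / (S.η * S.γ / 400)) ≤
            400 / 10 ^ 40 * (S.η * S.ρ ^ 2 * S.Ωs⁻¹ ^ 2) := by
          calc S.ν ^ 5 * S.Ωs * (S.Ωs / (S.η * S.γ / 400)) ≤
              (S.η ^ 2 * S.Ωs⁻¹ ^ 4 * S.ρ ^ 2 * S.γ / 10 ^ 40) * S.Ωs *
                (S.Ωs / (S.η * S.γ / 400)) := by
                gcongr
            _ = 400 / 10 ^ 40 * (S.η * S.ρ ^ 2 * S.Ωs⁻¹ ^ 2) := by field_simp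
        have hcmp : S.η ^ 2 * (S.γ ^ 2 * S.ρ) * S.Ωs⁻¹ ^ 3 ≤ S.η * S.ρ ^ 2 * S.Ωs⁻¹ ^ 2 := by
          gcongr ?_ * ?_ * ?_
          · exact pow_le_of_le_one hη.le hη1 (by norm_num)
          · rw [pow_two S.ρ]
            gcongr
            exact (pow_le_of_le_one hγ.le hγ1 (by norm_num)).trans sc.γ_le_ρ
          · exact pow_le_pow_of_le_one ho.le ho1 (by norm_num)
        have hrhs : S.η * (S.ρ / (100 * S.Ωs)) / 400 * S.ρ / (10 * S.Ωs) =
            S.η * S.ρ ^ 2 * S.Ωs⁻¹ ^ 2 / (4 * 10 ^ 5) := by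
          field_simp; norm_num
        rw [hrhs]
        set Q := S.η * S.ρ ^ 2 * S.Ωs⁻¹ ^ 2 with hQ
        have hQ0 : 0 < Q := by positivity
        have e1 : S.ν ^ 5 * S.Ωs * 1 ≤ S.ν ^ 5 * S.Ωs * (S.Ωs / (S.η * S.γ / 400)) := by
          have := sc.ν_pos
          gcongr
        have e2 : δ * 1 ≤ δ * (S.Ωs / (S.η * S.γ / 400)) := by gcongr
        nlinarith)
  have hV₁deg : ∀ v ∈ V₁, S.η * (S.ρ / (100 * S.Ωs)) / 200 * S.k ≤
      (deg (deleteVerts S.Gcap S.H) v X : ℝ) := by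
    intro v hv
    have hvM := hV₁ hv
    have hvH : v ∉ S.H := hT.P_not_H (hM.sub (Or.inl hvM))
    have h1 : S.ρ * S.k / (100 * S.Ωs) < (deg (deleteVerts S.Gcap S.H) v S.E : ℝ) := hexp hvM
    have h2 := hsp.deg_ge Gcap_mem_splitGraphs hvH (Set.disjoint_left.1 hex hvM)
      (U := S.E) (fun u hu => hS.E_disj hu) (fun u hu u' _ hj => (hj 4).1 hu) 1
    rw [sc.pow_eq, Set.inter_comm] at h2
    refine (sc.half_split (hT.p_ge 1) (hq 1) (by positivity) hξ (le_trans ?_ h1.le)).trans h2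
    exact le_of_eq (by ring)
  have hδle : δ ≤ S.η * (S.ρ / (100 * S.Ωs)) / 400 := by
    have h1 : δ = S.η ^ 3 * S.γ ^ 3 * S.ρ * S.Ωs⁻¹ ^ 4 / 10 ^ 12 := by rw [hδ]; field_simp
    have h2 : S.η ^ 3 * S.γ ^ 3 * S.ρ * S.Ωs⁻¹ ^ 4 ≤ S.η * 1 * S.ρ * S.Ωs⁻¹ := by
      gcongr ?_ * ?_ * ?_ * ?_
      · exact pow_le_of_le_one hη.le hη1 (by norm_num)
      · exact pow_le_one₀ hγ.le hγ1
      · exact pow_le_of_le_one ho.le ho1 (by norm_num)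
    have h3 : S.η * (S.ρ / (100 * S.Ωs)) / 400 = S.η * 1 * S.ρ * S.Ωs⁻¹ / (4 * 10 ^ 4) := by
      field_simp; norm_num
    have : 0 < S.η * 1 * S.ρ * S.Ωs⁻¹ := by positivity
    rw [h1, h3]; linarith
  have hδk : δ * S.k ≤ S.η * (S.ρ / (100 * S.Ωs)) / 400 * S.k := by gcongr
  have hδk0 : 0 < δ * S.k := by positivity
  have c1 : ∀ v ∈ V₁, δ * S.k ≤ (deg (deleteVerts S.Gcap S.H) v (X \ Y₁) : ℝ) := fun v hv => by
    have h1 := hV₁deg v hv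
    have h2 := deg_le_sdiff_add (deleteVerts S.Gcap S.H) v X Y₁
    have h3 := f0 v hv
    linarith
  have hG : deleteVerts S.Gcap S.H ≤ S.G := hS.deleteVerts_Gcap_le.trans hS.Gcap_le_G
  obtain ⟨v₁, hv₁⟩ := hreg.2.1
  have n2 := nonempty_of_deg_pos (hδk0.trans_le (c1 v₁ hv₁))
  obtain ⟨v₂, hv₂⟩ := id n2
  -- A vertex of `V₂` has at least $\frac{\eta\gamma k}{200}$ neighbours in `P 1` in the spots and
  -- fewer than half as many in `Y₂`.
  have n3 : (T.P 1 \ Y₂).Nonempty := by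
    refine nonempty_of_deg_pos (Γ := S.GD) (v := v₂) ?_
    have h1 := deg_GD_of_E sc hS hT hv₂.1.1 fun h => hv₂.2 (s1 h)
    have h2 := deg_le_sdiff_add S.GD v₂ (T.P 1) Y₂
    have h3 := f1 v₂ hv₂
    have : 0 < S.η * S.γ / 400 * S.k := by positivity
    linarith
  refine ⟨V₀, V₁, X \ Y₁, T.P 1 \ Y₂, hreg, heart V₀ V₁ hreg.1 hreg.2.1 hV₀ hV₁, n2,
    n3, fun v hv => ⟨hv.1, fun h => hv.2 (s1 h)⟩, fun v hv => hv.1, fun v hv => ?_, fun v hv => ?_,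
    fun v hv => ?_, b2⟩
  · exact (c1 v hv).trans (by exact_mod_cast deg_mono_left hG)
  · exact (b1 v hv).trans (by exact_mod_cast deg_mono_left hG)
  · refine lt_of_le_of_lt ?_ (f1 v hv)
    have : deg S.GD v (T.P 1 \ (T.P 1 \ Y₂)) ≤ deg S.GD v Y₂ :=
      deg_mono_right fun u hu => by
        by_contra h
        exact hu.2 ⟨hu.1, h⟩
    exact_mod_cast this

end Avoiding

end LKS

namespace LKS

/-! ### Restriction of the matchings to the part `P 1`. -/

section Restriction

set_option linter.unusedSectionVars false

variable {V : Type*} [Finite V] {S : Setup V} {T : Splitting V}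

theorem Setup.CommonSetting.regMatching_MAB (hS : S.CommonSetting) :
    RegMatching S.GD S.ε S.d (S.π * S.𝔠) S.MAB := by
  have hAB : ∀ p ∈ S.MA, ∀ q ∈ S.MB, Disjoint (p.1 ∪ p.2) (q.1 ∪ q.2) := by
    intro p hp q hq
    refine hS.disjAB.mono ?_ ?_
    · rintro x (hx | hx)
      exacts [Or.inl ⟨p, hp, hx⟩, Or.inr ⟨p, hp, hx⟩]
    · rintro x (hx | hx)
      exacts [Or.inl ⟨q, hq, hx⟩, Or.inr ⟨q, hq, hx⟩]
  refine ⟨?_, ?_, ?_, ?_, ?_⟩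
  · rintro p (hp | hp)
    exacts [hS.matchA.card_eq p hp, hS.matchB.card_eq p hp]
  · rintro p (hp | hp)
    exacts [hS.matchA.card_ge p hp, hS.matchB.card_ge p hp]
  · rintro p (hp | hp)
    exacts [hS.matchA.regular p hp, hS.matchB.regular p hp]
  · rintro p (hp | hp)
    exacts [hS.matchA.dense p hp, hS.matchB.dense p hp]
  · rintro p (hp | hp) q (hq | hq) hpq
    · exact hS.matchA.disj p hp q hq hpq
    · have h := hAB p hp q hq
      rw [Set.disjoint_union_left, Set.disjoint_union_right, Set.disjoint_union_right] at h
      exact ⟨h.1.1, h.2.2, h.1.2⟩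
    · have h := (hAB q hq p hp).symm
      rw [Set.disjoint_union_left, Set.disjoint_union_right, Set.disjoint_union_right] at h
      exact ⟨h.1.1, h.2.2, h.1.2⟩
    · exact hS.matchB.disj p hp q hq hpq

theorem Setup.CommonSetting.ν_mul_le (hS : S.CommonSetting) {C : Set V} (hC : C ∈ S.clusters) :
    S.ν * S.k ≤ S.𝔠 ∧ (S.𝔠 : ℝ) ≤ S.εp * S.k := by
  have := hS.sparse.bounded.cluster_size C hC C hC
  rw [hS.cluster_card C hC] at this
  exact ⟨this.1, this.2.2⟩

theorem Setup.CommonSetting.side_ncard_ge {ξ : ℝ} (sc : SmallConstants S.toConstants S.k ξ)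
    (hS : S.CommonSetting) {p : Set V × Set V} (hp : p ∈ S.MAB) :
    S.π * S.ν * S.k ≤ p.1.ncard := by
  obtain ⟨⟨C, hC, -⟩, -⟩ := hS.pair_cluster p hp
  have h1 := hS.regMatching_MAB.card_ge p hp
  have h2 := mul_le_mul_of_nonneg_left (hS.ν_mul_le hC).1 sc.π_pos.le
  linarith

/-- A side that is not exceptional has about the right number of vertices in a part. -/
theorem side_inter_le {q : Fin 3 → ℝ} {s : ℝ}
    (h : S.SplitsWith T.P T.exV T.exSides T.exClusters q) (hq : ∑ i, q i = 1)
    {X : Set V} (hX : ∀ i, q i * (X.ncard : ℝ) - s ≤ ((X ∩ T.P i).ncard : ℝ)) :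
    ((X ∩ T.P 1).ncard : ℝ) ≤ q 1 * X.ncard + 2 * s := by
  have d01 := (h.disj 0 1 (by decide)).mono (Set.inter_subset_right (s := X))
    (Set.inter_subset_right (s := X))
  have d02 := (h.disj 0 2 (by decide)).mono (Set.inter_subset_right (s := X))
    (Set.inter_subset_right (s := X))
  have d12 := (h.disj 1 2 (by decide)).mono (Set.inter_subset_right (s := X))
    (Set.inter_subset_right (s := X))
  have h1 : ((X ∩ T.P 0).ncard : ℝ) + (X ∩ T.P 1).ncard + (X ∩ T.P 2).ncard ≤ X.ncard := by
    have e1 := Set.ncard_union_eq d01 (Set.toFinite _) (Set.toFinite _)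
    have e2 := Set.ncard_union_eq (Set.disjoint_union_left.2 ⟨d02, d12⟩) (Set.toFinite _)
      (Set.toFinite _)
    have e3 : ((X ∩ T.P 0 ∪ X ∩ T.P 1) ∪ X ∩ T.P 2).ncard ≤ X.ncard :=
      Set.ncard_le_ncard (by
        rintro x ((hx | hx) | hx)
        exacts [hx.1, hx.1, hx.1]) (Set.toFinite _)
    rw [e2, e1] at e3
    exact_mod_cast e3
  have h0 := hX 0
  have h2 := hX 2
  rw [Fin.sum_univ_three] at hq
  -- The splitting gives only lower bounds; the upper bound for one part comes from the lower bounds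
  -- for the other two, as the proportions add up to one.
  have : q 1 = 1 - q 0 - q 2 := by linarith
  rw [this]
  linarith

/-- The matching `M₀ ⊆ MAB` can be restricted to the part `P 1` with a small loss. -/
theorem exists_restricted_matching [Nonempty V] {ξ : ℝ} (sc : SmallConstants S.toConstants S.k ξ)
    (hS : S.CommonSetting) (hT : SplittingSetting S T) {M₀ : Set (Set V × Set V)}
    (hM₀ : M₀ ⊆ S.MAB) :
    ∃ N, RegMatching S.GD (400 * S.ε / S.η) (S.d / 2) (S.η * S.π * S.𝔠 / (200 * S.k) * S.k) N ∧
      AbsorbedBy N M₀ ∧ vertsOf N ⊆ T.P 1 ∧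
      (((vertsOf M₀ ∩ T.P 1) \ vertsOf N).ncard : ℝ) ≤ S.ν ^ 7 * S.n := by
  classical
  obtain ⟨q, hq, hq1, hsp⟩ := hT.splits
  have hR := hS.regMatching_MAB
  have hη := sc.η_pos
  have hk := sc.k_pos
  have hπ := sc.π_pos
  have hν := sc.ν_pos
  have hε := sc.ε_pos
  have hd := sc.d_pos
  have hξ0 := sc.ξ_pos
  have hn : 0 < S.n := n_pos
  have hνπ := sc.ν_le_π
  have hν1 := sc.ν_le_one
  have hν5 : S.ν ^ 5 ≤ S.η / 10 ^ 40 := by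
    simpa using sc.ν_pow_le 1 0 0 0 (by norm_num)
  have hξ1 : ξ ≤ S.η / 10 ^ 40 * (S.π * S.ν) := by
    calc ξ ≤ S.ν ^ 10 := sc.ξ_le
      _ ≤ S.ν ^ 7 := pow_le_pow_of_le_one hν.le hν1 (by norm_num)
      _ = S.ν ^ 5 * (S.ν * S.ν) := by ring
      _ ≤ S.η / 10 ^ 40 * (S.π * S.ν) := by gcongr
  have hεη : S.ε ≤ S.η / 200 := by
    have h1 := le_pow_of_le_pow (m := 2) sc.ε_le hd.le sc.d_le_one (by norm_num)
    have h2 : S.d * S.d ≤ S.η * (1 / 10 ^ 40) :=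
      mul_le_mul sc.d_le_η (sc.d_le_η.trans sc.η_le) hd.le hη.le
    rw [pow_two] at h1
    linarith
  have hεd : S.ε ≤ S.d / 2 := by
    have h1 := le_pow_of_le_pow (m := 2) sc.ε_le hd.le sc.d_le_one (by norm_num)
    have h2 : S.d * S.d ≤ S.d * (1 / 10 ^ 40) :=
      mul_le_mul_of_nonneg_left (sc.d_le_η.trans sc.η_le) hd.le
    rw [pow_two] at h1
    linarith
  let Good := {p | p ∈ M₀ ∧ p.1 ∉ T.exSides ∧ p.2 ∉ T.exSides}
  have hξs : ∀ p ∈ S.MAB, ξ * S.k ≤ S.η / 10 ^ 40 * p.1.ncard := fun p hp => by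
    have h1 := hS.side_ncard_ge sc hp
    calc ξ * S.k ≤ S.η / 10 ^ 40 * (S.π * S.ν) * S.k := by gcongr
      _ = S.η / 10 ^ 40 * (S.π * S.ν * S.k) := by ring
      _ ≤ _ := by gcongr
  have hside : ∀ p ∈ Good, ∀ i, q i * (p.1.ncard : ℝ) - ξ * S.k ≤ ((p.1 ∩ T.P i).ncard : ℝ) ∧
      q i * (p.1.ncard : ℝ) - ξ * S.k ≤ ((p.2 ∩ T.P i).ncard : ℝ) := by
    intro p hp i
    have h1 := hsp.side i p.1 ⟨⟨p, hM₀ hp.1, Or.inl rfl⟩, hp.2.1⟩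
    have h2 := hsp.side i p.2 ⟨⟨p, hM₀ hp.1, Or.inr rfl⟩, hp.2.2⟩
    rw [sc.pow_eq] at h1 h2
    rw [← hR.card_eq p (hM₀ hp.1)] at h2
    exact ⟨h1, h2⟩
  -- The two intersections with `P 1` are trimmed to the size of the smaller one. Each has between
  -- $q_1|X|-\xi k$ and $q_1|X|+2\xi k$ vertices, where $|X|$ is the size of the side, so each side
  -- loses at most $3\xi k$.
  have hex : ∀ p : Good, ∃ X ⊆ p.1.1 ∩ T.P 1, ∃ Y ⊆ p.1.2 ∩ T.P 1, X.ncard = Y.ncard ∧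
      S.η / 200 * (p.1.1.ncard : ℝ) ≤ X.ncard ∧
      ((((p.1.1 ∪ p.1.2) ∩ T.P 1) \ (X ∪ Y)).ncard : ℝ) ≤ 6 * ξ * S.k := by
    rintro ⟨p, hp⟩
    have hpM := hM₀ hp.1
    set m := min (p.1 ∩ T.P 1).ncard (p.2 ∩ T.P 1).ncard with hm
    obtain ⟨X, hX, hXc⟩ := Set.exists_subset_card_eq (s := p.1 ∩ T.P 1) (n := m) (min_le_left _ _)
    obtain ⟨Y, hY, hYc⟩ := Set.exists_subset_card_eq (s := p.2 ∩ T.P 1) (n := m) (min_le_right _ _)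
    have u1 := side_inter_le (s := ξ * S.k) hsp hq1 fun i => (hside p hp i).1
    have u2 := side_inter_le (X := p.2) (s := ξ * S.k) hsp hq1
      fun i => by rw [← hR.card_eq p hpM]; exact (hside p hp i).2
    rw [← hR.card_eq p hpM] at u2
    obtain ⟨l1, l2⟩ := hside p hp 1
    have lm : q 1 * (p.1.ncard : ℝ) - ξ * S.k ≤ m := by
      rw [hm, Nat.cast_min]; exact le_min l1 l2
    refine ⟨X, hX, Y, hY, by rw [hXc, hYc], ?_, ?_⟩
    · rw [hXc]
      refine le_trans ?_ lm
      have h1 := hξs p hpM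
      have h2 : S.η / 100 * (p.1.ncard : ℝ) ≤ q 1 * p.1.ncard := by
        gcongr; exact (hT.p_ge 1).trans (hq 1)
      have h3 : 0 ≤ S.η * (p.1.ncard : ℝ) := by positivity
      change S.η / 200 * (p.1.ncard : ℝ) ≤ _
      linarith
    · have h1 : ((p.1 ∪ p.2) ∩ T.P 1) \ (X ∪ Y) ⊆ (p.1 ∩ T.P 1) \ X ∪ (p.2 ∩ T.P 1) \ Y := by
        rintro x ⟨⟨hx | hx, hxP⟩, hn⟩
        · exact Or.inl ⟨⟨hx, hxP⟩, fun h => hn (Or.inl h)⟩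
        · exact Or.inr ⟨⟨hx, hxP⟩, fun h => hn (Or.inr h)⟩
      have h2 : ((((p.1 ∪ p.2) ∩ T.P 1) \ (X ∪ Y)).ncard : ℝ) ≤
          ((p.1 ∩ T.P 1) \ X).ncard + ((p.2 ∩ T.P 1) \ Y).ncard := by
        exact_mod_cast (Set.ncard_le_ncard h1 (Set.toFinite _)).trans (Set.ncard_union_le _ _)
      have h3 := ncard_sdiff_add hX
      have h4 := ncard_sdiff_add hY
      rw [hXc] at h3
      rw [hYc] at h4
      refine h2.trans ?_
      linarith
  choose X hX Y hY hXY hXs hmiss using hex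
  have hXs' : ∀ p : Good, S.η / 200 * (p.1.2.ncard : ℝ) ≤ (Y p).ncard := fun p => by
    rw [← hR.card_eq p.1 (hM₀ p.2.1), ← hXY]; exact hXs p
  have hX1 : ∀ p, X p ⊆ p.1.1 := fun p => (hX p).trans Set.inter_subset_left
  have hY1 : ∀ p, Y p ⊆ p.1.2 := fun p => (hY p).trans Set.inter_subset_left
  let N : Set (Set V × Set V) := Set.range fun p : Good => (X p, Y p)
  refine ⟨N, ⟨?_, ?_, ?_, ?_, ?_⟩, ?_, ?_, ?_⟩
  · rintro _ ⟨p, rfl⟩; exact hXY p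
  · rintro _ ⟨p, rfl⟩
    refine le_trans ?_ (hXs p)
    have h1 := mul_le_mul_of_nonneg_left (hR.card_ge p.1 (hM₀ p.2.1)) (by positivity : 0 ≤ S.η / 200)
    refine le_trans (le_of_eq ?_) h1
    field_simp
  · rintro _ ⟨p, rfl⟩
    -- The proportion kept of each side is at least $\frac\eta{200}$; this gives the regularity
    -- $\frac{400\epsilon}\eta$.
    refine (hR.regular p.1 (hM₀ p.2.1)).sub (c := S.η / 200) (by positivity) hεη (hX1 p) (hY1 p)
      (hXs p) (hXs' p) ?_ ?_
    · rw [le_div_iff₀ hη]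
      nlinarith [sc.η_le_one]
    · have : 400 * S.ε / S.η * (S.η / 200) = 2 * S.ε := by field_simp; norm_num
      rw [this]; linarith
  · rintro _ ⟨p, rfl⟩
    have h1 := (hR.regular p.1 (hM₀ p.2.1)).sub_density hεη (hX1 p) (hY1 p) (hXs p) (hXs' p)
    have h2 := hR.dense p.1 (hM₀ p.2.1)
    rw [abs_lt] at h1
    change S.d / 2 ≤ density S.GD (X p) (Y p)
    linarith [h1.2]
  · rintro _ ⟨p, rfl⟩ _ ⟨p', rfl⟩ hne
    have hpp : p.1 ≠ p'.1 := fun h => hne (by rw [Subtype.ext h])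
    obtain ⟨e1, e2, e3⟩ := hR.disj p.1 (hM₀ p.2.1) p'.1 (hM₀ p'.2.1) hpp
    exact ⟨e1.mono (hX1 p) (hX1 p'), e2.mono (hY1 p) (hY1 p'), e3.mono (hX1 p) (hY1 p')⟩
  · rintro _ ⟨p, rfl⟩
    exact ⟨p.1, p.2.1, hX1 p, hY1 p⟩
  · rintro x (⟨_, ⟨p, rfl⟩, hx⟩ | ⟨_, ⟨p, rfl⟩, hx⟩)
    exacts [(hX p hx).2, (hY p hx).2]
  · let B : Good → Set V := fun p => ((p.1.1 ∪ p.1.2) ∩ T.P 1) \ (X p ∪ Y p)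
    -- The two sides of a pair have equal size, so a pair with an exceptional side has at most twice
    -- as many vertices as it has in the union of the exceptional sides.
    let Bad := {p | p ∈ M₀ ∧ (p.1 ∈ T.exSides ∨ p.2 ∈ T.exSides)}
    have hsub : (vertsOf M₀ ∩ T.P 1) \ vertsOf N ⊆
        (⋃ p ∈ (Set.univ : Set Good), B p) ∪ ⋃ p ∈ Bad, (p.1 ∪ p.2) := by
      rintro x ⟨⟨hx, hxP⟩, hxN⟩
      have : ∃ p ∈ M₀, x ∈ p.1 ∪ p.2 := by
        rcases hx with ⟨p, hp, hx⟩ | ⟨p, hp, hx⟩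
        exacts [⟨p, hp, Or.inl hx⟩, ⟨p, hp, Or.inr hx⟩]
      obtain ⟨p, hp, hx⟩ := this
      by_cases hb : p.1 ∈ T.exSides ∨ p.2 ∈ T.exSides
      · exact Or.inr (Set.mem_biUnion (show p ∈ Bad from ⟨hp, hb⟩) hx)
      · have hg : p ∈ Good := ⟨hp, fun h => hb (Or.inl h), fun h => hb (Or.inr h)⟩
        refine Or.inl (Set.mem_biUnion (Set.mem_univ (⟨p, hg⟩ : Good)) ⟨⟨hx, hxP⟩, ?_⟩)
        rintro (h | h)
        · exact hxN (Or.inl ⟨_, ⟨⟨p, hg⟩, rfl⟩, h⟩)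
        · exact hxN (Or.inr ⟨_, ⟨⟨p, hg⟩, rfl⟩, h⟩)
    have h1 : ((⋃ p ∈ (Set.univ : Set Good), B p).ncard : ℝ) ≤
        6 * ξ / (S.π * S.ν) * (Set.univ : Set V).ncard := by
      refine ncard_biUnion_le_mul Set.univ (fun p : Good => p.1.1) B Set.univ (by positivity) ?_
        (fun _ _ => Set.subset_univ _) ?_
      · intro p _ p' _ hne
        exact (hR.disj p.1 (hM₀ p.2.1) p'.1 (hM₀ p'.2.1) fun h => hne (Subtype.ext h)).1
      · intro p _
        refine (hmiss p).trans ?_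
        have h2 := hS.side_ncard_ge sc (hM₀ p.2.1)
        calc 6 * ξ * S.k = 6 * ξ / (S.π * S.ν) * (S.π * S.ν * S.k) := by field_simp
          _ ≤ _ := by gcongr
    have h2 : ((⋃ p ∈ Bad, (p.1 ∪ p.2)).ncard : ℝ) ≤ 2 * (⋃₀ T.exSides).ncard := by
      refine ncard_biUnion_le_mul Bad (fun p => (p.1 ∪ p.2) ∩ ⋃₀ T.exSides) (fun p => p.1 ∪ p.2) _
        (by norm_num) ?_ (fun _ _ => Set.inter_subset_right) ?_
      · intro p hp p' hp' hne
        obtain ⟨e1, e2, e3⟩ := hR.disj p (hM₀ hp.1) p' (hM₀ hp'.1) hne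
        obtain ⟨-, -, e4⟩ := hR.disj p' (hM₀ hp'.1) p (hM₀ hp.1) hne.symm
        refine Disjoint.mono Set.inter_subset_left Set.inter_subset_left ?_
        rw [Set.disjoint_union_left, Set.disjoint_union_right, Set.disjoint_union_right]
        exact ⟨⟨e1, e3⟩, e4.symm, e2⟩
      · intro p hp
        have e1 : ((p.1 ∪ p.2).ncard : ℝ) ≤ p.1.ncard + p.2.ncard := by
          exact_mod_cast Set.ncard_union_le _ _
        have e2 := hR.card_eq p (hM₀ hp.1)
        have e3 : (p.1.ncard : ℝ) ≤ ((p.1 ∪ p.2) ∩ ⋃₀ T.exSides).ncard := by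
          rcases hp.2 with h | h
          · have : p.1 ⊆ (p.1 ∪ p.2) ∩ ⋃₀ T.exSides := fun x hx => ⟨Or.inl hx, p.1, h, hx⟩
            exact_mod_cast Set.ncard_le_ncard this (Set.toFinite _)
          · rw [e2]
            have : p.2 ⊆ (p.1 ∪ p.2) ∩ ⋃₀ T.exSides := fun x hx => ⟨Or.inr hx, p.2, h, hx⟩
            exact_mod_cast Set.ncard_le_ncard this (Set.toFinite _)
        rw [← e2] at e1
        linarith
    have h3 : ((⋃₀ T.exSides).ncard : ℝ) ≤ ξ * S.n :=
      hsp.exSides_small.trans (by gcongr; exact sc.exp_le)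
    have h4 : ((Set.univ : Set V).ncard : ℝ) = S.n := by rw [Set.ncard_univ]; rfl
    rw [h4] at h1
    have h5 : (((vertsOf M₀ ∩ T.P 1) \ vertsOf N).ncard : ℝ) ≤
        (⋃ p ∈ (Set.univ : Set Good), B p).ncard + (⋃ p ∈ Bad, (p.1 ∪ p.2)).ncard := by
      exact_mod_cast (Set.ncard_le_ncard hsub (Set.toFinite _)).trans (Set.ncard_union_le _ _)
    -- A side has at least $\pi\nu k$ vertices, with $\pi\nu\ge\nu^2$, while $\xi\le\nu^{10}$.
    have h6 : 6 * ξ / (S.π * S.ν) + 2 * ξ ≤ S.ν ^ 7 := by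
      have a1 : ξ / (S.π * S.ν) ≤ S.ν ^ 8 := by
        rw [div_le_iff₀ (by positivity)]
        calc ξ ≤ S.ν ^ 10 := sc.ξ_le
          _ = S.ν ^ 8 * (S.ν * S.ν) := by ring
          _ ≤ S.ν ^ 8 * (S.π * S.ν) := by gcongr
      have a2 : ξ ≤ S.ν ^ 8 := le_pow_of_le_pow sc.ξ_le hν.le hν1 (by norm_num)
      have a3 : S.ν ^ 8 ≤ S.ν ^ 7 * (1 / 10 ^ 40) := by
        rw [pow_succ S.ν 7]
        gcongr
        exact sc.ν_le_η.trans sc.η_le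
      have a4 : 0 < S.ν ^ 7 := by positivity
      have a5 : 6 * ξ / (S.π * S.ν) = 6 * (ξ / (S.π * S.ν)) := by ring
      rw [a5]
      linarith
    calc _ ≤ 6 * ξ / (S.π * S.ν) * S.n + 2 * (ξ * S.n) := by linarith
      _ = (6 * ξ / (S.π * S.ν) + 2 * ξ) * S.n := by ring
      _ ≤ _ := by gcongr

end Restriction

end LKS

namespace LKS

/-! ### Degrees into the matchings, and configuration (◇9). -/

section MatchingConfigurations

set_option linter.unusedSectionVars false

variable {V : Type*} [Finite V] {S : Setup V} {T : Splitting V}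

theorem deg_le_of_not_expShadow {v : V} (h : v ∉ expShadow S) :
    (deg S.Gcap v S.Gexp.support : ℝ) ≤ S.ρ * S.k := by
  by_contra! hc
  exact h hc

theorem deg_E_le {ξ : ℝ} (sc : SmallConstants S.toConstants S.k ξ) (hS : S.CommonSetting) {v : V}
    (hvH : v ∉ S.H) (h : v ∉ S.VtoE) : (deg S.Gcap v S.E : ℝ) ≤ S.ρ * S.k := by
  rw [← hS.deg_deleteVerts hvH fun u hu => hS.E_disj hu]
  by_contra! hc
  refine h (lt_of_le_of_lt ?_ hc)
  have h1 : S.ρ * S.k / (100 * S.Ωs) = S.ρ * S.k * (S.Ωs⁻¹ / 100) := by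
    rw [div_eq_mul_inv, mul_inv]; ring
  rw [h1]
  exact mul_le_of_le_one_right (mul_pos sc.ρ_pos sc.k_pos).le (by linarith [sc.o_le_one])

/-- A small vertex outside the support of `Gexp` and outside `E` is in $\mathbb S^0$, which $V_+$
excludes except on $V_{AB}$. -/
theorem mem_of_mem_Vplus {u : V} (hu : u ∈ S.Vplus) :
    u ∈ vertsOf S.MAB ∨ u ∈ S.L \ vertsOf S.MAB ∨ u ∈ S.Gexp.support ∨ u ∈ S.E := by
  by_cases h1 : u ∈ vertsOf S.MAB
  · exact Or.inl h1
  by_cases h2 : u ∈ S.Gexp.support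
  · exact Or.inr (Or.inr (Or.inl h2))
  by_cases h3 : u ∈ S.E
  · exact Or.inr (Or.inr (Or.inr h3))
  refine Or.inr (Or.inl ⟨L_of_not_Sm fun h => ?_, h1⟩)
  exact hu ⟨⟨h, fun h' => h'.elim h2 h3⟩, h1⟩

theorem vertsOf_MB_subset : vertsOf S.MB ⊆ vertsOf S.MAB := by
  rintro u (⟨p, hp, h⟩ | ⟨p, hp, h⟩)
  exacts [Or.inl ⟨p, Or.inr hp, h⟩, Or.inr ⟨p, Or.inr hp, h⟩]

theorem mem_XA_of_not_MAB {u : V} (h : u ∈ S.L \ vertsOf S.MAB) : u ∈ S.XA :=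
  ⟨h.1, fun hB => h.2 (vertsOf_MB_subset hB)⟩

/-- The case where the first sides send almost all edges to the matchings. -/
theorem conf9_of_caseB [Nonempty V] {ξ ε d l d' : ℝ} {M : Set (Set V × Set V)}
    (hM : UsableMatching S T ε d l d' M) (sc : SmallConstants S.toConstants S.k ξ)
    (hS : S.CommonSetting) (hT : SplittingSetting S T)
    (hM1 : verts1 M ⊆ (S.XA ∩ T.P 0) \ (S.J ∪ S.J2 ∪ S.J3 ∪ T.exV ∪ FF S T))
    (hM2 : verts2 M ⊆ (S.XB ∩ T.P 0) \ (S.J ∪ T.exV ∪ FF S T))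
    (hdisj : verts1 M ∩ (expShadow S ∪ S.VtoE) = ∅) :
    Conf9 S T (S.ρ * S.η ^ 8 / (10 ^ 27 * S.Ωs ^ 3)) (2 * S.η ^ 3 / 10 ^ 3)
      (T.p 1 * (1 + S.η / 40) * S.k) (T.p 2 * (1 + S.η / 20) * S.k)
      (400 * S.ε / S.η) (S.d / 2) (S.η * S.π * S.𝔠 / (200 * S.k)) (4 * S.π) d'
      (S.η ^ 2 * S.ν / (2 * 10 ^ 4)) := by
  obtain ⟨q, hq, hq1, hsp⟩ := hT.splits
  have hη := sc.η_pos
  have hk := sc.k_pos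
  have hρ := sc.ρ_pos
  have hΩ := sc.Ω_pos
  have ho := sc.o_pos
  have hη1 := sc.η_le_one
  have ho1 := sc.o_le_one
  have hn : 0 < S.n := n_pos
  have hν := sc.ν_pos
  set δ := S.ρ * S.η ^ 8 / (10 ^ 27 * S.Ωs ^ 3) with hδ
  have hδ0 : 0 < δ := by positivity
  -- Second sides may lie in `E`. Including all sides inside `E` in the cover leaves only vertices
  -- of clusters outside it.
  set F := coverFamily S S.E with hF
  obtain ⟨N, hN, hNabs, hNP, hmiss⟩ := exists_restricted_matching sc hS hT (subset_refl S.MAB)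
  set Miss := (vertsOf S.MAB ∩ T.P 1) \ vertsOf N with hMiss
  set X := (vertsOf S.MAB ∩ T.P 1) \ ⋃₀ F with hX
  have hE : ∀ v ∈ verts1 M, v ∉ expShadow S ∧ v ∉ S.VtoE := fun v hv => by
    constructor <;> intro h <;> exact Set.notMem_empty v (hdisj ▸ ⟨hv, by simp [h]⟩)
  have hH : ∀ v ∈ verts1 M, v ∉ S.H := fun v hv => hT.P_not_H (hM1 hv).1.2
  have hc1 := sc.sqrt_γ_le
  have hc2 := sc.ρ_le_η_cube
  have hη3 : 0 < S.η ^ 3 := by positivity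
  have hFdeg : ∀ v ∈ verts1 M,
      S.η ^ 3 * S.k / 10 ^ 3 + √S.γ * S.k + deg S.Gcap v S.E ≤ 2 * S.η ^ 3 / 10 ^ 3 * S.k := by
    intro v hv
    have h1 := deg_E_le sc hS (hH v hv) (hE v hv).2
    have h2 : √S.γ * S.k ≤ S.η ^ 3 / 10 ^ 40 * S.k := by gcongr
    have h3 : S.ρ * S.k ≤ S.η ^ 3 / 10 ^ 40 * S.k := by gcongr
    have h4 : 0 < S.η ^ 3 * S.k := by positivity
    linarith
  -- Only the first step of the chain is used. Starting the removed set with `Miss` ensures that the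
  -- kept part of `X` is covered by `N`.
  obtain ⟨V₀, V₁, Y₁, Y₂, Y₃, hV₀, hV₁, s1, s2, hreg, f0, -, -, b1, -, -⟩ :=
    hM.exists_chain sc X ∅ ∅ Miss ∅ S.GD ⊥ ⊥ (S.η ^ 2 / 10 ^ 5) S.Ωs S.Ωs δ (by positivity) hΩ hΩ
      hδ0.le (fun v hv => hS.deg_GD_le (hT.P_not_H hv.1.2) _) (by simp)
      (fun v hv => hS.deg_GD_le (hT.P_not_H hv.1.2) _) (by simp)
      (hmiss.trans (by
        gcongr ?_ * _
        exact pow_le_pow_of_le_one hν.le sc.ν_le_one (by norm_num)))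
      (by simp only [Set.ncard_empty, Nat.cast_zero]; positivity)
      (by
        have h1 := sc.ν_pow_le 2 2 1 0 (by norm_num)
        simp only [pow_zero, pow_one, mul_one] at h1
        have w1 : S.Ωs / S.Ωs = 1 := div_self hΩ.ne'
        have w2 : S.Ωs ^ 2 / (S.Ωs * S.Ωs) = 1 := by rw [pow_two]; exact div_self (by positivity)
        rw [w1, w2]
        set Q := S.η ^ 2 * S.ρ * S.Ωs⁻¹ with hQ
        have hQ0 : 0 < Q := by positivity
        have e1 : S.ν ^ 5 * S.Ωs ≤ Q / 10 ^ 40 := by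
          calc S.ν ^ 5 * S.Ωs ≤ (S.η ^ 2 * S.Ωs⁻¹ ^ 2 * S.ρ / 10 ^ 40) * S.Ωs := by gcongr
            _ = Q / 10 ^ 40 := by rw [hQ]; field_simp
        have e2 : δ ≤ Q / 10 ^ 27 := by
          have h3 : δ = (S.η ^ 8 * S.ρ * S.Ωs⁻¹ ^ 3) / 10 ^ 27 := by rw [hδ]; field_simp
          rw [h3, hQ]
          gcongr ?_ * _ * ?_ / _
          · exact pow_le_pow_of_le_one hη.le hη1 (by norm_num)
          · exact pow_le_of_le_one ho.le ho1 (by norm_num)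
        have e3 : S.η ^ 2 / 10 ^ 5 * S.ρ / (10 * S.Ωs) = Q / 10 ^ 6 := by
          rw [hQ]; field_simp
        rw [e3]
        linarith)
  have hheart := heart1_of_caseB (γ' := 2 * S.η ^ 3 / 10 ^ 3) sc hS hT S.E hreg.1 hreg.2.1
    (hV₁.trans hM1) (hV₀.trans hM2) fun v hv => hFdeg v (hV₁ hv)
  refine ⟨V₀, V₁, X \ Y₁, F, N, hheart, hN, hNabs, hNP, hreg, ?_, ?_, ?_, b1⟩
  · rintro x ⟨hx, hxY⟩
    refine ⟨?_, hx.2⟩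
    by_contra h
    exact hxY (s1 ⟨hx.1, h⟩)
  · rintro x ⟨hx, hxF⟩
    have : ∃ p ∈ S.MAB, x ∈ p.1 ∨ x ∈ p.2 := by
      rcases hx with ⟨p, hp, hx⟩ | ⟨p, hp, hx⟩
      · obtain ⟨p', hp', h1, -⟩ := hNabs p hp
        exact ⟨p', hp', Or.inl (h1 hx)⟩
      · obtain ⟨p', hp', -, h1⟩ := hNabs p hp
        exact ⟨p', hp', Or.inr (h1 hx)⟩
    obtain ⟨p, hp, hx | hx⟩ := this
    · obtain ⟨C, hC, h⟩ := (hS.pair_cluster p hp).1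
      exact ⟨C, hC, h hx⟩
    · rcases (hS.pair_cluster p hp).2 with ⟨C, hC, h⟩ | h
      · exact ⟨C, hC, h hx⟩
      · exact absurd ⟨p.2, Or.inr (Or.inr ⟨⟨p, hp, Or.inr rfl⟩, fun y hy => (h hy).2⟩), hx⟩ hxF
  · intro v hv
    have hvM := hV₁ hv
    have hvs := hM1 hvM
    have hvH := hH v hvM
    obtain ⟨hvW, hvE⟩ := hE v hvM
    have dW := deg_le_of_not_expShadow hvW
    have dE := deg_E_le sc hS hvH hvE
    have dXA : (deg S.Gcap v S.XA : ℝ) ≤ S.η ^ 3 * S.k / 10 ^ 3 := by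
      by_contra! h
      exact hvs.2 (Or.inl (Or.inl (Or.inr ⟨hvs.1.1, h⟩)))
    have dg := deg_Vgood_of_XA hS hvs.1.1 fun h => hvs.2 (Or.inl (Or.inl (Or.inl (Or.inl h))))
    -- A good neighbour outside $V_{AB}$ is in `XA`, in the support of `Gexp` or in `E`. These are
    -- negligible because the vertex is outside `J3`, `expShadow` and `VtoE`.
    have a1 : (deg S.Gcap v S.Vgood : ℝ) ≤ deg (deleteVerts S.Gcap S.H) v (vertsOf S.MAB)
        + deg S.Gcap v (S.XA ∪ S.Gexp.support ∪ S.E) := by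
      have : deg S.Gcap v S.Vgood ≤ deg (deleteVerts S.Gcap S.H) v (vertsOf S.MAB)
          + deg S.Gcap v (S.XA ∪ S.Gexp.support ∪ S.E) := deg_le_add fun u hu hadj => by
        rcases mem_of_mem_Vplus hu.1 with h | h | h | h
        · exact Or.inl ⟨h, hadj, hvH, fun h' => hu.2 (Or.inl h')⟩
        · exact Or.inr ⟨Or.inl (Or.inl (mem_XA_of_not_MAB h)), hadj⟩
        · exact Or.inr ⟨Or.inl (Or.inr h), hadj⟩
        · exact Or.inr ⟨Or.inr h, hadj⟩
      exact_mod_cast this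
    have a2 := deg_union_le S.Gcap v (S.XA ∪ S.Gexp.support) S.E
    have a3 := deg_union_le S.Gcap v S.XA S.Gexp.support
    have a4 := hsp.deg_ge Gcap_mem_splitGraphs hvH (fun h => hvs.2 (Or.inl (Or.inr h)))
      (U := vertsOf S.MAB) (fun u hu => hS.MAB_disj hu) (fun u hu u' _ hj => (hj 10).1 hu) 1
    rw [sc.pow_eq] at a4
    have hηsq : S.η ^ 3 ≤ S.η ^ 2 / 10 ^ 40 := by
      have := mul_le_mul_of_nonneg_left sc.η_le (pow_nonneg hη.le 2)
      rw [← pow_succ] at this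
      linarith
    have hηsq' : S.η ^ 2 ≤ S.η := pow_le_of_le_one hη.le hη1 (by norm_num)
    have a5 : (1 + 8 * S.η / 100) * S.k ≤
        (deg (deleteVerts S.Gcap S.H) v (vertsOf S.MAB) : ℝ) := by
      have h3 : S.ρ * S.k ≤ S.η / 10 ^ 40 * S.k := by gcongr; linarith
      have h4 : S.η ^ 3 * S.k ≤ S.η * S.k := by gcongr; linarith
      have h5 : 0 < S.η * S.k := by positivity
      linarith
    have a6 := sc.split_ineq (b := 1 + 7 * S.η / 100) (hT.p_ge 1) (hq 1) (by positivity)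
      (by linarith) a5
    have a7 : (deg (deleteVerts S.Gcap S.H) v (T.P 1 ∩ vertsOf S.MAB) : ℝ) ≤
        deg S.GD v X + deg S.Gcap v (⋃₀ F ∪ S.Gexp.support) := by
      have : deg (deleteVerts S.Gcap S.H) v (T.P 1 ∩ vertsOf S.MAB) ≤
          deg S.GD v X + deg S.Gcap v (⋃₀ F ∪ S.Gexp.support) := deg_le_add fun u hu hadj => by
        by_cases h1 : u ∈ ⋃₀ F
        · exact Or.inr ⟨Or.inl h1, hadj.1⟩
        by_cases h2 : u ∈ S.Gexp.support
        · exact Or.inr ⟨Or.inr h2, hadj.1⟩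
        exact Or.inl ⟨⟨⟨hu.2, hu.1⟩, h1⟩,
          hS.Gcap_not_support hadj.1 hadj.2.1 hadj.2.2 (Or.inr h2)⟩
      exact_mod_cast this
    have a8 := deg_union_le S.Gcap v (⋃₀ F) S.Gexp.support
    have a9 := hheart.deg_cover v hv
    have a10 := deg_le_sdiff_add S.GD v X Y₁
    have a11 := f0 v hv
    have a12 : S.ρ * S.k ≤ S.η ^ 2 / 10 ^ 40 * S.k := by gcongr; linarith
    have a13 : 2 * S.η ^ 3 / 10 ^ 3 * S.k ≤ S.η ^ 2 / 10 ^ 40 * S.k :=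
      mul_le_mul_of_nonneg_right (by linarith) hk.le
    -- The surplus of $\frac{7\eta}{100}$ over $\frac\eta{40}$, multiplied by $\mathfrak
    -- p_1k\ge\frac{\eta k}{100}$, exceeds the loss $\frac{\eta^2k}{10^5}$ to `Y₁` and the much
    -- smaller losses to the cover and to the support of `Gexp`.
    have a14 : S.η / 100 * (S.η * S.k) ≤ T.p 1 * (S.η * S.k) := by
      gcongr; exact hT.p_ge 1
    have a15 : 0 < S.η ^ 2 * S.k := by positivity
    nlinarith

end MatchingConfigurations

end LKS

namespace LKS

/-! ### Large vertices that see the avoiding set, and configuration (◇8). -/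

section AvoidingThroughLarge

set_option linter.unusedSectionVars false

variable {V : Type*} [Finite V] {S : Setup V} {T : Splitting V}

/-- This is the budget condition `hsmall` of `exists_chain` for a chain with three effective steps.
The largest weight contains $1/(\rho\gamma)$; multiplied by `δ` it leaves $\gamma^3$, which is far
below `ρ`. -/
theorem SmallConstants.conf8_ineq {K : Constants} {k : ℕ} {ξ : ℝ} (sc : SmallConstants K k ξ) :
    K.ν ^ 5 * K.Ωs * (1 + K.Ωs / (K.η * (K.ρ / (100 * K.Ωs)) / 400)) +
      K.η ^ 4 * K.γ ^ 4 * K.ρ / (10 ^ 15 * K.Ωs ^ 5) *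
        (1 + K.Ωs / (K.η * (K.ρ / (100 * K.Ωs)) / 400) +
          K.Ωs ^ 2 / (K.η * (K.ρ / (100 * K.Ωs)) / 400 * (K.η * K.γ / 400))) <
      K.η * (K.η ^ 2 / (2 * 10 ^ 5)) / 400 * K.ρ / (10 * K.Ωs) := by
  have hη := sc.η_pos
  have hρ := sc.ρ_pos
  have hγ := sc.γ_pos
  have hΩ := sc.Ω_pos
  have ho := sc.o_pos
  have hη1 := sc.η_le_one
  have hρ1 := sc.ρ_le_one
  have hγ1 := sc.γ_le_one
  have ho1 := sc.o_le_one
  have hν := sc.ν_pos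
  have hΩ1 : 1 ≤ K.Ωs := by
    have := (one_le_inv₀ ho).2 ho1
    rwa [inv_inv] at this
  set w₁ := K.Ωs / (K.η * (K.ρ / (100 * K.Ωs)) / 400) with hw₁
  set w₂ := K.Ωs ^ 2 / (K.η * (K.ρ / (100 * K.Ωs)) / 400 * (K.η * K.γ / 400)) with hw₂
  set δ := K.η ^ 4 * K.γ ^ 4 * K.ρ / (10 ^ 15 * K.Ωs ^ 5) with hδ
  have hδ0 : 0 < δ := by positivity
  have h1 : 1 ≤ w₁ := by
    have e : w₁ = K.Ωs ^ 2 * (4 * 10 ^ 4) / (K.η * K.ρ) := by rw [hw₁]; field_simp; norm_num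
    rw [e, le_div_iff₀ (by positivity), one_mul]
    have : K.η * K.ρ ≤ 1 := mul_le_one₀ hη1 hρ.le hρ1
    nlinarith
  have h2 : w₁ ≤ w₂ := by
    have e : w₂ = w₁ * (K.Ωs * 400 / (K.η * K.γ)) := by rw [hw₁, hw₂]; field_simp
    rw [e]
    refine le_mul_of_one_le_right (by positivity) ?_
    rw [le_div_iff₀ (by positivity), one_mul]
    have : K.η * K.γ ≤ 1 := mul_le_one₀ hη1 hγ.le hγ1
    nlinarith
  set Q := K.η ^ 3 * K.ρ * K.Ωs⁻¹ with hQ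
  have hQ0 : 0 < Q := by positivity
  have h3 : K.ν ^ 5 * K.Ωs * w₁ ≤ 4 * 10 ^ 4 / 10 ^ 40 * Q := by
    have := sc.ν_pow_le 4 4 2 0 (by norm_num)
    simp only [pow_zero, mul_one] at this
    calc K.ν ^ 5 * K.Ωs * w₁ ≤ (K.η ^ 4 * K.Ωs⁻¹ ^ 4 * K.ρ ^ 2 / 10 ^ 40) * K.Ωs * w₁ := by gcongr
      _ = 4 * 10 ^ 4 / 10 ^ 40 * Q := by rw [hw₁, hQ]; field_simp; norm_num
  have h4 : δ * w₂ ≤ 2 / 10 ^ 8 / 10 ^ 40 * Q := by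
    have e : δ * w₂ = 16 / 10 ^ 9 * (K.η ^ 2 * (K.γ * K.γ * K.γ) * (K.Ωs⁻¹ * K.Ωs⁻¹)) := by
      rw [hδ, hw₂]; field_simp; norm_num
    have hγη : K.γ ≤ K.η := sc.γ_le_ρ.trans (sc.ρ_le_o.trans sc.o_le_η)
    have e2 : K.η ^ 2 * (K.γ * K.γ * K.γ) * (K.Ωs⁻¹ * K.Ωs⁻¹) ≤
        K.η ^ 2 * (K.η * K.ρ * (1 / 10 ^ 40)) * (1 * K.Ωs⁻¹) := by
      gcongr
      · exact sc.γ_le_ρ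
      · exact hγη.trans sc.η_le
    have e3 : K.η ^ 2 * (K.η * K.ρ * (1 / 10 ^ 40)) * (1 * K.Ωs⁻¹) = Q / 10 ^ 40 := by
      rw [hQ]; ring
    rw [e3] at e2
    rw [e]
    linarith
  have h5 : K.η * (K.η ^ 2 / (2 * 10 ^ 5)) / 400 * K.ρ / (10 * K.Ωs) = Q / (8 * 10 ^ 8) := by
    rw [hQ]; field_simp; norm_num
  rw [h5]
  have h6 : K.ν ^ 5 * K.Ωs * 1 ≤ K.ν ^ 5 * K.Ωs * w₁ := by gcongr
  have h7 : δ * 1 ≤ δ * w₂ := by gcongr; linarith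
  have h8 : δ * w₁ ≤ δ * w₂ := by gcongr
  linarith

/-- The large vertices outside the matchings that see the avoiding set and have no exceptional
neighbourhoods. -/
def cleanLarge (S : Setup V) : Set V :=
  (S.VtoE ∩ S.L) \ (vertsOf S.MAB ∪ (S.VnoH ∪ S.Lsharp ∪ S.Jatom ∪ S.J1) ∪ S.Gexp.support ∪ S.E)

/-- All sets in the definition of `cleanLarge` are split sets, which makes degrees into it split
proportionally. -/
theorem cleanLarge_union_of_atoms {u u' : V} (hu : u ∈ cleanLarge S)
    (h : ∀ j, u ∈ S.splitSets j ↔ u' ∈ S.splitSets j) : u' ∈ cleanLarge S := by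
  have h3 : u ∈ S.Gexp.support ↔ u' ∈ S.Gexp.support := h 3
  have h4 : u ∈ S.E ↔ u' ∈ S.E := h 4
  have h5 : u ∈ S.VtoE ↔ u' ∈ S.VtoE := h 5
  have h6 : u ∈ S.Jatom ↔ u' ∈ S.Jatom := h 6
  have h7 : u ∈ S.L ↔ u' ∈ S.L := h 7
  have h8 : u ∈ S.Lsharp ↔ u' ∈ S.Lsharp := h 8
  have h9 : u ∈ S.VnoH ↔ u' ∈ S.VnoH := h 9
  have h10 : u ∈ vertsOf S.MAB ↔ u' ∈ vertsOf S.MAB := h 10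
  have h11 : u ∈ S.J1 ↔ u' ∈ S.J1 := h 11
  simpa only [cleanLarge, Set.mem_sdiff, Set.mem_inter_iff, Set.mem_union, h3, h4, h5, h6, h7, h8,
    h9, h10, h11] using hu

theorem deg_le_of_not_J {v : V} (hJ : v ∉ S.J) :
    (deg S.Gcap v (S.VnoH ∪ S.Lsharp ∪ S.Jatom ∪ S.J1) : ℝ) ≤ S.η ^ 2 * S.k / 10 ^ 5 := by
  by_contra! h
  refine hJ (Or.inr ?_)
  have : deg S.Gcap v (S.VnoH ∪ S.Lsharp ∪ S.Jatom ∪ S.J1) ≤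
      deg (S.GD ⊔ S.Gcap) v (S.VnoH ∪ S.Lsharp ∪ S.Jatom ∪ S.J1) := deg_mono_left le_sup_right
  exact lt_of_lt_of_le h (by exact_mod_cast this)

/-- Of the more than $\frac{2\eta^2k}{10^5}$ neighbours given by `RR`, being outside `J` limits
those in the exceptional sets to half of that amount, and the support of `Gexp` and `E` take at most
$2\rho k$. -/
theorem deg_cleanLarge_of_RR {ξ : ℝ} (sc : SmallConstants S.toConstants S.k ξ)
    (hS : S.CommonSetting) {v : V} (hvH : v ∉ S.H) (hR : v ∈ RR S) (hJ : v ∉ S.J)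
    (hW : v ∉ expShadow S) (hE : v ∉ S.VtoE) :
    S.η ^ 2 / (2 * 10 ^ 5) * S.k ≤ (deg S.Gcap v (cleanLarge S) : ℝ) := by
  have hη := sc.η_pos
  have hk := sc.k_pos
  have h1 : 2 * S.η ^ 2 * S.k / 10 ^ 5 <
    (deg S.Gcap v ((S.VtoE ∩ S.L) \ vertsOf S.MAB) : ℝ) := hR
  have h2 : (deg S.Gcap v ((S.VtoE ∩ S.L) \ vertsOf S.MAB) : ℝ) ≤ deg S.Gcap v (cleanLarge S) +
      deg S.Gcap v ((S.VnoH ∪ S.Lsharp ∪ S.Jatom ∪ S.J1) ∪ S.Gexp.support ∪ S.E) := by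
    have : deg S.Gcap v ((S.VtoE ∩ S.L) \ vertsOf S.MAB) ≤ deg S.Gcap v (cleanLarge S) +
        deg S.Gcap v ((S.VnoH ∪ S.Lsharp ∪ S.Jatom ∪ S.J1) ∪ S.Gexp.support ∪ S.E) :=
      deg_le_add fun u hu hadj => by
        by_cases h : u ∈ (S.VnoH ∪ S.Lsharp ∪ S.Jatom ∪ S.J1) ∪ S.Gexp.support ∪ S.E
        · exact Or.inr ⟨h, hadj⟩
        · refine Or.inl ⟨⟨hu.1, ?_⟩, hadj⟩
          rintro (((h' | h') | h') | h')
          · exact hu.2 h'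
          · exact h (Or.inl (Or.inl h'))
          · exact h (Or.inl (Or.inr h'))
          · exact h (Or.inr h')
    exact_mod_cast this
  have h3 := deg_union_le S.Gcap v
    ((S.VnoH ∪ S.Lsharp ∪ S.Jatom ∪ S.J1) ∪ S.Gexp.support) S.E
  have h4 := deg_union_le S.Gcap v (S.VnoH ∪ S.Lsharp ∪ S.Jatom ∪ S.J1) S.Gexp.support
  have h5 := deg_le_of_not_J hJ
  have h6 := deg_le_of_not_expShadow hW
  have h7 := deg_E_le sc hS hvH hE
  have h8 : S.η ^ 3 ≤ S.η ^ 2 := pow_le_pow_of_le_one hη.le sc.η_le_one (by norm_num)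
  have h9 : S.ρ * S.k ≤ S.η ^ 2 / 10 ^ 40 * S.k := by
    gcongr
    linarith [sc.ρ_le_η_cube]
  have h10 : 0 < S.η ^ 2 * S.k := by positivity
  linarith

/-- Vertices outside the matchings, the large-degree exceptions and the nowhere-dense graph send
many captured edges to the matchings and the avoiding set. -/
theorem deg_MAB_union_E {ξ : ℝ} (sc : SmallConstants S.toConstants S.k ξ)
    (hS : S.CommonSetting) {u : V} (huH : u ∉ S.H) (hu : u ∈ S.L \ vertsOf S.MAB)
    (hV : u ∉ S.VnoH) (hL : u ∉ S.Lsharp) (hJ : u ∉ S.J1) (hs : u ∉ S.Gexp.support)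
    (hE : u ∉ S.E) :
    (1 + 8 * S.η / 10) * S.k ≤
      (deg (deleteVerts S.Gcap S.H) u (vertsOf S.MAB ∪ S.E) : ℝ) := by
  have h1 : (1 + 9 / 10 * S.η) * S.k ≤ (deg S.Gcap u Set.univ : ℝ) := by
    by_contra h
    exact hL ⟨hu.1, h⟩
  have h2 : (deg S.G u S.H : ℝ) ≤ S.η / 100 * S.k := by
    by_contra! h
    exact hV ⟨Or.inl (mem_XA_of_not_MAB hu), h⟩
  have h3 : (deg S.Greg u (vertsOf S.MAB)ᶜ : ℝ) ≤ S.γ * S.k := by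
    by_contra! h
    exact hJ ⟨h, hu.2⟩
  have h4 : (deg S.Gcap u Set.univ : ℝ) ≤ deg S.G u S.H + deg S.Gcap u S.Hᶜ := by
    have : deg S.Gcap u Set.univ ≤ deg S.G u S.H + deg S.Gcap u S.Hᶜ :=
      deg_le_add fun w _ hadj => by
        by_cases h : w ∈ S.H
        · exact Or.inl ⟨h, hS.Gcap_le_G hadj⟩
        · exact Or.inr ⟨h, hadj⟩
    exact_mod_cast this
  -- Since the vertex is neither in `E` nor in the support of `Gexp`, its other captured edges
  -- outside `H` are regular, and being outside `J1` makes those leaving $V_{AB}$ negligible.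
  have h5 : (deg S.Gcap u S.Hᶜ : ℝ) ≤
      deg (deleteVerts S.Gcap S.H) u (vertsOf S.MAB ∪ S.E) + deg S.Greg u (vertsOf S.MAB)ᶜ := by
    have : deg S.Gcap u S.Hᶜ ≤
        deg (deleteVerts S.Gcap S.H) u (vertsOf S.MAB ∪ S.E) + deg S.Greg u (vertsOf S.MAB)ᶜ :=
      deg_le_add fun w hw hadj => by
        by_cases h : w ∈ vertsOf S.MAB ∪ S.E
        · exact Or.inl ⟨h, hadj, huH, hw⟩
        · exact Or.inr ⟨fun h' => h (Or.inl h'), hS.Gcap_not_E hadj huH hw (Or.inl hs) hE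
            fun h' => h (Or.inr h')⟩
    exact_mod_cast this
  have hη := sc.η_pos
  have hk := sc.k_pos
  have h6 : S.γ * S.k ≤ S.η / 10 ^ 3 * S.k := by
    gcongr
    have := sc.γ_le_ρ.trans sc.ρ_le_η_cube
    have h7 : S.η ^ 3 ≤ S.η := pow_le_of_le_one hη.le sc.η_le_one (by norm_num)
    linarith
  have : 0 < S.η * S.k := by positivity
  linarith

/-- The case where the first sides see the avoiding set through large vertices. -/
theorem conf8_of_RR [Nonempty V] {ξ ε d l d' : ℝ} {M : Set (Set V × Set V)}
    (hM : UsableMatching S T ε d l d' M) (sc : SmallConstants S.toConstants S.k ξ)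
    (hS : S.CommonSetting) (hT : SplittingSetting S T)
    (hMA : vertsOf M ⊆ (S.XA ∩ T.P 0) \ (S.J ∪ T.exV ∪ FF S T))
    (hR : verts1 M ⊆ RR S \ (expShadow S ∪ S.VtoE)) :
    Conf8 S T (S.η ^ 4 * S.γ ^ 4 * S.ρ / (10 ^ 15 * S.Ωs ^ 5)) (S.η * S.γ / 400)
      (400 * S.ε / S.η) (4 * S.π) (S.d / 2) d' (S.η * S.π * S.𝔠 / (200 * S.k))
      (S.η ^ 2 * S.ν / (2 * 10 ^ 4)) (T.p 1 * (1 + S.η / 20) * S.k)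
      (T.p 2 * (1 + S.η / 20) * S.k) := by
  obtain ⟨q, hq, hq1, hsp⟩ := hT.splits
  have hη := sc.η_pos
  have hk := sc.k_pos
  have hρ := sc.ρ_pos
  have hγ := sc.γ_pos
  have hΩ := sc.Ω_pos
  have ho := sc.o_pos
  have hη1 := sc.η_le_one
  have hρ1 := sc.ρ_le_one
  have hγ1 := sc.γ_le_one
  have ho1 := sc.o_le_one
  have hn : 0 < S.n := n_pos
  have hν := sc.ν_pos
  set δ := S.η ^ 4 * S.γ ^ 4 * S.ρ / (10 ^ 15 * S.Ωs ^ 5) with hδ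
  have hδ0 : 0 < δ := by positivity
  obtain ⟨N, hN, hNabs, hNP, hmiss⟩ := exists_restricted_matching sc hS hT
    (Set.sdiff_subset : S.MAB \ S.Natom ⊆ S.MAB)
  set Miss := (vertsOf (S.MAB \ S.Natom) ∩ T.P 1) \ vertsOf N with hMiss
  set X₁ := T.P 0 ∩ cleanLarge S with hX₁
  set X₂ := S.E ∩ T.P 1 with hX₂
  -- The vertices that lose too much when the matching is restricted to `P 1`. Double counting the
  -- edges to `Miss` shows that they are few, so they may be removed at the outset.
  set Bad := {u | u ∈ X₁ ∧ S.γ * S.k ≤ (deg S.GD u Miss : ℝ)} with hBad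
  have hBadc : (Bad.ncard : ℝ) ≤ S.ν ^ 6 * S.n := by
    have h1 : Bad.ncard * (S.γ * S.k) ≤ Miss.ncard * (S.Ωs * S.k) :=
      ncard_many_nbrs_mul_le (Γ := S.GD) (fun u hu => hu.2)
        fun y hy => hS.deg_GD_le (hT.P_not_H hy.1.2) _
    have h2 : S.ν ≤ S.γ * S.Ωs⁻¹ := by
      have := le_pow_of_le_pow (m := 2) (sc.ν_le_d.trans sc.d_le) hγ.le hγ1 (by norm_num)
      rw [pow_two] at this
      exact this.trans (mul_le_mul_of_nonneg_left (sc.γ_le_ρ.trans sc.ρ_le_o) hγ.le)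
    have h3 : S.ν * S.Ωs ≤ S.γ := by
      calc S.ν * S.Ωs ≤ S.γ * S.Ωs⁻¹ * S.Ωs := by gcongr
        _ = S.γ := by field_simp
    have h4 : Bad.ncard * (S.γ * S.k) ≤ S.ν ^ 6 * S.n * (S.γ * S.k) := by
      calc _ ≤ (Miss.ncard : ℝ) * (S.Ωs * S.k) := h1
        _ ≤ S.ν ^ 7 * S.n * (S.Ωs * S.k) := by gcongr
        _ = S.ν ^ 6 * S.n * (S.ν * S.Ωs * S.k) := by ring
        _ ≤ _ := by gcongr
    exact le_of_mul_le_mul_right h4 (by positivity)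
  have hZ₁c : ((T.exV ∪ Bad).ncard : ℝ) ≤ S.ν ^ 5 * S.n := by
    have h1 : ((T.exV ∪ Bad).ncard : ℝ) ≤ T.exV.ncard + Bad.ncard := by
      exact_mod_cast Set.ncard_union_le _ _
    have h2 : (T.exV.ncard : ℝ) ≤ S.ν ^ 6 * S.n := by
      refine hsp.exV_small.trans ?_
      gcongr
      exact sc.exp_le.trans (le_pow_of_le_pow sc.ξ_le hν.le sc.ν_le_one (by norm_num))
    have h3 : 2 * S.ν ^ 6 ≤ S.ν ^ 5 := by
      have : S.ν * 2 ≤ 1 := by linarith [sc.ν_le_η, sc.η_le]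
      calc 2 * S.ν ^ 6 = S.ν ^ 5 * (S.ν * 2) := by ring
        _ ≤ S.ν ^ 5 * 1 := by gcongr
        _ = S.ν ^ 5 := mul_one _
    have h4 := mul_le_mul_of_nonneg_right h3 hn.le
    linarith
  have hX₁H : ∀ v ∈ X₁, v ∉ S.H := fun v hv => hT.P_not_H hv.1
  have hX₂H : ∀ v ∈ X₂, v ∉ S.H := fun v hv => hT.P_not_H hv.2
  have hexH : ∀ v ∈ T.exV, v ∉ S.H := fun v hv => hsp.exV_sub hv
  -- All three steps are effective here: from `M` to the clean large vertices in `P 0`, from these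
  -- to `E` in `P 1`, and from there through the dense spots to `P 1`.
  obtain ⟨V₀, V₁, Y₁, Y₂, Y₃, hV₀, hV₁, s1, s2, hreg, f0, f1, f2, b1, b2, b3⟩ :=
    hM.exists_chain sc X₁ X₂ (T.P 1) (T.exV ∪ Bad) T.exV (deleteVerts S.Gcap S.H)
      (deleteVerts S.Gcap S.H) S.GD
      (S.η * (S.η ^ 2 / (2 * 10 ^ 5)) / 400) (S.η * (S.ρ / (100 * S.Ωs)) / 400) (S.η * S.γ / 400) δ
      (by positivity) (by positivity) (by positivity) hδ0.le
      (fun v hv => hS.deg_Gcap_le (hX₁H v hv) _) (fun v hv => hS.deg_Gcap_le (hX₂H v hv) _)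
      (fun v hv => hS.deg_Gcap_le (hv.elim (hexH v) fun h => hX₁H v h.1) _)
      (fun v hv => hS.deg_Gcap_le (hexH v hv) _) hZ₁c (hT.exV_ncard sc) sc.conf8_ineq
  have hV₁A : ∀ v ∈ V₁, v ∈ (S.XA ∩ T.P 0) \ (S.J ∪ T.exV ∪ FF S T) := fun v hv =>
    hMA (Or.inl (hV₁ hv))
  have hδ_eq : δ = S.η ^ 4 * S.γ ^ 4 * S.ρ * S.Ωs⁻¹ ^ 5 / 10 ^ 15 := by rw [hδ]; field_simp
  have hδ₀ : δ * S.k ≤ S.η * (S.η ^ 2 / (2 * 10 ^ 5)) / 400 * S.k := by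
    gcongr
    have h2 : S.η ^ 4 * S.γ ^ 4 * S.ρ * S.Ωs⁻¹ ^ 5 ≤ S.η ^ 3 * 1 * 1 * 1 := by
      gcongr ?_ * ?_ * ?_ * ?_
      · exact pow_le_pow_of_le_one hη.le hη1 (by norm_num)
      · exact pow_le_one₀ hγ.le hγ1
      · exact pow_le_one₀ ho.le ho1
    have : 0 < S.η ^ 3 := by positivity
    rw [hδ_eq]
    linarith
  have hδ₁ : δ * S.k ≤ S.η * (S.ρ / (100 * S.Ωs)) / 400 * S.k := by
    gcongr
    have h2 : S.η ^ 4 * S.γ ^ 4 * S.ρ * S.Ωs⁻¹ ^ 5 ≤ S.η * 1 * S.ρ * S.Ωs⁻¹ := by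
      gcongr ?_ * ?_ * ?_ * ?_
      · exact pow_le_of_le_one hη.le hη1 (by norm_num)
      · exact pow_le_one₀ hγ.le hγ1
      · exact pow_le_of_le_one ho.le ho1 (by norm_num)
    have h3 : S.η * (S.ρ / (100 * S.Ωs)) / 400 = S.η * 1 * S.ρ * S.Ωs⁻¹ / (4 * 10 ^ 4) := by
      field_simp; norm_num
    have : 0 < S.η * 1 * S.ρ * S.Ωs⁻¹ := by positivity
    rw [hδ_eq, h3]
    linarith
  have hδk0 : 0 < δ * S.k := by positivity
  have c1 : ∀ v ∈ V₁, δ * S.k ≤ (deg (deleteVerts S.Gcap S.H) v (X₁ \ Y₁) : ℝ) := by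
    intro v hv
    have hvs := hV₁A v hv
    have hvH : v ∉ S.H := hT.P_not_H hvs.1.2
    have hvR := hR (hV₁ hv)
    have hUH : ∀ u ∈ cleanLarge S, u ∉ S.H := fun u hu =>
      hS.VtoE_disj (by positivity) hu.1.1
    have h1 := deg_cleanLarge_of_RR sc hS hvH hvR.1 (fun h => hvs.2 (Or.inl (Or.inl h)))
      (fun h => hvR.2 (Or.inl h)) fun h => hvR.2 (Or.inr h)
    rw [← hS.deg_deleteVerts hvH hUH] at h1
    have h2 := hsp.deg_ge Gcap_mem_splitGraphs hvH (fun h => hvs.2 (Or.inl (Or.inr h))) hUH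
      (fun u hu u' _ hj => cleanLarge_union_of_atoms hu hj) 0
    rw [sc.pow_eq] at h2
    have hξ : ξ ≤ S.η * (S.η ^ 2 / (2 * 10 ^ 5)) / 200 := by
      have := sc.ξ_le_η_cube
      have : 0 < S.η ^ 3 := by positivity
      linarith
    have h3 := (sc.half_split (hT.p_ge 0) (hq 0) (by positivity) hξ h1).trans h2
    have h4 := deg_le_sdiff_add (deleteVerts S.Gcap S.H) v X₁ Y₁
    have h5 := f0 v hv
    linarith
  have hE₁ : ∀ u ∈ X₁ \ Y₁, S.η * (S.ρ / (100 * S.Ωs)) / 200 * S.k ≤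
      (deg (deleteVerts S.Gcap S.H) u X₂ : ℝ) := by
    intro u hu
    have huH := hX₁H u hu.1
    have h1 : S.ρ * S.k / (100 * S.Ωs) < (deg (deleteVerts S.Gcap S.H) u S.E : ℝ) := hu.1.2.1.1
    have h2 := hsp.deg_ge Gcap_mem_splitGraphs huH (fun h => hu.2 (s1 (Or.inl h)))
      (U := S.E) (fun u hu => hS.E_disj hu) (fun u hu u' _ hj => (hj 4).1 hu) 1
    rw [sc.pow_eq, Set.inter_comm] at h2
    have hξ : ξ ≤ S.η * (S.ρ / (100 * S.Ωs)) / 200 := by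
      have h1 := sc.ξ_le_ν_pow.trans (sc.ν_pow_le 1 1 1 0 (by norm_num))
      have h2 : 0 < S.η * S.Ωs⁻¹ * S.ρ := by positivity
      have h3 : S.η * (S.ρ / (100 * S.Ωs)) / 200 = S.η * S.Ωs⁻¹ * S.ρ / (2 * 10 ^ 4) := by
        field_simp; norm_num
      simp only [pow_one, pow_zero, mul_one] at h1
      rw [h3]
      linarith
    refine (sc.half_split (hT.p_ge 1) (hq 1) (by positivity) hξ (le_trans ?_ h1.le)).trans h2
    exact le_of_eq (by ring)
  have c2 : ∀ u ∈ X₁ \ Y₁, δ * S.k ≤ (deg (deleteVerts S.Gcap S.H) u (X₂ \ Y₂) : ℝ) := by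
    intro u hu
    have h1 := hE₁ u hu
    have h2 := deg_le_sdiff_add (deleteVerts S.Gcap S.H) u X₂ Y₂
    have h3 := f1 u hu
    linarith
  have hG : deleteVerts S.Gcap S.H ≤ S.G := hS.deleteVerts_Gcap_le.trans hS.Gcap_le_G
  obtain ⟨v₁, hv₁⟩ := hreg.2.1
  have n2 := nonempty_of_deg_pos (hδk0.trans_le (c1 v₁ hv₁))
  obtain ⟨v₂, hv₂⟩ := id n2
  have n3 := nonempty_of_deg_pos (hδk0.trans_le (c2 v₂ hv₂))
  obtain ⟨v₃, hv₃⟩ := id n3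
  have n4 : (T.P 1 \ Y₃).Nonempty := by
    refine nonempty_of_deg_pos (Γ := S.GD) (v := v₃) ?_
    have h1 := deg_GD_of_E sc hS hT hv₃.1.1 fun h => hv₃.2 (s2 h)
    have h2 := deg_le_sdiff_add S.GD v₃ (T.P 1) Y₃
    have h3 := f2 v₃ hv₃
    have : 0 < S.η * S.γ / 400 * S.k := by positivity
    linarith
  have hNE : ∀ x ∈ vertsOf N, x ∉ S.E := by
    rintro x (⟨p, hp, hx⟩ | ⟨p, hp, hx⟩) hxE
    · obtain ⟨p', hp', h1, -⟩ := hNabs p hp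
      exact hp'.2 ⟨hp'.1, x, Or.inl (h1 hx), hxE⟩
    · obtain ⟨p', hp', -, h1⟩ := hNabs p hp
      exact hp'.2 ⟨hp'.1, x, Or.inr (h1 hx), hxE⟩
  refine ⟨V₀, V₁, X₁ \ Y₁, X₂ \ Y₂, T.P 1 \ Y₃, N, hreg,
    heart2_of_caseA sc hS hT hreg.1 hreg.2.1 ?_, n2, n3, n4, fun v hv => hv.1.1,
    fun v hv => hv.1.2, fun v hv => hv.1, fun v hv => ⟨hv.1.1, fun h => hv.2 (s2 h)⟩, hN, hNabs,
    fun x hx => ⟨hNP hx, fun h => hNE x hx h.1.1⟩, fun v hv => ?_, fun v hv => ?_, fun v hv => ?_,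
    fun v hv => ?_, fun v hv => ?_, b3, fun u hu => ?_⟩
  · rintro v (hv | hv)
    exacts [hMA (Or.inr (hV₀ hv)), hV₁A v hv]
  · exact (c1 v hv).trans (by exact_mod_cast deg_mono_left hG)
  · exact (b1 v hv).trans (by exact_mod_cast deg_mono_left hG)
  · exact (c2 v hv).trans (by exact_mod_cast deg_mono_left hS.deleteVerts_Gcap_le)
  · exact (b2 v hv).trans (by exact_mod_cast deg_mono_left hS.deleteVerts_Gcap_le)
  · refine lt_of_le_of_lt ?_ (f2 v hv)
    have : deg S.GD v (T.P 1 \ (T.P 1 \ Y₃)) ≤ deg S.GD v Y₃ :=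
      deg_mono_right fun u hu => by
        by_contra h
        exact hu.2 ⟨hu.1, h⟩
    exact_mod_cast this
  · have huH := hX₁H u hu.1
    have huC := hu.1.2
    have nMAB : u ∉ vertsOf S.MAB := fun h => huC.2 (Or.inl (Or.inl (Or.inl h)))
    have nJat : u ∉ S.Jatom := fun h => huC.2 (Or.inl (Or.inl (Or.inr (Or.inl (Or.inr h)))))
    have nSup : u ∉ S.Gexp.support := fun h => huC.2 (Or.inl (Or.inr h))
    have nE : u ∉ S.E := fun h => huC.2 (Or.inr h)
    have a1 := deg_MAB_union_E sc hS huH ⟨huC.1.2, nMAB⟩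
      (fun h => huC.2 (Or.inl (Or.inl (Or.inr (Or.inl (Or.inl (Or.inl h)))))))
      (fun h => huC.2 (Or.inl (Or.inl (Or.inr (Or.inl (Or.inl (Or.inr h)))))))
      (fun h => huC.2 (Or.inl (Or.inl (Or.inr (Or.inr h))))) nSup nE
    have a2 := hsp.deg_ge Gcap_mem_splitGraphs huH (fun h => hu.2 (s1 (Or.inl h)))
      (U := vertsOf S.MAB ∪ S.E)
      (fun w hw => hw.elim (fun h => hS.MAB_disj h) fun h => hS.E_disj h)
      (fun w hw w' _ hj => hw.imp (fun h => (hj 10).1 h) fun h => (hj 4).1 h) 1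
    rw [sc.pow_eq] at a2
    have a3 := (sc.split_ineq (b := 1 + 7 * S.η / 10) (hT.p_ge 1) (hq 1) (by positivity)
      (by nlinarith) a1).trans a2
    -- Edges to `E` are counted towards `V₃`. The remaining ones are regular and end in `N`, in a
    -- pair meeting `E`, or in `Miss`; the last two kinds are few because the vertex is outside
    -- `Jatom` and outside `Bad`.
    have a4 : (deg (deleteVerts S.Gcap S.H) u (T.P 1 ∩ (vertsOf S.MAB ∪ S.E)) : ℝ) ≤
        deg (deleteVerts S.Gcap S.H) u X₂ + deg S.Greg u (T.P 1 ∩ vertsOf S.MAB) := by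
      have : deg (deleteVerts S.Gcap S.H) u (T.P 1 ∩ (vertsOf S.MAB ∪ S.E)) ≤
          deg (deleteVerts S.Gcap S.H) u X₂ + deg S.Greg u (T.P 1 ∩ vertsOf S.MAB) :=
        deg_le_add fun w hw hadj => by
          by_cases h : w ∈ S.E
          · exact Or.inl ⟨⟨h, hw.1⟩, hadj⟩
          · exact Or.inr ⟨⟨hw.1, hw.2.resolve_right h⟩,
              hS.Gcap_not_E hadj.1 huH hadj.2.2 (Or.inl nSup) nE h⟩
      exact_mod_cast this
    have a5 : (deg S.Greg u (T.P 1 ∩ vertsOf S.MAB) : ℝ) ≤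
        deg S.Greg u (vertsOf N ∪ vertsOf S.Natom) + deg S.GD u Miss := by
      have : deg S.Greg u (T.P 1 ∩ vertsOf S.MAB) ≤
          deg S.Greg u (vertsOf N ∪ vertsOf S.Natom) + deg S.GD u Miss :=
        deg_le_add fun w hw hadj => by
          by_cases h1 : w ∈ vertsOf N ∪ vertsOf S.Natom
          · exact Or.inl ⟨h1, hadj⟩
          · refine Or.inr ⟨⟨⟨?_, hw.1⟩, fun h => h1 (Or.inl h)⟩, hS.Greg_le_GD hadj⟩
            rcases hw.2 with ⟨p, hp, hx⟩ | ⟨p, hp, hx⟩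
            · exact Or.inl ⟨p, ⟨hp, fun h => h1 (Or.inr (Or.inl ⟨p, h, hx⟩))⟩, hx⟩
            · exact Or.inr ⟨p, ⟨hp, fun h => h1 (Or.inr (Or.inr ⟨p, h, hx⟩))⟩, hx⟩
      exact_mod_cast this
    have a6 := deg_union_le S.Greg u (vertsOf N) (vertsOf S.Natom)
    have a7 : (deg S.Greg u (vertsOf S.Natom) : ℝ) ≤ S.γ * S.k := by
      by_contra! h
      exact nJat ⟨h, nMAB⟩
    have a8 : (deg S.GD u Miss : ℝ) < S.γ * S.k := by
      by_contra! h
      exact hu.2 (s1 (Or.inr ⟨hu.1, h⟩))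
    have a9 := deg_le_sdiff_add (deleteVerts S.Gcap S.H) u X₂ Y₂
    have a10 := f1 u hu
    have a11 : (deg (deleteVerts S.Gcap S.H) u (X₂ \ Y₂) : ℝ) ≤ deg S.GD u (X₂ \ Y₂) := by
      have : deg (deleteVerts S.Gcap S.H) u (X₂ \ Y₂) ≤ deg S.GD u (X₂ \ Y₂) :=
        deg_le_deg fun w hw hadj =>
          ⟨hw, hS.Gcap_not_support hadj.1 huH hadj.2.2 (Or.inl nSup)⟩
      exact_mod_cast this
    have hηsq : S.η ^ 3 ≤ S.η ^ 2 := pow_le_pow_of_le_one hη.le hη1 (by norm_num)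
    have hρη : S.ρ ≤ S.η ^ 2 / 10 ^ 40 := by linarith [sc.ρ_le_η_cube]
    have a12 : S.γ * S.k ≤ S.η ^ 2 / 10 ^ 40 * S.k := by gcongr; exact sc.γ_le_ρ.trans hρη
    have a13 : S.η * (S.ρ / (100 * S.Ωs)) / 400 * S.k ≤ S.η ^ 2 / 10 ^ 40 * S.k := by
      refine mul_le_mul_of_nonneg_right ?_ hk.le
      have h3 : S.η * (S.ρ / (100 * S.Ωs)) / 400 = S.η * S.ρ * S.Ωs⁻¹ / (4 * 10 ^ 4) := by
        field_simp; norm_num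
      have h4 : S.η * S.ρ * S.Ωs⁻¹ ≤ 1 * S.ρ * 1 := by gcongr
      rw [h3]
      linarith
    have a14 : S.η / 100 * (S.η * S.k) ≤ T.p 1 * (S.η * S.k) := by
      gcongr; exact hT.p_ge 1
    have a15 : 0 < S.η ^ 2 * S.k := by positivity
    have a16 : T.p 1 * (1 + S.η / 20) * S.k =
        T.p 1 * (1 + 7 * S.η / 10) * S.k - 13 / 20 * (T.p 1 * (S.η * S.k)) := by ring
    have a17 : S.η / 100 * (S.η * S.k) = S.η ^ 2 * S.k / 100 := by ring
    have a18 : S.η ^ 2 / 10 ^ 40 * S.k = S.η ^ 2 * S.k / 10 ^ 40 := by ring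
    rw [a16]
    rw [a17] at a14
    rw [a18] at a12 a13
    linarith only [a3, a4, a5, a6, a7, a8, a9, a10, a11, a12, a13, a14, a15]

end AvoidingThroughLarge

end LKS

namespace LKS

/-! ### Regular degrees between clusters. -/

section Clusters

set_option linter.unusedSectionVars false

variable {V : Type*} [Finite V] {S : Setup V} {T : Splitting V}

theorem ncard_inter_sUnion (F : Finset (Set V))
    (hF : ∀ C ∈ F, ∀ C' ∈ F, C ≠ C' → Disjoint C C') (Z : Set V) :
    (Z ∩ ⋃₀ (F : Set (Set V))).ncard = ∑ C ∈ F, (Z ∩ C).ncard := by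
  classical
  have := Fintype.ofFinite V
  have e : Z ∩ ⋃₀ (F : Set (Set V)) = ↑(F.biUnion fun C => (Z ∩ C).toFinset) := by
    ext x
    simp only [Set.mem_inter_iff, Set.mem_sUnion, Finset.mem_coe, Finset.coe_biUnion,
      Set.coe_toFinset, Set.mem_iUnion]
    exact ⟨fun ⟨h, C, hC, hx⟩ => ⟨C, hC, h, hx⟩, fun ⟨C, hC, h, hx⟩ => ⟨h, C, hC, hx⟩⟩
  rw [e, Set.ncard_coe_finset, Finset.card_biUnion]
  · exact Finset.sum_congr rfl fun C _ => by rw [Set.ncard_eq_toFinset_card']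
  · intro C hC C' hC' hne
    rw [Function.onFun, Set.disjoint_toFinset]
    exact (hF C hC C' hC' hne).mono Set.inter_subset_right Set.inter_subset_right

theorem deg_inter_sUnion (Γ : SimpleGraph V) (F : Finset (Set V))
    (hF : ∀ C ∈ F, ∀ C' ∈ F, C ≠ C' → Disjoint C C') (Z : Set V) (v : V) :
    deg Γ v (Z ∩ ⋃₀ (F : Set (Set V))) = ∑ C ∈ F, deg Γ v (Z ∩ C) := by
  have := ncard_inter_sUnion F hF {u | u ∈ Z ∧ Γ.Adj v u}
  unfold deg
  convert this using 3 with C hC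
  · ext u; simp only [Set.mem_inter_iff, Set.mem_ofPred_eq]; tauto
  · ext u; simp only [Set.mem_inter_iff, Set.mem_ofPred_eq]; tauto

theorem ePair_inter_sUnion (Γ : SimpleGraph V) (F : Finset (Set V))
    (hF : ∀ C ∈ F, ∀ C' ∈ F, C ≠ C' → Disjoint C C') (X Z : Set V) :
    ePair Γ X (Z ∩ ⋃₀ (F : Set (Set V))) = ∑ C ∈ F, ePair Γ X (Z ∩ C) := by
  simp only [ePair_eq_sum, deg_inter_sUnion Γ F hF]
  exact Finset.sum_comm

/-- The clusters joined to `C` by a regular pair. -/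
noncomputable def nbClusters (S : Setup V) (C : Set V) : Finset (Set V) :=
  (Set.toFinite {C' | C' ∈ S.clusters ∧ ∃ x ∈ C, ∃ y ∈ C', S.Greg.Adj x y}).toFinset

theorem mem_nbClusters {C C' : Set V} :
    C' ∈ nbClusters S C ↔ C' ∈ S.clusters ∧ ∃ x ∈ C, ∃ y ∈ C', S.Greg.Adj x y := by
  simp [nbClusters]

theorem Setup.CommonSetting.cluster_eq (hS : S.CommonSetting) {C C' : Set V}
    (hC : C ∈ S.clusters) (hC' : C' ∈ S.clusters) {x : V} (hx : x ∈ C) (hx' : x ∈ C') :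
    C = C' := by
  by_contra h
  exact Set.disjoint_left.1 (hS.sparse.bounded.clusters_disj C hC C' hC' h) hx hx'

theorem nbClusters_disj (hS : S.CommonSetting) {C : Set V} :
    ∀ C₁ ∈ nbClusters S C, ∀ C₂ ∈ nbClusters S C, C₁ ≠ C₂ → Disjoint C₁ C₂ :=
  fun C₁ h₁ C₂ h₂ hne => hS.sparse.bounded.clusters_disj C₁ (mem_nbClusters.1 h₁).1 C₂
    (mem_nbClusters.1 h₂).1 hne

/-- Adjacent clusters form a regular pair of the regular graph. -/
theorem Setup.CommonSetting.regular_of_adj (hS : S.CommonSetting) {C C' : Set V}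
    (hC : C ∈ S.clusters) (hC' : C' ∈ S.clusters) {x y : V} (hx : x ∈ C) (hy : y ∈ C')
    (h : S.Greg.Adj x y) :
    C ≠ C' ∧ RegularPair S.Greg S.εp C C' ∧ S.γ ^ 2 ≤ density S.Greg C C' := by
  obtain ⟨D, hD, D', hD', hne, hxD, hyD, hiff, hr, hd⟩ := hS.sparse.bounded.reg_edge x y h
  obtain rfl := hS.cluster_eq hC hD hx hxD
  obtain rfl := hS.cluster_eq hC' hD' hy hyD
  exact ⟨hne, hr.congr hiff, by rwa [← density_congr hiff]⟩

theorem regular_of_mem_nbClusters (hS : S.CommonSetting) {C C' : Set V}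
    (hC : C ∈ S.clusters) (hC' : C' ∈ nbClusters S C) :
    C ≠ C' ∧ RegularPair S.Greg S.εp C C' ∧ S.γ ^ 2 ≤ density S.Greg C C' := by
  obtain ⟨h1, x, hx, y, hy, h⟩ := mem_nbClusters.1 hC'
  exact hS.regular_of_adj hC h1 hx hy h

theorem deg_Greg_eq_nb (hS : S.CommonSetting) {C : Set V} {v : V} (hv : v ∈ C) (Z : Set V) :
    deg S.Greg v (Z ∩ ⋃₀ (nbClusters S C : Set (Set V))) = deg S.Greg v Z := by
  refine le_antisymm (deg_mono_right Set.inter_subset_left) (deg_le_deg fun u hu h => ?_)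
  obtain ⟨C', hC', huC'⟩ := hS.Greg_cluster h.symm
  exact ⟨⟨hu, C', mem_nbClusters.2 ⟨hC', v, hv, u, huC', h⟩, huC'⟩, h⟩

theorem Setup.CommonSetting.cluster_ncard_pos {ξ : ℝ} (sc : SmallConstants S.toConstants S.k ξ)
    (hS : S.CommonSetting) {C : Set V} (hC : C ∈ S.clusters) : (0 : ℝ) < C.ncard := by
  rw [hS.cluster_card C hC]
  exact (mul_pos sc.ν_pos sc.k_pos).trans_le (hS.ν_mul_le hC).1

/-- The clusters adjacent to a given one have a bounded number of vertices in total. -/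
theorem sum_nbClusters_le {ξ : ℝ} (sc : SmallConstants S.toConstants S.k ξ)
    (hS : S.CommonSetting) {C : Set V} (hC : C ∈ S.clusters) :
    ∑ C' ∈ nbClusters S C, (C'.ncard : ℝ) ≤ S.Ωs * S.k / S.γ ^ 2 := by
  have hγ := sc.γ_pos
  have hCp := hS.cluster_ncard_pos sc hC
  rw [le_div_iff₀ (by positivity)]
  have h1 : (ePair S.Greg C Set.univ : ℝ) ≤ C.ncard * (S.Ωs * S.k) :=
    ePair_le_mul fun x hx => by
      have h2 : deg S.Greg x Set.univ ≤ deg S.GD x Set.univ := deg_mono_left hS.Greg_le_GD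
      have h3 := hS.deg_GD_le (hS.cluster_disj ⟨C, hC, hx⟩) Set.univ
      exact le_trans (by exact_mod_cast h2) h3
  have h2 : (∑ C' ∈ nbClusters S C, (ePair S.Greg C (Set.univ ∩ C') : ℝ)) ≤
      ePair S.Greg C Set.univ := by
    rw [← Nat.cast_sum, ← ePair_inter_sUnion S.Greg _ (nbClusters_disj hS)]
    exact_mod_cast ePair_mono fun x hx y hy h => ⟨hx, Set.mem_univ _, h⟩
  -- Each adjacent cluster receives at least $\gamma^2|C||C'|$ edges, while `C` sends out at most
  -- $|C|\,\Omega^*k$.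
  have h3 : (∑ C' ∈ nbClusters S C, C.ncard * S.γ ^ 2 * (C'.ncard : ℝ)) ≤
      ∑ C' ∈ nbClusters S C, (ePair S.Greg C (Set.univ ∩ C') : ℝ) := by
    refine Finset.sum_le_sum fun C' hC' => ?_
    have h4 := (regular_of_mem_nbClusters hS hC hC').2.2
    have hCp' := hS.cluster_ncard_pos sc (mem_nbClusters.1 hC').1
    rw [density, le_div_iff₀ (by positivity)] at h4
    rw [Set.univ_inter]
    linarith
  rw [← Finset.mul_sum] at h3
  have h4 : (C.ncard : ℝ) * ((∑ C' ∈ nbClusters S C, (C'.ncard : ℝ)) * S.γ ^ 2) ≤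
      C.ncard * (S.Ωs * S.k) := by linarith
  exact le_of_mul_le_mul_left h4 hCp

/-- The regular degree of a vertex of a cluster into a set that is sparse on each cluster. -/
theorem deg_sparse_le {ξ c : ℝ} (sc : SmallConstants S.toConstants S.k ξ) (hS : S.CommonSetting)
    (hc : 0 ≤ c) {C : Set V} (hC : C ∈ S.clusters) {v : V} (hv : v ∈ C) {Z : Set V}
    (hZ : ∀ C' ∈ S.clusters, ((Z ∩ C').ncard : ℝ) ≤ c * C'.ncard) :
    (deg S.Greg v Z : ℝ) ≤ c * (S.Ωs * S.k / S.γ ^ 2) := by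
  rw [← deg_Greg_eq_nb hS hv, deg_inter_sUnion _ _ (nbClusters_disj hS), Nat.cast_sum]
  refine le_trans ?_ (mul_le_mul_of_nonneg_left (sum_nbClusters_le sc hS hC) hc)
  rw [Finset.mul_sum]
  refine Finset.sum_le_sum fun C' hC' => le_trans ?_ (hZ C' (mem_nbClusters.1 hC').1)
  exact_mod_cast deg_le_ncard _ _ _

/-- If the vertices of a non-negligible part of a cluster have regular degree at least `m` into
`Z`, then almost all vertices of the cluster have almost as large a degree into `Z`. -/
theorem cluster_homogeneous {ξ m : ℝ} (sc : SmallConstants S.toConstants S.k ξ)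
    (hS : S.CommonSetting) {C A Z : Set V} (hC : C ∈ S.clusters) (hA : A ⊆ C)
    (hAc : S.εp * C.ncard ≤ A.ncard) (hm : ∀ v ∈ A, m ≤ (deg S.Greg v Z : ℝ)) :
    ({v | v ∈ C ∧ (deg S.Greg v Z : ℝ) < m - 3 * S.εp * (S.Ωs * S.k / S.γ ^ 2)}.ncard : ℝ) ≤
      S.εp * C.ncard := by
  have hεp := sc.εp_pos
  have hCp := hS.cluster_ncard_pos sc hC
  by_contra! hcon
  set B := {v | v ∈ C ∧ (deg S.Greg v Z : ℝ) < m - 3 * S.εp * (S.Ωs * S.k / S.γ ^ 2)} with hB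
  have hBC : B ⊆ C := fun v hv => hv.1
  have hAp : (0 : ℝ) < A.ncard := lt_of_lt_of_le (by positivity) hAc
  have hBp : (0 : ℝ) < B.ncard := lt_of_le_of_lt (by positivity) hcon
  have key : ∀ {X : Set V}, X ⊆ C → (ePair S.Greg X Z : ℝ) =
      ∑ C' ∈ nbClusters S C, (ePair S.Greg X (Z ∩ C') : ℝ) := fun {X} hX => by
    rw [← Nat.cast_sum, ← ePair_inter_sUnion _ _ (nbClusters_disj hS), ePair_eq_sum, ePair_eq_sum]
    congr 1
    exact Finset.sum_congr rfl fun x hx => (deg_Greg_eq_nb hS (hX (by simpa using hx)) Z).symm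
  have h1 : (A.ncard : ℝ) * m ≤ ePair S.Greg A Z := mul_le_ePair hm
  have h2 : (ePair S.Greg B Z : ℝ) ≤
      B.ncard * (m - 3 * S.εp * (S.Ωs * S.k / S.γ ^ 2)) := ePair_le_mul fun v hv => hv.2.le
  -- The average degrees of `A` and of the low-degree set `B` are compared on each adjacent cluster.
  -- If `Z` is large there, regularity brings both densities within $\epsilon'$ of the density of
  -- the pair; otherwise the degrees are trivially below $\epsilon'|C'|$. The errors sum to
  -- $2\epsilon'\Omega^*k/\gamma^2$, against the assumed gap with factor 3.
  have hloc : ∀ C' ∈ nbClusters S C, (ePair S.Greg A (Z ∩ C') : ℝ) / A.ncard ≤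
      (ePair S.Greg B (Z ∩ C') : ℝ) / B.ncard + 2 * S.εp * C'.ncard := by
    intro C' hC'
    have hCp' := hS.cluster_ncard_pos sc (mem_nbClusters.1 hC').1
    by_cases hz : S.εp * C'.ncard ≤ (Z ∩ C').ncard
    · have hZp : (0 : ℝ) < (Z ∩ C').ncard := lt_of_lt_of_le (by positivity) hz
      have hr := (regular_of_mem_nbClusters hS hC hC').2.1
      have r1 := abs_lt.1 (hr.2 A (Z ∩ C') hA Set.inter_subset_right hAc hz)
      have r2 := abs_lt.1 (hr.2 B (Z ∩ C') hBC Set.inter_subset_right hcon.le hz)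
      have r3 : density S.Greg A (Z ∩ C') ≤ density S.Greg B (Z ∩ C') + 2 * S.εp := by linarith
      have e : ∀ X : Set V, (ePair S.Greg X (Z ∩ C') : ℝ) / X.ncard =
          density S.Greg X (Z ∩ C') * (Z ∩ C').ncard := fun X => by
        rw [density]; field_simp
      have hle : ((Z ∩ C').ncard : ℝ) ≤ C'.ncard := by
        exact_mod_cast Set.ncard_le_ncard Set.inter_subset_right (Set.toFinite _)
      rw [e, e]
      nlinarith
    · push Not at hz
      have h3 : (ePair S.Greg A (Z ∩ C') : ℝ) ≤ A.ncard * (Z ∩ C').ncard :=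
        ePair_le_mul fun v _ => by exact_mod_cast deg_le_ncard _ _ _
      have h4 : (ePair S.Greg A (Z ∩ C') : ℝ) / A.ncard ≤ (Z ∩ C').ncard := by
        rw [div_le_iff₀ hAp]; linarith
      have h5 : (0 : ℝ) ≤ (ePair S.Greg B (Z ∩ C') : ℝ) / B.ncard := by positivity
      nlinarith
  have hsum := Finset.sum_le_sum hloc
  rw [Finset.sum_add_distrib, ← Finset.sum_div, ← Finset.sum_div, ← key hA, ← key hBC,
    ← Finset.mul_sum] at hsum
  have h3 : m ≤ (ePair S.Greg A Z : ℝ) / A.ncard := by rw [le_div_iff₀ hAp]; linarith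
  have h4 : (ePair S.Greg B Z : ℝ) / B.ncard ≤ m - 3 * S.εp * (S.Ωs * S.k / S.γ ^ 2) := by
    rw [div_le_iff₀ hBp]; linarith
  have h5 := mul_le_mul_of_nonneg_left (sum_nbClusters_le sc hS hC)
    (by positivity : 0 ≤ 2 * S.εp)
  have h6 : 0 < S.εp * (S.Ωs * S.k / S.γ ^ 2) := by
    have := sc.γ_pos
    have := sc.Ω_pos
    have := sc.k_pos
    positivity
  linarith

end Clusters

end LKS

namespace LKS

/-! ### The regularized graph of configuration (◇10). -/

section RegularizedPieces

set_option linter.unusedSectionVars false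

variable {V : Type*} [Finite V] {S : Setup V} {T : Splitting V}

theorem SmallConstants.sqrt_εp_le {K : Constants} {k : ℕ} {ξ : ℝ} (sc : SmallConstants K k ξ) :
    Real.sqrt K.εp ≤ K.αh ^ 50 := by
  rw [Real.sqrt_le_left (by have := sc.αh_pos; positivity), ← pow_mul]
  exact sc.εp_le

theorem SmallConstants.αh_tiny {K : Constants} {k : ℕ} {ξ : ℝ} (sc : SmallConstants K k ξ) :
    K.αh ≤ 1 / 10 ^ 40 :=
  sc.αh_le_d.trans (sc.d_le_η.trans sc.η_le)

theorem SmallConstants.sqrt_εp_le_αh {K : Constants} {k : ℕ} {ξ : ℝ}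
    (sc : SmallConstants K k ξ) : Real.sqrt K.εp ≤ K.αh / 10 ^ 40 := by
  have h0 := sc.αh_pos
  calc Real.sqrt K.εp ≤ K.αh ^ 50 := sc.sqrt_εp_le
    _ ≤ K.αh ^ 2 := pow_le_pow_of_le_one h0.le sc.αh_le_one (by norm_num)
    _ = K.αh * K.αh := by ring
    _ ≤ K.αh * (1 / 10 ^ 40) := by gcongr; exact sc.αh_tiny
    _ = K.αh / 10 ^ 40 := by ring

/-- Ignoring a proportion $\sqrt{\epsilon'}$ of every cluster costs a regular degree of at most
$\sqrt{\epsilon'}\,\Omega^*k/\gamma^2$, by `deg_sparse_le`; this makes the cost negligible against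
$\eta k$. -/
theorem SmallConstants.sqrt_εp_mul_le {K : Constants} {k : ℕ} {ξ : ℝ}
    (sc : SmallConstants K k ξ) : Real.sqrt K.εp * (K.Ωs / K.γ ^ 2) ≤ K.η / 10 ^ 40 := by
  have h0 := sc.αh_pos
  have hγ := sc.γ_pos
  have hΩ := sc.Ω_pos
  have hη := sc.η_pos
  have ho := sc.o_pos
  have aγ : K.αh ≤ K.γ := sc.αh_le_d.trans sc.d_le_γ
  have ao : K.αh ≤ K.Ωs⁻¹ := aγ.trans (sc.γ_le_ρ.trans sc.ρ_le_o)
  have h1 : Real.sqrt K.εp ≤ K.Ωs⁻¹ * (K.γ * K.γ) * (K.η * (1 / 10 ^ 40)) :=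
    calc Real.sqrt K.εp ≤ K.αh ^ 50 := sc.sqrt_εp_le
      _ ≤ K.αh ^ 5 := pow_le_pow_of_le_one h0.le sc.αh_le_one (by norm_num)
      _ = K.αh * (K.αh * K.αh) * (K.αh * K.αh) := by ring
      _ ≤ K.Ωs⁻¹ * (K.γ * K.γ) * (K.η * (1 / 10 ^ 40)) := by
        gcongr
        · exact sc.αh_le_d.trans sc.d_le_η
        · exact sc.αh_tiny
  calc Real.sqrt K.εp * (K.Ωs / K.γ ^ 2)
      ≤ K.Ωs⁻¹ * (K.γ * K.γ) * (K.η * (1 / 10 ^ 40)) * (K.Ωs / K.γ ^ 2) := by gcongr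
    _ = K.η / 10 ^ 40 := by field_simp

/-- The first inequality is the condition under which subsets of proportion $\sqrt{\epsilon'}$ of an
$\epsilon'$-regular pair form an $\epsilon$-regular pair. It fixes the minimum size of remainders in
`pieces`. -/
theorem SmallConstants.εp_le_sqrt {K : Constants} {k : ℕ} {ξ : ℝ}
    (sc : SmallConstants K k ξ) : K.εp ≤ K.ε * Real.sqrt K.εp ∧ K.εp ≤ Real.sqrt K.εp / 10 ^ 40 := by
  have h1 := sc.sqrt_εp_le_αh
  have h2 : 0 < Real.sqrt K.εp := Real.sqrt_pos.2 sc.εp_pos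
  have h3 : Real.sqrt K.εp * Real.sqrt K.εp = K.εp := Real.mul_self_sqrt sc.εp_pos.le
  have h4 : K.αh ≤ K.ε := sc.αh_le.trans sc.π_le
  have h5 := sc.αh_pos
  have h6 := sc.αh_le_one
  constructor
  · nlinarith
  · nlinarith

/-- The sides of the pairs of the two matchings, and the large remainders of the clusters. -/
def pieces (S : Setup V) : Set (Set V) :=
  sidesOf S.MAB ∪ {X | ∃ C ∈ S.clusters, X = C \ vertsOf S.MAB ∧
    Real.sqrt S.εp * S.𝔠 ≤ (X.ncard : ℝ)}

/-- `x` and `y` are in the two sides of a pair of the matchings. -/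
def Matched (S : Setup V) (x y : V) : Prop :=
  ∃ p ∈ S.MAB, x ∈ p.1 ∧ y ∈ p.2 ∨ x ∈ p.2 ∧ y ∈ p.1

/-- The regular edges between pieces, and the edges of the dense spots inside matched pairs. -/
def pieceGraph (S : Setup V) : SimpleGraph V where
  Adj x y := S.Greg.Adj x y ∧ x ∈ ⋃₀ pieces S ∧ y ∈ ⋃₀ pieces S ∨ S.GD.Adj x y ∧ Matched S x y
  symm := ⟨fun _ _ h => h.imp (fun h => ⟨h.1.symm, h.2.2, h.2.1⟩) fun ⟨h, p, hp, h'⟩ =>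
    ⟨h.symm, p, hp, h'.symm.imp (fun h => ⟨h.2, h.1⟩) fun h => ⟨h.2, h.1⟩⟩⟩
  loopless := ⟨fun _ h => h.elim (fun h => S.Greg.loopless.irrefl _ h.1)
    fun h => S.GD.loopless.irrefl _ h.1⟩

theorem pieceGraph_le (hS : S.CommonSetting) : pieceGraph S ≤ S.GD :=
  fun _ _ h => h.elim (fun h => hS.Greg_le_GD h.1) fun h => h.1

theorem side_subset {p : Set V × Set V} (hp : p ∈ S.MAB) :
    p.1 ⊆ vertsOf S.MAB ∧ p.2 ⊆ vertsOf S.MAB :=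
  ⟨fun _ hx => Or.inl ⟨p, hp, hx⟩, fun _ hx => Or.inr ⟨p, hp, hx⟩⟩

theorem side_mem_pieces {p : Set V × Set V} (hp : p ∈ S.MAB) :
    p.1 ∈ pieces S ∧ p.2 ∈ pieces S :=
  ⟨Or.inl ⟨p, hp, Or.inl rfl⟩, Or.inl ⟨p, hp, Or.inr rfl⟩⟩

theorem vertsOf_MAB_subset_pieces : vertsOf S.MAB ⊆ ⋃₀ pieces S := by
  rintro x (⟨p, hp, hx⟩ | ⟨p, hp, hx⟩)
  exacts [⟨p.1, (side_mem_pieces hp).1, hx⟩, ⟨p.2, (side_mem_pieces hp).2, hx⟩]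

theorem pieces_disj (hS : S.CommonSetting) :
    ∀ X ∈ pieces S, ∀ Y ∈ pieces S, X ≠ Y → Disjoint X Y := by
  have hM := hS.regMatching_MAB
  have hside : ∀ X ∈ sidesOf S.MAB, X ⊆ vertsOf S.MAB := by
    rintro X ⟨p, hp, rfl | rfl⟩
    exacts [(side_subset hp).1, (side_subset hp).2]
  have hrem : ∀ C : Set V, Disjoint (C \ vertsOf S.MAB) (vertsOf S.MAB) := fun C =>
    Set.disjoint_sdiff_left
  rintro X (hX | ⟨C, hC, rfl, -⟩) Y (hY | ⟨C', hC', rfl, -⟩) hne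
  · obtain ⟨p, hp, hXp⟩ := hX
    obtain ⟨q, hq, hYq⟩ := hY
    by_cases hpq : p = q
    · subst hpq
      rcases hXp with rfl | rfl <;> rcases hYq with rfl | rfl
      · exact absurd rfl hne
      · exact (hM.regular p hp).1
      · exact (hM.regular p hp).1.symm
      · exact absurd rfl hne
    · obtain ⟨h1, h2, h3⟩ := hM.disj p hp q hq hpq
      obtain ⟨-, -, h4⟩ := hM.disj q hq p hp (Ne.symm hpq)
      rcases hXp with rfl | rfl <;> rcases hYq with rfl | rfl
      exacts [h1, h3, h4.symm, h2]
  · exact ((hrem C').mono_right (hside X hX)).symm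
  · exact (hrem C).mono_right (hside Y hY)
  · refine (hS.sparse.bounded.clusters_disj C hC C' hC' ?_).mono Set.sdiff_subset Set.sdiff_subset
    rintro rfl
    exact hne rfl

theorem piece_eq (hS : S.CommonSetting) {X Y : Set V} (hX : X ∈ pieces S) (hY : Y ∈ pieces S)
    {x : V} (hx : x ∈ X) (hy : x ∈ Y) : X = Y := by
  by_contra h
  exact Set.disjoint_left.1 (pieces_disj hS X hX Y hY h) hx hy

theorem piece_cases (hS : S.CommonSetting) {X : Set V} (hX : X ∈ pieces S) :
    (∃ C ∈ S.clusters, X ⊆ C) ∨ X ⊆ S.E := by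
  rcases hX with ⟨p, hp, rfl | rfl⟩ | ⟨C, hC, rfl, -⟩
  · exact Or.inl (hS.pair_cluster p hp).1
  · exact (hS.pair_cluster p hp).2.imp_right fun h => h.trans Set.inter_subset_right
  · exact Or.inl ⟨C, hC, Set.sdiff_subset⟩

theorem piece_subset_cluster (hS : S.CommonSetting) {X C : Set V} (hX : X ∈ pieces S)
    (hC : C ∈ S.clusters) {x : V} (hx : x ∈ X) (hxC : x ∈ C) : X ⊆ C := by
  rcases piece_cases hS hX with ⟨C', hC', h⟩ | h
  · rwa [hS.cluster_eq hC hC' hxC (h hx)]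
  · exact absurd ⟨C, hC, hxC⟩ (hS.E_not_cluster (h hx))

theorem piece_ncard_ge {ξ : ℝ} (sc : SmallConstants S.toConstants S.k ξ) (hS : S.CommonSetting)
    {X : Set V} (hX : X ∈ pieces S) :
    Real.sqrt S.εp * S.𝔠 ≤ X.ncard ∧ S.ν * S.k ≤ S.𝔠 := by
  have h0 : Real.sqrt S.εp ≤ S.π := sc.sqrt_εp_le_αh.trans (by
    have := sc.αh_le; have := sc.αh_pos; linarith)
  rcases hX with ⟨p, hp, h⟩ | ⟨C, hC, -, h⟩
  · obtain ⟨⟨C, hC, -⟩, -⟩ := hS.pair_cluster p hp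
    refine ⟨?_, (hS.ν_mul_le hC).1⟩
    have h1 := hS.regMatching_MAB.card_ge p hp
    have h2 : X.ncard = p.1.ncard := by
      rcases h with rfl | rfl
      exacts [rfl, (hS.regMatching_MAB.card_eq p hp).symm]
    rw [h2]
    exact le_trans (by gcongr) h1
  · exact ⟨h, (hS.ν_mul_le hC).1⟩

theorem piece_size {ξ : ℝ} (sc : SmallConstants S.toConstants S.k ξ) (hS : S.CommonSetting)
    {X : Set V} (hX : X ∈ pieces S) :
    S.π * Real.sqrt S.εp * S.ν * S.k ≤ X.ncard := by
  obtain ⟨h1, h2⟩ := piece_ncard_ge sc hS hX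
  have h3 : S.π ≤ 1 := sc.π_le_d.trans sc.d_le_one
  have h4 : 0 ≤ Real.sqrt S.εp * (S.ν * S.k) := by
    have := sc.ν_pos; have := sc.k_pos; positivity
  have h5 := mul_le_mul_of_nonneg_left h2 (Real.sqrt_nonneg S.εp)
  nlinarith

theorem Matched.iff_sides (hS : S.CommonSetting) {X Y : Set V} (hX : X ∈ pieces S)
    (hY : Y ∈ pieces S) {x y : V} (hx : x ∈ X) (hy : y ∈ Y) (h : Matched S x y) :
    ∃ p ∈ S.MAB, X = p.1 ∧ Y = p.2 ∨ X = p.2 ∧ Y = p.1 := by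
  obtain ⟨p, hp, ⟨h1, h2⟩ | ⟨h1, h2⟩⟩ := h
  · exact ⟨p, hp, Or.inl ⟨piece_eq hS hX (side_mem_pieces hp).1 hx h1,
      piece_eq hS hY (side_mem_pieces hp).2 hy h2⟩⟩
  · exact ⟨p, hp, Or.inr ⟨piece_eq hS hX (side_mem_pieces hp).2 hx h1,
      piece_eq hS hY (side_mem_pieces hp).1 hy h2⟩⟩

/-- A regular edge joins two different clusters, while a piece that meets a cluster lies inside it;
and the two sides of a matched pair are disjoint. -/
theorem pieceGraph_indep (hS : S.CommonSetting) {X : Set V} (hX : X ∈ pieces S) {x y : V}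
    (hx : x ∈ X) (hy : y ∈ X) : ¬ (pieceGraph S).Adj x y := by
  rintro (⟨h, -⟩ | ⟨-, h⟩)
  · obtain ⟨C, hC, hxC⟩ := hS.Greg_cluster h
    exact (hS.regular_of_adj hC hC hxC (piece_subset_cluster hS hX hC hx hxC hy) h).1 rfl
  · obtain ⟨p, hp, h'⟩ := h.iff_sides hS hX hX hx hy
    have h12 : p.1 = p.2 := by rcases h' with ⟨h1, h2⟩ | ⟨h1, h2⟩ <;> rw [← h1, ← h2]
    have hXp : X = p.1 := by rcases h' with ⟨h1, h2⟩ | ⟨h1, h2⟩ <;> assumption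
    have := (hS.regMatching_MAB.regular p hp).1
    rw [← h12] at this
    exact Set.disjoint_left.1 this (hXp ▸ hx) (hXp ▸ hx)

theorem pieceGraph_matched (hS : S.CommonSetting) {p : Set V × Set V} (hp : p ∈ S.MAB) :
    ∀ x ∈ p.1, ∀ y ∈ p.2, S.GD.Adj x y ↔ (pieceGraph S).Adj x y := fun _ hx _ hy =>
  ⟨fun h => Or.inr ⟨h, p, hp, Or.inl ⟨hx, hy⟩⟩, fun h => pieceGraph_le hS h⟩

/-- The two bounds serve the matched pairs, of density at least `d`, and pieces of regular cluster
pairs, of density at least $\gamma^2-\epsilon'$. -/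
theorem SmallConstants.conf10_density_le {K : Constants} {k : ℕ} {ξ : ℝ}
    (sc : SmallConstants K k ξ) : K.γ ^ 2 * K.d / 2 ≤ K.d ∧ K.γ ^ 2 * K.d / 2 ≤ K.γ ^ 2 - K.εp := by
  have h1 := sc.γ_pos
  have h2 := sc.d_pos
  have h3 : K.γ ^ 2 ≤ 1 := pow_le_one₀ h1.le sc.γ_le_one
  have h4 := sc.d_le_one
  have h5 : K.εp ≤ K.γ ^ 2 / 2 := by
    have e1 : K.d ≤ K.γ ^ 3 := sc.d_le.trans
      (pow_le_pow_of_le_one h1.le sc.γ_le_one (by norm_num))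
    have e2 : K.γ ≤ 1 / 2 := (sc.γ_le_ρ.trans (sc.ρ_le_o.trans sc.o_le_η)).trans
      (sc.η_le.trans (by norm_num))
    have e3 : K.εp ≤ K.d := sc.εp_le_αh.trans sc.αh_le_d
    nlinarith [sq_nonneg K.γ]
  constructor
  · nlinarith
  · nlinarith [sq_nonneg K.γ]

theorem pieceGraph_regMatching {ξ : ℝ} (sc : SmallConstants S.toConstants S.k ξ)
    (hS : S.CommonSetting) : RegMatching (pieceGraph S) S.ε (S.γ ^ 2 * S.d / 2)
      (S.π * Real.sqrt S.εp * S.ν * S.k) S.MAB where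
  card_eq := hS.regMatching_MAB.card_eq
  card_ge p hp := piece_size sc hS (side_mem_pieces hp).1
  regular p hp := (hS.regMatching_MAB.regular p hp).congr (pieceGraph_matched hS hp)
  dense p hp := by
    rw [← density_congr (pieceGraph_matched hS hp)]
    exact sc.conf10_density_le.1.trans (hS.regMatching_MAB.dense p hp)
  disj := hS.regMatching_MAB.disj

/-- Matched pieces carry all edges of the dense spots between them and inherit their regularity from
the matching. Between other pieces only regular edges occur: one such edge puts both pieces into a
regular pair of clusters, and without any the density vanishes on all subpairs. -/
theorem pieceGraph_regular {ξ : ℝ} (sc : SmallConstants S.toConstants S.k ξ)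
    (hS : S.CommonSetting) {X Y : Set V} (hX : X ∈ pieces S) (hY : Y ∈ pieces S) (hne : X ≠ Y) :
    RegularPair (pieceGraph S) S.ε X Y ∧
      (density (pieceGraph S) X Y = 0 ∨ S.γ ^ 2 * S.d / 2 ≤ density (pieceGraph S) X Y) := by
  have hN := pieceGraph_regMatching sc hS
  by_cases hm : ∃ p ∈ S.MAB, X = p.1 ∧ Y = p.2 ∨ X = p.2 ∧ Y = p.1
  · obtain ⟨p, hp, ⟨rfl, rfl⟩ | ⟨rfl, rfl⟩⟩ := hm
    · exact ⟨hN.regular p hp, Or.inr (hN.dense p hp)⟩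
    · exact ⟨(hN.regular p hp).symm, Or.inr (by rw [density_comm]; exact hN.dense p hp)⟩
  have hiff : ∀ x ∈ X, ∀ y ∈ Y, S.Greg.Adj x y ↔ (pieceGraph S).Adj x y := fun x hx y hy =>
    ⟨fun h => Or.inl ⟨h, ⟨X, hX, hx⟩, ⟨Y, hY, hy⟩⟩,
      fun h => h.elim (fun h => h.1) fun h => absurd (h.2.iff_sides hS hX hY hx hy) hm⟩
  by_cases he : ∃ x ∈ X, ∃ y ∈ Y, S.Greg.Adj x y
  · obtain ⟨x, hx, y, hy, h⟩ := he
    obtain ⟨C, hC, hxC⟩ := hS.Greg_cluster h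
    obtain ⟨C', hC', hyC⟩ := hS.Greg_cluster h.symm
    obtain ⟨-, hr, hd⟩ := hS.regular_of_adj hC hC' hxC hyC h
    have hXC := piece_subset_cluster hS hX hC hx hxC
    have hYC := piece_subset_cluster hS hY hC' hy hyC
    have hXc := (piece_ncard_ge sc hS hX).1
    have hYc := (piece_ncard_ge sc hS hY).1
    rw [← hS.cluster_card C hC] at hXc
    rw [← hS.cluster_card C' hC'] at hYc
    obtain ⟨e1, e2⟩ := sc.εp_le_sqrt
    have e3 : S.εp ≤ Real.sqrt S.εp := by linarith [Real.sqrt_nonneg S.εp]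
    have e4 : 2 * S.εp ≤ S.ε := by
      have := sc.sqrt_εp_le_αh
      have := sc.αh_le.trans sc.π_le
      have := sc.αh_pos
      linarith
    refine ⟨(hr.sub sc.ε_pos.le e3 hXC hYC hXc hYc e4 e1).congr hiff, Or.inr ?_⟩
    rw [← density_congr hiff]
    have := (abs_lt.1 (hr.sub_density e3 hXC hYC hXc hYc)).2
    linarith [sc.conf10_density_le.2]
  · have h0 : ∀ X' ⊆ X, ∀ Y' ⊆ Y, density (pieceGraph S) X' Y' = 0 := fun X' hX' Y' hY' => by
      by_contra h
      obtain ⟨x, hx, y, hy, h⟩ := exists_adj_of_density_pos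
        (lt_of_le_of_ne (density_nonneg (pieceGraph S) X' Y') (Ne.symm h))
      exact he ⟨x, hX' hx, y, hY' hy, (hiff x (hX' hx) y (hY' hy)).2 h⟩
    refine ⟨⟨pieces_disj hS X hX Y hY hne, fun X' Y' hX' hY' _ _ => ?_⟩,
      Or.inl (h0 X subset_rfl Y subset_rfl)⟩
    rw [h0 X subset_rfl Y subset_rfl, h0 X' hX' Y' hY']
    simpa using sc.ε_pos

/-- Neighbouring pieces lie in clusters adjacent to the cluster of `X`, with at most
$\Omega^*k/\gamma^2$ vertices in total, or are the partner of `X` in its pair. -/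
theorem pieceGraph_nbhd {ξ : ℝ} (sc : SmallConstants S.toConstants S.k ξ)
    (hS : S.CommonSetting) {X : Set V} (hX : X ∈ pieces S) :
    ((⋃₀ {Y | Y ∈ pieces S ∧ ∃ x ∈ X, ∃ y ∈ Y, (pieceGraph S).Adj x y}).ncard : ℝ) ≤
      S.Ωs ^ 2 * S.k / S.γ ^ 2 := by
  have hγ := sc.γ_pos
  have hΩ := sc.Ω_pos
  have hk := sc.k_pos
  set A : Set V := {y | ∃ C ∈ S.clusters, X ⊆ C ∧ y ∈ ⋃₀ (nbClusters S C : Set (Set V)) ∧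
    X.Nonempty} with hA
  set B : Set V := {y | ∃ p ∈ S.MAB, (X = p.1 ∨ X = p.2) ∧ y ∈ p.1 ∪ p.2 ∧ X.Nonempty} with hB
  have hsub : ⋃₀ {Y | Y ∈ pieces S ∧ ∃ x ∈ X, ∃ y ∈ Y, (pieceGraph S).Adj x y} ⊆ A ∪ B := by
    rintro z ⟨Y, ⟨hY, x, hx, y, hy, h | h⟩, hz⟩
    · left
      obtain ⟨C, hC, hxC⟩ := hS.Greg_cluster h.1
      obtain ⟨C', hC', hyC⟩ := hS.Greg_cluster h.1.symm
      exact ⟨C, hC, piece_subset_cluster hS hX hC hx hxC,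
        ⟨C', mem_nbClusters.2 ⟨hC', x, hxC, y, hyC, h.1⟩,
          piece_subset_cluster hS hY hC' hy hyC hz⟩, ⟨x, hx⟩⟩
    · right
      obtain ⟨p, hp, ⟨h1, h2⟩ | ⟨h1, h2⟩⟩ := h.2.iff_sides hS hX hY hx hy
      · exact ⟨p, hp, Or.inl h1, Or.inr (h2 ▸ hz), ⟨x, hx⟩⟩
      · exact ⟨p, hp, Or.inr h1, Or.inl (h2 ▸ hz), ⟨x, hx⟩⟩
  have hAc : (A.ncard : ℝ) ≤ S.Ωs * S.k / S.γ ^ 2 := by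
    by_cases h : A.Nonempty
    · obtain ⟨_, C, hC, hXC, -, x, hx⟩ := h
      have hAC : A ⊆ Set.univ ∩ ⋃₀ (nbClusters S C : Set (Set V)) := by
        rintro y ⟨C', hC', hXC', hy, -⟩
        rw [hS.cluster_eq hC hC' (hXC hx) (hXC' hx)]
        exact ⟨Set.mem_univ _, hy⟩
      have h1 := Set.ncard_le_ncard hAC (Set.toFinite _)
      rw [ncard_inter_sUnion _ (nbClusters_disj hS)] at h1
      simp only [Set.univ_inter] at h1
      refine le_trans ?_ (sum_nbClusters_le sc hS hC)
      exact_mod_cast h1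
    · rw [Set.not_nonempty_iff_eq_empty.1 h]
      simp only [Set.ncard_empty, Nat.cast_zero]
      positivity
  have hBc : (B.ncard : ℝ) ≤ 2 * S.εp * S.k := by
    by_cases h : B.Nonempty
    · obtain ⟨_, p, hp, hXp, -, x, hx⟩ := h
      have hBp : B ⊆ p.1 ∪ p.2 := by
        rintro y ⟨q, hq, hXq, hy, -⟩
        by_cases hpq : p = q
        · rwa [hpq]
        · exfalso
          obtain ⟨h1, h2, h3⟩ := hS.regMatching_MAB.disj p hp q hq hpq
          obtain ⟨-, -, h4⟩ := hS.regMatching_MAB.disj q hq p hp (Ne.symm hpq)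
          rcases hXp with e | e <;> rcases hXq with e' | e'
          · exact Set.disjoint_left.1 h1 (e ▸ hx) (e' ▸ hx)
          · exact Set.disjoint_left.1 h3 (e ▸ hx) (e' ▸ hx)
          · exact Set.disjoint_left.1 h4 (e' ▸ hx) (e ▸ hx)
          · exact Set.disjoint_left.1 h2 (e ▸ hx) (e' ▸ hx)
      have h1 := (Set.ncard_le_ncard hBp (Set.toFinite _)).trans (Set.ncard_union_le _ _)
      rw [← hS.regMatching_MAB.card_eq p hp] at h1
      obtain ⟨C, hC, hpC⟩ := (hS.pair_cluster p hp).1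
      have h2 := Set.ncard_le_ncard hpC (Set.toFinite _)
      rw [hS.cluster_card C hC] at h2
      have h3 := (hS.ν_mul_le hC).2
      have h4 : (B.ncard : ℝ) ≤ 2 * S.𝔠 := by exact_mod_cast (by omega : B.ncard ≤ 2 * S.𝔠)
      linarith
    · rw [Set.not_nonempty_iff_eq_empty.1 h]
      simp only [Set.ncard_empty, Nat.cast_zero]
      have := sc.εp_pos
      positivity
  have h1 := (Set.ncard_le_ncard hsub (Set.toFinite _)).trans (Set.ncard_union_le _ _)
  have h2 : ((⋃₀ {Y | Y ∈ pieces S ∧ ∃ x ∈ X, ∃ y ∈ Y, (pieceGraph S).Adj x y}).ncard : ℝ) ≤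
    A.ncard + B.ncard := by exact_mod_cast h1
  have hΩ2 : 2 ≤ S.Ωs := by
    have h3 : S.Ωs⁻¹ ≤ 2⁻¹ := sc.o_le_η.trans (sc.η_le.trans (by norm_num))
    exact (inv_le_inv₀ hΩ (by norm_num)).1 h3
  have h4 : 2 * S.εp * S.k ≤ S.Ωs * S.k / S.γ ^ 2 := by
    rw [le_div_iff₀ (by positivity)]
    have e1 : S.γ ^ 2 ≤ 1 := pow_le_one₀ hγ.le sc.γ_le_one
    have e2 : S.εp ≤ 1 := sc.εp_le_αh.trans sc.αh_le_one
    have e3 : S.εp * S.γ ^ 2 ≤ 1 * 1 := by gcongr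
    nlinarith
  have h5 : S.Ωs * S.k / S.γ ^ 2 + S.Ωs * S.k / S.γ ^ 2 ≤ S.Ωs ^ 2 * S.k / S.γ ^ 2 := by
    rw [← add_div]
    gcongr
    nlinarith [mul_pos hΩ hk]
  linarith

theorem regularizedGraph_pieces {ξ : ℝ} (sc : SmallConstants S.toConstants S.k ξ)
    (hS : S.CommonSetting) : RegularizedGraph (pieceGraph S) (pieces S) S.ε (S.γ ^ 2 * S.d / 2)
      (S.π * Real.sqrt S.εp * S.ν * S.k) (S.Ωs ^ 2 * S.k / S.γ ^ 2) where
  supp := by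
    rintro x ⟨y, h | ⟨-, p, hp, h | h⟩⟩
    exacts [h.2.1, ⟨p.1, (side_mem_pieces hp).1, h.1⟩, ⟨p.2, (side_mem_pieces hp).2, h.1⟩]
  disj := pieces_disj hS
  size _ hX := piece_size sc hS hX
  indep _ hX _ hx _ hy := pieceGraph_indep hS hX hx hy
  regular _ hX _ hY hne := pieceGraph_regular sc hS hX hY hne
  nbhd _ hX := pieceGraph_nbhd sc hS hX

end RegularizedPieces

end LKS

namespace LKS

/-! ### Pieces of large degree, and configuration (◇10). -/

section RegularCase

set_option linter.unusedSectionVars false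

variable {V : Type*} [Finite V] {S : Setup V} {T : Splitting V}

/-- The pieces almost all of whose vertices have a large degree. -/
def largePieces (S : Setup V) : Set (Set V) :=
  {X | X ∈ pieces S ∧
    ({v | v ∈ X ∧ (deg (pieceGraph S) v Set.univ : ℝ) < (1 + S.η / 40) * S.k}.ncard : ℝ) ≤
      S.ε * (X.ncard : ℝ)}

theorem deg_Greg_le_pieceGraph {v : V} (hv : v ∈ ⋃₀ pieces S) {Z Z' : Set V}
    (hZ : Z ⊆ ⋃₀ pieces S) (hZ' : Z ⊆ Z') :
    (deg S.Greg v Z : ℝ) ≤ deg (pieceGraph S) v Z' := by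
  have : deg S.Greg v Z ≤ deg (pieceGraph S) v Z' :=
    deg_le_deg fun u hu h => ⟨hZ' hu, Or.inl ⟨h, hv, hZ hu⟩⟩
  exact_mod_cast this

theorem SmallConstants.error_le {K : Constants} {k : ℕ} {ξ : ℝ} (sc : SmallConstants K k ξ) :
    Real.sqrt K.εp * (K.Ωs * k / K.γ ^ 2) ≤ K.η * k / 10 ^ 40 ∧
      3 * K.εp * (K.Ωs * k / K.γ ^ 2) ≤ K.η * k / 10 ^ 40 := by
  have hk := sc.k_pos
  have hΩ := sc.Ω_pos
  have hγ := sc.γ_pos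
  have h1 : Real.sqrt K.εp * (K.Ωs * k / K.γ ^ 2) ≤ K.η * k / 10 ^ 40 := by
    have := mul_le_mul_of_nonneg_right sc.sqrt_εp_mul_le hk.le
    calc _ = Real.sqrt K.εp * (K.Ωs / K.γ ^ 2) * k := by ring
      _ ≤ _ := this
      _ = _ := by ring
  refine ⟨h1, le_trans ?_ h1⟩
  gcongr
  linarith [sc.εp_le_sqrt.2, Real.sqrt_nonneg K.εp]

/-- A piece with a non-negligible set of vertices of large regular degree into `Z` consists mostly
of vertices of large degree into `Z`. -/
theorem piece_homogeneous {ξ : ℝ} (sc : SmallConstants S.toConstants S.k ξ)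
    (hS : S.CommonSetting) {X C A Z Z' : Set V} (hX : X ∈ pieces S) (hC : C ∈ S.clusters)
    (hXC : X ⊆ C) (hA : A ⊆ C) (hAc : S.εp * C.ncard ≤ A.ncard)
    (hm : ∀ v ∈ A, (1 + S.η / 30) * S.k ≤ (deg S.Greg v Z : ℝ))
    (hZ : Z ⊆ ⋃₀ pieces S) (hZ' : Z ⊆ Z') :
    ({v | v ∈ X ∧ (deg (pieceGraph S) v Z' : ℝ) < (1 + S.η / 40) * S.k}.ncard : ℝ) ≤
      S.ε * (X.ncard : ℝ) := by
  have h1 := cluster_homogeneous sc hS hC hA hAc hm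
  have h2 := sc.error_le.2
  have hηk : 0 < S.η * S.k := mul_pos sc.η_pos sc.k_pos
  have h3 : {v | v ∈ X ∧ (deg (pieceGraph S) v Z' : ℝ) < (1 + S.η / 40) * S.k} ⊆
      {v | v ∈ C ∧ (deg S.Greg v Z : ℝ) <
        (1 + S.η / 30) * S.k - 3 * S.εp * (S.Ωs * S.k / S.γ ^ 2)} := fun v hv => by
    refine ⟨hXC hv.1, ?_⟩
    have e1 := deg_Greg_le_pieceGraph ⟨X, hX, hv.1⟩ hZ hZ'
    have e2 := hv.2
    linarith
  have h4 : ({v | v ∈ X ∧ (deg (pieceGraph S) v Z' : ℝ) < (1 + S.η / 40) * S.k}.ncard : ℝ) ≤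
      ({v | v ∈ C ∧ (deg S.Greg v Z : ℝ) <
        (1 + S.η / 30) * S.k - 3 * S.εp * (S.Ωs * S.k / S.γ ^ 2)}.ncard : ℝ) := by
    exact_mod_cast Set.ncard_le_ncard h3 (Set.toFinite _)
  have h5 := (piece_ncard_ge sc hS hX).1
  have h6 := mul_le_mul_of_nonneg_left h5 sc.ε_pos.le
  -- The exceptional set has at most $\epsilon'|C|\le\epsilon\sqrt{\epsilon'}\,|C|\le\epsilon|X|$
  -- vertices; thus `A` may be anywhere in the cluster, not only in the piece.
  have h7 := mul_le_mul_of_nonneg_right sc.εp_le_sqrt.1 (Nat.cast_nonneg (α := ℝ) C.ncard)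
  rw [hS.cluster_card C hC] at h1 h7
  linarith

/-- The vertices of `L` outside the matchings have many regular neighbours in the matchings,
unless they are exceptional. -/
theorem deg_Greg_MAB {ξ : ℝ} (sc : SmallConstants S.toConstants S.k ξ) (hS : S.CommonSetting)
    {u : V} (huH : u ∉ S.H) (hu : u ∈ S.L \ vertsOf S.MAB) (hV : u ∉ S.VnoH)
    (hL : u ∉ S.Lsharp) (hJ : u ∉ S.J1) (hs : u ∉ S.Gexp.support) (hE : u ∉ S.E)
    (hVE : u ∉ S.VtoE) :
    (1 + S.η / 30) * S.k ≤ (deg S.Greg u (vertsOf S.MAB) : ℝ) := by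
  have h1 := deg_MAB_union_E sc hS huH hu hV hL hJ hs hE
  have h2 := deg_E_le sc hS huH hVE
  have h3 : (deg (deleteVerts S.Gcap S.H) u (vertsOf S.MAB ∪ S.E) : ℝ) ≤
      deg S.Greg u (vertsOf S.MAB) + deg S.Gcap u S.E := by
    have : deg (deleteVerts S.Gcap S.H) u (vertsOf S.MAB ∪ S.E) ≤
        deg S.Greg u (vertsOf S.MAB) + deg S.Gcap u S.E :=
      deg_le_add fun w hw h => by
        by_cases hwE : w ∈ S.E
        · exact Or.inr ⟨hwE, h.1⟩
        · exact Or.inl ⟨hw.resolve_right hwE, hS.Gcap_not_E h.1 huH h.2.2 (Or.inl hs) hE hwE⟩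
    exact_mod_cast this
  have h4 : S.ρ * S.k ≤ S.η / 10 * S.k := by
    have := sc.ρ_le_o.trans sc.o_le_η
    have h5 : S.ρ ≤ S.η / 10 := by
      have := sc.ρ_le_η_cube
      have h6 : S.η ^ 3 ≤ S.η ^ 1 :=
        pow_le_pow_of_le_one sc.η_pos.le sc.η_le_one (by norm_num)
      linarith [sc.η_pos]
    exact mul_le_mul_of_nonneg_right h5 sc.k_pos.le
  have hηk : 0 < S.η * S.k := mul_pos sc.η_pos sc.k_pos
  linarith

/-- The vertices in small remainders of clusters. -/
def smallRemainders (S : Setup V) : Set V :=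
  {w | ∃ C ∈ S.clusters, w ∈ C \ vertsOf S.MAB ∧
    ((C \ vertsOf S.MAB).ncard : ℝ) < Real.sqrt S.εp * S.𝔠}

/-- The vertices with many regular neighbours in the matchings, in clusters with few of them. -/
def sparseSaturated (S : Setup V) : Set V :=
  {w | ∃ C ∈ S.clusters, w ∈ C ∧ (1 + S.η / 30) * S.k ≤ (deg S.Greg w (vertsOf S.MAB) : ℝ) ∧
    ({u | u ∈ C ∧ (1 + S.η / 30) * S.k ≤ (deg S.Greg u (vertsOf S.MAB) : ℝ)}.ncard : ℝ) <
      S.εp * C.ncard}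

theorem smallRemainders_inter_le {C : Set V} (hS : S.CommonSetting) (hC : C ∈ S.clusters) :
    ((smallRemainders S ∩ C).ncard : ℝ) ≤ Real.sqrt S.εp * C.ncard := by
  by_cases h : (smallRemainders S ∩ C).Nonempty
  · obtain ⟨w, ⟨C', hC', hw, hlt⟩, hwC⟩ := h
    obtain rfl := hS.cluster_eq hC hC' hwC hw.1
    rw [hS.cluster_card C hC]
    refine le_trans ?_ hlt.le
    have : smallRemainders S ∩ C ⊆ C \ vertsOf S.MAB := by
      rintro u ⟨⟨C₁, _, hu, -⟩, huC⟩
      exact ⟨huC, hu.2⟩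
    exact_mod_cast Set.ncard_le_ncard this (Set.toFinite _)
  · rw [Set.not_nonempty_iff_eq_empty.1 h, Set.ncard_empty, Nat.cast_zero]
    positivity

theorem sparseSaturated_inter_le {ξ : ℝ} (sc : SmallConstants S.toConstants S.k ξ) {C : Set V}
    (hS : S.CommonSetting) (hC : C ∈ S.clusters) :
    ((sparseSaturated S ∩ C).ncard : ℝ) ≤ Real.sqrt S.εp * C.ncard := by
  by_cases h : (sparseSaturated S ∩ C).Nonempty
  · obtain ⟨w, ⟨C', hC', hw, -, hlt⟩, hwC⟩ := h
    obtain rfl := hS.cluster_eq hC hC' hwC hw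
    have h1 : S.εp * (C.ncard : ℝ) ≤ Real.sqrt S.εp * C.ncard := by
      gcongr
      linarith [sc.εp_le_sqrt.2, Real.sqrt_nonneg S.εp]
    refine le_trans ?_ (hlt.le.trans h1)
    have : sparseSaturated S ∩ C ⊆
        {u | u ∈ C ∧ (1 + S.η / 30) * S.k ≤ (deg S.Greg u (vertsOf S.MAB) : ℝ)} := by
      rintro u ⟨⟨C₁, _, _, hu, -⟩, huC⟩
      exact ⟨huC, hu⟩
    exact_mod_cast Set.ncard_le_ncard this (Set.toFinite _)
  · rw [Set.not_nonempty_iff_eq_empty.1 h, Set.ncard_empty, Nat.cast_zero]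
    positivity

/-- Outside negligible exceptions, a good neighbour is in $V_{AB}$ or is a large vertex to which
`deg_Greg_MAB` applies. The latter lies in a large piece unless the remainder of its cluster is
small or its cluster has few vertices of this kind; these two possibilities take only a proportion
$\sqrt{\epsilon'}$ of each cluster. -/
theorem deg_matching_union_largePieces {ξ : ℝ} (sc : SmallConstants S.toConstants S.k ξ)
    (hS : S.CommonSetting) {v : V} (hvC : v ∈ ⋃₀ S.clusters) (hXA : v ∈ S.XA) (hJ : v ∉ S.J)
    (hW : v ∉ expShadow S) (hVE : v ∉ S.VtoE) (hR : v ∉ RR S) :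
    (1 + S.η / 30) * S.k ≤ (deg S.Greg v (vertsOf S.MAB ∪ ⋃₀ largePieces S) : ℝ) := by
  have hvH := hS.cluster_disj hvC
  have hvE : v ∉ S.E := fun h => hS.E_not_cluster h hvC
  obtain ⟨C₀, hC₀, hvC₀⟩ := hvC
  have h1 := deg_Vgood_of_XA hS hXA hJ
  have h2 := deg_le_of_not_expShadow hW
  have h3 := deg_E_le sc hS hvH hVE
  have h4 := deg_le_of_not_J hJ
  have h5 : (deg S.Gcap v ((S.VtoE ∩ S.L) \ vertsOf S.MAB) : ℝ) ≤ 2 * S.η ^ 2 * S.k / 10 ^ 5 := by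
    by_contra! h
    exact hR h
  have h6 := deg_sparse_le sc hS (Real.sqrt_nonneg S.εp) hC₀ hvC₀
    fun C hC => smallRemainders_inter_le hS hC
  have h7 := deg_sparse_le sc hS (Real.sqrt_nonneg S.εp) hC₀ hvC₀
    fun C hC => sparseSaturated_inter_le sc hS hC
  set bad := S.VnoH ∪ S.Lsharp ∪ S.Jatom ∪ S.J1 with hbad
  have h8 : (deg S.Gcap v S.Vgood : ℝ) ≤
      deg S.Greg v ((vertsOf S.MAB ∪ ⋃₀ largePieces S) ∪
        (smallRemainders S ∪ sparseSaturated S)) +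
      deg S.Gcap v ((S.Gexp.support ∪ S.E) ∪ (bad ∪ (S.VtoE ∩ S.L) \ vertsOf S.MAB)) := by
    have : deg S.Gcap v S.Vgood ≤
        deg S.Greg v ((vertsOf S.MAB ∪ ⋃₀ largePieces S) ∪
          (smallRemainders S ∪ sparseSaturated S)) +
        deg S.Gcap v ((S.Gexp.support ∪ S.E) ∪ (bad ∪ (S.VtoE ∩ S.L) \ vertsOf S.MAB)) := by
      refine deg_le_add fun w hw h => ?_
      by_cases hw1 : w ∈ (S.Gexp.support ∪ S.E) ∪ (bad ∪ (S.VtoE ∩ S.L) \ vertsOf S.MAB)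
      · exact Or.inr ⟨hw1, h⟩
      left
      have hwH : w ∉ S.H := fun h' => hw.2 (Or.inl h')
      have hws : w ∉ S.Gexp.support := fun h' => hw1 (Or.inl (Or.inl h'))
      have hwE : w ∉ S.E := fun h' => hw1 (Or.inl (Or.inr h'))
      have hwbad : w ∉ bad := fun h' => hw1 (Or.inr (Or.inl h'))
      have hG := hS.Gcap_not_E h hvH hwH (Or.inr hws) hvE hwE
      refine ⟨?_, hG⟩
      rcases mem_of_mem_Vplus hw.1 with hw2 | hw2 | hw2 | hw2
      · exact Or.inl (Or.inl hw2)
      · have hwV : w ∉ S.VtoE := fun h' => hw1 (Or.inr (Or.inr ⟨⟨h', hw2.1⟩, hw2.2⟩))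
        have hdeg := deg_Greg_MAB sc hS hwH hw2
          (fun h' => hwbad (Or.inl (Or.inl (Or.inl h'))))
          (fun h' => hwbad (Or.inl (Or.inl (Or.inr h'))))
          (fun h' => hwbad (Or.inr h')) hws hwE hwV
        obtain ⟨C, hC, hwC⟩ := hS.Greg_cluster hG.symm
        by_cases hsm : ((C \ vertsOf S.MAB).ncard : ℝ) < Real.sqrt S.εp * S.𝔠
        · exact Or.inr (Or.inl ⟨C, hC, ⟨hwC, hw2.2⟩, hsm⟩)
        by_cases hsat : ({u | u ∈ C ∧
            (1 + S.η / 30) * S.k ≤ (deg S.Greg u (vertsOf S.MAB) : ℝ)}.ncard : ℝ) <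
              S.εp * C.ncard
        · exact Or.inr (Or.inr ⟨C, hC, hwC, hdeg, hsat⟩)
        have hX : C \ vertsOf S.MAB ∈ pieces S := Or.inr ⟨C, hC, rfl, not_lt.1 hsm⟩
        refine Or.inl (Or.inr ⟨C \ vertsOf S.MAB, ⟨hX, ?_⟩, hwC, hw2.2⟩)
        exact piece_homogeneous sc hS hX hC Set.sdiff_subset (fun u hu => hu.1)
          (not_lt.1 hsat) (fun u hu => hu.2) vertsOf_MAB_subset_pieces (Set.subset_univ _)
      · exact absurd hw2 hws
      · exact absurd hw2 hwE
    exact_mod_cast this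
  have e1 := deg_union_le S.Greg v (vertsOf S.MAB ∪ ⋃₀ largePieces S)
    (smallRemainders S ∪ sparseSaturated S)
  have e2 := deg_union_le S.Greg v (smallRemainders S) (sparseSaturated S)
  have e3 := deg_union_le S.Gcap v (S.Gexp.support ∪ S.E)
    (bad ∪ (S.VtoE ∩ S.L) \ vertsOf S.MAB)
  have e4 := deg_union_le S.Gcap v S.Gexp.support S.E
  have e5 := deg_union_le S.Gcap v bad ((S.VtoE ∩ S.L) \ vertsOf S.MAB)
  have hk := sc.k_pos
  have hη := sc.η_pos
  have hηk : 0 < S.η * S.k := mul_pos hη hk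
  have f1 : S.ρ * S.k ≤ S.η * S.k / 10 ^ 5 := by
    have h9 : S.η ^ 3 ≤ S.η ^ 1 := pow_le_pow_of_le_one hη.le sc.η_le_one (by norm_num)
    have h10 : S.ρ ≤ S.η / 10 ^ 5 := by linarith [sc.ρ_le_η_cube]
    calc S.ρ * S.k ≤ S.η / 10 ^ 5 * S.k := by gcongr
      _ = _ := by ring
  have f2 : S.η ^ 2 * S.k ≤ S.η * S.k := by
    have h9 : S.η ^ 2 ≤ S.η ^ 1 := pow_le_pow_of_le_one hη.le sc.η_le_one (by norm_num)
    rw [pow_one] at h9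
    gcongr
  have f3 := sc.error_le.1
  linarith

/-- The vertices of `Y` that are in no piece with a non-negligible part in `Y`. -/
def poorPart (S : Setup V) (Y : Set V) : Set V :=
  {v | v ∈ Y ∧ ¬ ∃ X ∈ pieces S, v ∈ X ∧ S.εp * S.𝔠 ≤ ((X ∩ Y).ncard : ℝ)}

/-- A piece has at least $\sqrt{\epsilon'}\,\mathfrak c$ vertices, so fewer than $\epsilon'\mathfrak
c$ of them are at most a proportion $\sqrt{\epsilon'}$ of it. Vertices of `Y` in no piece lie in
small remainders, with the same proportion. -/
theorem ncard_poorPart_le {ξ : ℝ} (sc : SmallConstants S.toConstants S.k ξ)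
    (hS : S.CommonSetting) {Y : Set V} (hY : Y ⊆ ⋃₀ S.clusters) :
    ((poorPart S Y).ncard : ℝ) ≤ 2 * Real.sqrt S.εp * S.n := by
  have hs := Real.sqrt_nonneg S.εp
  have hn : ((Set.univ : Set V).ncard : ℝ) = S.n := by rw [Set.ncard_univ]; rfl
  have h1 := ncard_biUnion_le_mul {X | X ∈ pieces S ∧ ((X ∩ Y).ncard : ℝ) < S.εp * S.𝔠}
    (fun X => X) (fun X => X ∩ Y) Set.univ hs
    (fun X hX X' hX' hne => pieces_disj hS X hX.1 X' hX'.1 hne) (fun _ _ => Set.subset_univ _)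
    (fun X hX => by
      have e1 := (piece_ncard_ge sc hS hX.1).1
      have e2 := mul_le_mul_of_nonneg_left e1 hs
      rw [← mul_assoc, Real.mul_self_sqrt sc.εp_pos.le] at e2
      exact hX.2.le.trans e2)
  have h2 := ncard_biUnion_le_mul S.clusters (fun C => C) (fun C => smallRemainders S ∩ C)
    Set.univ hs (fun C hC C' hC' hne => hS.sparse.bounded.clusters_disj C hC C' hC' hne)
    (fun _ _ => Set.subset_univ _) fun C hC => smallRemainders_inter_le hS hC
  rw [hn] at h1 h2
  have h3 : poorPart S Y ⊆
      (⋃ X ∈ {X | X ∈ pieces S ∧ ((X ∩ Y).ncard : ℝ) < S.εp * S.𝔠}, X ∩ Y) ∪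
        ⋃ C ∈ S.clusters, smallRemainders S ∩ C := by
    rintro v ⟨hvY, hv⟩
    obtain ⟨C, hC, hvC⟩ := hY hvY
    by_cases hp : v ∈ ⋃₀ pieces S
    · obtain ⟨X, hX, hvX⟩ := hp
      left
      simp only [Set.mem_iUnion]
      exact ⟨X, ⟨hX, not_le.1 fun h => hv ⟨X, hX, hvX, h⟩⟩, hvX, hvY⟩
    · right
      simp only [Set.mem_iUnion]
      have hvM : v ∉ vertsOf S.MAB := fun h => hp (vertsOf_MAB_subset_pieces h)
      refine ⟨C, hC, ⟨C, hC, ⟨hvC, hvM⟩, not_le.1 fun h => hp ?_⟩, hvC⟩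
      exact ⟨_, Or.inr ⟨C, hC, rfl, h⟩, hvC, hvM⟩
  have h4 := (Set.ncard_le_ncard h3 (Set.toFinite _)).trans (Set.ncard_union_le _ _)
  have h5 : ((poorPart S Y).ncard : ℝ) ≤
      ((⋃ X ∈ {X | X ∈ pieces S ∧ ((X ∩ Y).ncard : ℝ) < S.εp * S.𝔠}, X ∩ Y).ncard : ℝ) +
        (⋃ C ∈ S.clusters, smallRemainders S ∩ C).ncard := by exact_mod_cast h4
  linarith

theorem SmallConstants.sqrt_εp_lt {K : Constants} {k : ℕ} {ξ : ℝ} (sc : SmallConstants K k ξ) :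
    8 * Real.sqrt K.εp < K.ρ / K.Ωs := by
  have h0 := sc.αh_pos
  have ho := sc.o_pos
  have hρ := sc.ρ_pos
  have aρ : K.αh ≤ K.ρ := (sc.αh_le_d.trans sc.d_le_γ).trans sc.γ_le_ρ
  have h1 : Real.sqrt K.εp ≤ K.ρ * K.Ωs⁻¹ * (1 / 10 ^ 40) :=
    calc Real.sqrt K.εp ≤ K.αh ^ 50 := sc.sqrt_εp_le
      _ ≤ K.αh ^ 3 := pow_le_pow_of_le_one h0.le sc.αh_le_one (by norm_num)
      _ = K.αh * K.αh * K.αh := by ring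
      _ ≤ K.ρ * K.Ωs⁻¹ * (1 / 10 ^ 40) := by
        gcongr
        · exact aρ.trans sc.ρ_le_o
        · exact sc.αh_tiny
  have h2 : 0 < K.ρ * K.Ωs⁻¹ := by positivity
  rw [div_eq_mul_inv]
  linarith

/-- A matching pair of which at most half of either side is poor has an edge between the parts
that are not poor. -/
theorem exists_rich_edge [Nonempty V] {ξ ε d l d' : ℝ} {M : Set (Set V × Set V)}
    (hM : UsableMatching S T ε d l d' M) (sc : SmallConstants S.toConstants S.k ξ)
    (hS : S.CommonSetting) (hC : vertsOf M ⊆ ⋃₀ S.clusters) :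
    ∃ p ∈ M, ∃ a ∈ p.1 \ poorPart S (vertsOf M), ∃ b ∈ p.2 \ poorPart S (vertsOf M),
      S.G.Adj a b := by
  set P := poorPart S (vertsOf M) with hP
  have hd : 0 < d := by linarith [hM.d'_le, hM.ε_pos, hM.d'_nonneg]
  -- A pair with a side that is more than half poor has at most four times as many vertices as it
  -- has poor ones. If all pairs were like this, `V(M)` would have at most $8\sqrt{\epsilon'}\,n$
  -- vertices, fewer than $\frac{\rho n}{\Omega^*}$.
  obtain ⟨p, hp, h1, h2⟩ : ∃ p ∈ M, (p.1.ncard : ℝ) ≤ 2 * (p.1 \ P).ncard ∧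
      (p.2.ncard : ℝ) ≤ 2 * (p.2 \ P).ncard := by
    by_contra! hcon
    have h3 := ncard_biUnion_le_mul M (fun p => (p.1 ∪ p.2) ∩ P) (fun p => p.1 ∪ p.2) P (c := 4)
      (by norm_num) (fun p hp q hq hne => ?_) (fun _ _ => Set.inter_subset_right) fun p hp => ?_
    · have h4 : vertsOf M ⊆ ⋃ p ∈ M, p.1 ∪ p.2 := by
        rintro x (⟨p, hp, hx⟩ | ⟨p, hp, hx⟩) <;> simp only [Set.mem_iUnion]
        exacts [⟨p, hp, Or.inl hx⟩, ⟨p, hp, Or.inr hx⟩]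
      have h5 : ((vertsOf M).ncard : ℝ) ≤ (⋃ p ∈ M, p.1 ∪ p.2).ncard := by
        exact_mod_cast Set.ncard_le_ncard h4 (Set.toFinite _)
      have h6 := ncard_poorPart_le sc hS hC
      have h7 := hM.large
      have h8 := mul_lt_mul_of_pos_right sc.sqrt_εp_lt (n_pos (S := S))
      have h9 : S.ρ * S.n / S.Ωs = S.ρ / S.Ωs * S.n := by ring
      linarith
    · obtain ⟨e1, e2, e3⟩ := hM.reg.disj p hp q hq hne
      obtain ⟨-, -, e4⟩ := hM.reg.disj q hq p hp hne.symm
      refine Disjoint.mono Set.inter_subset_left Set.inter_subset_left ?_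
      rw [Set.disjoint_union_left, Set.disjoint_union_right, Set.disjoint_union_right]
      exact ⟨⟨e1, e3⟩, e4.symm, e2⟩
    · have hcard := hM.reg.card_eq p hp
      have e1 : ((p.1 ∪ p.2).ncard : ℝ) ≤ p.1.ncard + p.2.ncard := by
        exact_mod_cast Set.ncard_union_le _ _
      have e2 : ∀ X : Set V, (X.ncard : ℝ) = (X \ P).ncard + (X ∩ P).ncard := fun X => by
        have := Set.ncard_inter_add_ncard_sdiff_eq_ncard X P (Set.toFinite _)
        have : (((X ∩ P).ncard + (X \ P).ncard : ℕ) : ℝ) = X.ncard := by rw [this]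
        push_cast at this
        linarith
      have e3 : ∀ X ⊆ p.1 ∪ p.2, ((X ∩ P).ncard : ℝ) ≤ ((p.1 ∪ p.2) ∩ P).ncard := fun X hX => by
        exact_mod_cast Set.ncard_le_ncard (Set.inter_subset_inter_left _ hX) (Set.toFinite _)
      have e4 := e3 p.1 Set.subset_union_left
      have e5 := e3 p.2 Set.subset_union_right
      have e6 := e2 p.1
      have e7 := e2 p.2
      have hcard' : (p.1.ncard : ℝ) = p.2.ncard := by exact_mod_cast hcard
      by_cases hh : (p.1.ncard : ℝ) ≤ 2 * (p.1 \ P).ncard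
      · have := hcon p hp hh
        linarith
      · push Not at hh
        linarith
  refine ⟨p, hp, exists_adj_of_density_pos ?_⟩
  have h3 := hM.ε_le
  have r := abs_lt.1 ((hM.reg.regular p hp).2 (p.1 \ P) (p.2 \ P) Set.sdiff_subset
    Set.sdiff_subset (by nlinarith [(Nat.cast_nonneg p.1.ncard : (0 : ℝ) ≤ _)])
    (by nlinarith [(Nat.cast_nonneg p.2.ncard : (0 : ℝ) ≤ _)]))
  have := hM.reg.dense p hp
  linarith [r.2, hM.d'_le, hM.ε_pos, hM.d'_nonneg]

/-- The case where the matching sends almost all edges to the regular graph. -/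
theorem conf10_of_regular [Nonempty V] {ξ ε d l d' : ℝ} {M : Set (Set V × Set V)}
    (hM : UsableMatching S T ε d l d' M) (sc : SmallConstants S.toConstants S.k ξ)
    (hS : S.CommonSetting)
    (hMA : vertsOf M ⊆ (S.XA ∩ T.P 0) \ (S.J ∪ T.exV ∪ FF S T))
    (hreg : vertsOf M ⊆ ⋃₀ S.clusters \ (expShadow S ∪ S.VtoE ∪ RR S))
    (hadj : ∀ p ∈ M, ∀ x ∈ p.1, ∀ y ∈ p.2, S.G.Adj x y →
      S.Greg.Adj x y ∨ S.GD.Adj x y ∧ Matched S x y) :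
    Conf10 S S.ε (S.γ ^ 2 * S.d / 2) (S.π * Real.sqrt S.εp * S.ν * S.k)
      (S.Ωs ^ 2 * S.k / S.γ ^ 2) (S.η / 40) := by
  have hMC : vertsOf M ⊆ ⋃₀ S.clusters := fun v hv => (hreg hv).1
  obtain ⟨p, hp, a, ha, b, hb, hab⟩ := exists_rich_edge hM sc hS hMC
  have haM : a ∈ vertsOf M := Or.inl ⟨p, hp, ha.1⟩
  have hbM : b ∈ vertsOf M := Or.inr ⟨p, hp, hb.1⟩
  have rich : ∀ v ∈ vertsOf M, v ∉ poorPart S (vertsOf M) →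
      ∃ X ∈ pieces S, v ∈ X ∧
        ({u | u ∈ X ∧ (deg (pieceGraph S) u (vertsOf S.MAB ∪ ⋃₀ largePieces S) : ℝ) <
          (1 + S.η / 40) * S.k}.ncard : ℝ) ≤ S.ε * (X.ncard : ℝ) := by
    intro v hv hvP
    obtain ⟨X, hX, hvX, hXM⟩ : ∃ X ∈ pieces S, v ∈ X ∧
        S.εp * S.𝔠 ≤ ((X ∩ vertsOf M).ncard : ℝ) := by
      by_contra h
      exact hvP ⟨hv, h⟩
    obtain ⟨C, hC, hvC⟩ := hMC hv
    have hXC := piece_subset_cluster hS hX hC hvX hvC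
    refine ⟨X, hX, hvX, piece_homogeneous sc hS hX hC hXC
      (A := X ∩ vertsOf M) (Set.inter_subset_left.trans hXC) ?_ (fun u hu => ?_)
      (Set.union_subset vertsOf_MAB_subset_pieces ?_) subset_rfl⟩
    · rwa [hS.cluster_card C hC]
    · obtain ⟨⟨h1, -⟩, h2⟩ := hMA hu.2
      have h3 := (hreg hu.2).2
      exact deg_matching_union_largePieces sc hS (hMC hu.2) h1
        (fun h => h2 (Or.inl (Or.inl h))) (fun h => h3 (Or.inl (Or.inl h)))
        (fun h => h3 (Or.inl (Or.inr h))) (fun h => h3 (Or.inr h))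
    · exact Set.sUnion_subset_sUnion fun X hX => hX.1
  obtain ⟨A, hA, haA, hAd⟩ := rich a haM ha.2
  obtain ⟨B, hB, hbB, hBd⟩ := rich b hbM hb.2
  -- Both ends lie in pieces, so even a regular edge outside matched pairs is in `pieceGraph`.
  have hΓ : (pieceGraph S).Adj a b :=
    (hadj p hp a ha.1 b hb.1 hab).imp (fun h => ⟨h, ⟨A, hA, haA⟩, B, hB, hbB⟩) id
  refine ⟨pieceGraph S, pieces S, S.MAB, largePieces S, A, B,
    fun x y h => (hS.GD_le (pieceGraph_le hS h)).1, regularizedGraph_pieces sc hS,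
    pieceGraph_regMatching sc hS, Set.subset_union_left, fun X hX => hX.1, hA, hB, ?_,
    ⟨a, haA, b, hbB, hΓ⟩, ?_, fun X hX => hX.2⟩
  · rintro rfl
    exact pieceGraph_indep hS hA haA hbB hΓ
  · rintro X (rfl | rfl)
    exacts [hAd, hBd]

end RegularCase

end LKS

namespace LKS

/-! ### The two types of matchings, and the case distinction. -/

section Conclusion

set_option linter.unusedSectionVars false

variable {V : Type*} [Finite V] {S : Setup V} {T : Splitting V}

theorem exists_mem_of_large [Nonempty V] {ξ : ℝ} (sc : SmallConstants S.toConstants S.k ξ)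
    {M : Set (Set V × Set V)} (hl : S.ρ * S.n / S.Ωs ≤ ((vertsOf M).ncard : ℝ)) :
    ∃ p, p ∈ M := by
  have h1 : 0 < S.ρ * S.n / S.Ωs := by
    have := sc.ρ_pos; have := sc.Ω_pos; have := n_pos (S := S); positivity
  have h2 : 0 < (vertsOf M).ncard := by exact_mod_cast h1.trans_le hl
  obtain ⟨v, ⟨p, hp, -⟩ | ⟨p, hp, -⟩⟩ := Set.nonempty_of_ncard_ne_zero h2.ne'
  exacts [⟨p, hp⟩, ⟨p, hp⟩]

theorem usableMatching_of_typeM1 [Nonempty V] {ξ : ℝ} (sc : SmallConstants S.toConstants S.k ξ)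
    (hS : S.CommonSetting) {M : Set (Set V × Set V)} (h : TypeM1 S M) (hP : vertsOf M ⊆ T.P 0)
    (hl : S.ρ * S.n / S.Ωs ≤ ((vertsOf M).ncard : ℝ)) :
    UsableMatching S T (10 ^ 5 * S.εp / S.η ^ 2) (S.γ ^ 2 / 4)
      (S.η ^ 2 * S.𝔠 / (8 * 10 ^ 3 * S.k) * S.k) (S.γ ^ 3 * S.ρ / (32 * S.Ωs)) M := by
  have hη := sc.η_pos
  have hρ := sc.ρ_pos
  have hΩ := sc.Ω_pos
  have ho := sc.o_pos
  have hγ := sc.γ_pos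
  have hk := sc.k_pos
  have hα := sc.αh_pos
  have hεp := sc.εp_pos
  have hπ := sc.π_pos
  have aη : S.αh ≤ S.η := sc.αh_le_d.trans sc.d_le_η
  have e1 : S.εp ≤ S.αh * (1 / 10 ^ 40) * (S.η * S.η) :=
    calc S.εp ≤ S.αh ^ 4 := le_pow_of_le_pow sc.εp_le hα.le sc.αh_le_one (by norm_num)
      _ = S.αh * S.αh * (S.αh * S.αh) := by ring
      _ ≤ _ := by gcongr; exact sc.αh_tiny
  have e2 : 10 ^ 5 * S.εp / S.η ^ 2 ≤ S.αh / 10 ^ 35 := by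
    rw [div_le_iff₀ (by positivity)]
    nlinarith
  have e3 : S.γ ^ 3 * S.ρ / (32 * S.Ωs) ≤ S.γ ^ 2 / 32 := by
    have : S.γ ^ 3 * S.ρ / (32 * S.Ωs) = S.γ ^ 2 * (S.γ * S.ρ * S.Ωs⁻¹) / 32 := by
      field_simp
    rw [this]
    have h1 : S.γ * S.ρ * S.Ωs⁻¹ ≤ 1 * 1 * 1 := by
      gcongr
      exacts [sc.γ_le_one, sc.ρ_le_one, sc.o_le_one]
    gcongr
    exact mul_le_of_le_one_right (by positivity) (by linarith)
  have e4 : S.αh ≤ S.γ ^ 2 :=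
    sc.αh_le_d.trans (le_pow_of_le_pow sc.d_le hγ.le sc.γ_le_one (by norm_num))
  refine ⟨h.1, by positivity, ?_, ?_, by positivity, ?_, ?_, hP, hl⟩
  · linarith [sc.αh_le_one]
  · linarith [sc.αh_le]
  · linarith
  -- A pair of `M` yields a cluster, whence $\mathfrak c\ge\nu k$. The constants match exactly,
  -- since $\frac25\cdot\frac1{8\cdot10^3}=\frac1{2\cdot10^4}$.
  · obtain ⟨p, hp⟩ := exists_mem_of_large sc hl
    obtain ⟨q, hq, -⟩ := h.2 p hp
    obtain ⟨⟨C, hC, -⟩, -⟩ := hS.pair_cluster q (Or.inl hq.1)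
    have h1 := mul_le_mul_of_nonneg_left (hS.ν_mul_le hC).1 (by positivity : 0 ≤ S.η ^ 2)
    have h2 : S.η ^ 2 * S.𝔠 / (8 * 10 ^ 3 * S.k) * S.k = S.η ^ 2 * S.𝔠 / (8 * 10 ^ 3) := by
      field_simp
    rw [h2]
    linarith

theorem usableMatching_of_typeM2 {ξ : ℝ} (sc : SmallConstants S.toConstants S.k ξ)
    {M : Set (Set V × Set V)} (h : TypeM2 S M) (hP : vertsOf M ⊆ T.P 0)
    (hl : S.ρ * S.n / S.Ωs ≤ ((vertsOf M).ncard : ℝ)) :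
    UsableMatching S T S.π (S.γ ^ 3 * S.ρ / (32 * S.Ωs)) (S.αh * S.ρ / S.Ωs * S.k)
      (S.γ ^ 3 * S.ρ / (128 * S.Ωs)) M := by
  have hη := sc.η_pos
  have hρ := sc.ρ_pos
  have hΩ := sc.Ω_pos
  have ho := sc.o_pos
  have hγ := sc.γ_pos
  have hk := sc.k_pos
  have hα := sc.αh_pos
  have hν := sc.ν_pos
  have aγ : S.αh ≤ S.γ := sc.αh_le_d.trans sc.d_le_γ
  have e1 : S.π ≤ S.γ ^ 3 * S.ρ * S.Ωs⁻¹ * (1 / 10 ^ 40) :=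
    calc S.π ≤ S.γ ^ 6 := sc.π_le_d.trans
          (le_pow_of_le_pow sc.d_le hγ.le sc.γ_le_one (by norm_num))
      _ = S.γ ^ 3 * S.γ * S.γ * S.γ := by ring
      _ ≤ _ := by
        gcongr
        exacts [sc.γ_le_ρ, sc.γ_le_ρ.trans sc.ρ_le_o,
          (sc.γ_le_ρ.trans (sc.ρ_le_o.trans sc.o_le_η)).trans sc.η_le]
  have e2 : ∀ c : ℝ, S.γ ^ 3 * S.ρ / (c * S.Ωs) = S.γ ^ 3 * S.ρ * S.Ωs⁻¹ / c := fun c => by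
    rw [div_eq_mul_inv, mul_inv]; ring
  have e3 : 0 < S.γ ^ 3 * S.ρ * S.Ωs⁻¹ := by positivity
  refine ⟨h.1, sc.π_pos, ?_, le_rfl, by positivity, ?_, ?_, hP, hl⟩
  · have := sc.π_le_d.trans (sc.d_le_η.trans sc.η_le)
    linarith
  · rw [e2, e2]
    linarith
  · have e4 : S.ν ≤ S.αh * S.ρ * S.Ωs⁻¹ :=
      calc S.ν ≤ S.αh ^ 3 := sc.ν_le.trans
            (le_pow_of_le_pow sc.εp_le hα.le sc.αh_le_one (by norm_num))
        _ = S.αh * S.αh * S.αh := by ring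
        _ ≤ _ := by
          gcongr
          exacts [aγ.trans sc.γ_le_ρ, (aγ.trans sc.γ_le_ρ).trans sc.ρ_le_o]
    have e5 : S.η ^ 2 ≤ 1 := pow_le_one₀ hη.le sc.η_le_one
    have e6 : S.η ^ 2 * S.ν ≤ 1 * (S.αh * S.ρ * S.Ωs⁻¹) := by gcongr
    have e7 : S.η ^ 2 * S.ν / (2 * 10 ^ 4) ≤ 2 / 5 * (S.αh * S.ρ / S.Ωs) := by
      rw [div_eq_mul_inv (S.αh * S.ρ)]
      have : 0 < S.αh * S.ρ * S.Ωs⁻¹ := by positivity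
      linarith
    calc _ ≤ 2 / 5 * (S.αh * S.ρ / S.Ωs) * S.k := by gcongr
      _ = _ := by ring

/-- Each pair is inside a pair of `MA`, whose sides lie in the two sides of a spot, and edges of
$G-\mathbb H$ across a spot belong to `GD`. -/
theorem adj_of_typeM1 (hS : S.CommonSetting) {M : Set (Set V × Set V)} (h : TypeM1 S M) :
    ∀ p ∈ M, ∀ x ∈ p.1, ∀ y ∈ p.2, S.G.Adj x y →
      S.Greg.Adj x y ∨ S.GD.Adj x y ∧ Matched S x y := by
  intro p hp x hx y hy hxy
  obtain ⟨q, hq, hpq⟩ := h.2 p hp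
  have hqM : q ∈ S.MAB := Or.inl hq.1
  have hxy' : x ∈ q.1 ∧ y ∈ q.2 ∨ x ∈ q.2 ∧ y ∈ q.1 :=
    hpq.imp (fun h => ⟨h.1 hx, h.2 hy⟩) fun h => ⟨h.1 hx, h.2 hy⟩
  refine Or.inr ⟨?_, q, hqM, hxy'⟩
  have hs := side_subset hqM
  have hxH : x ∉ S.H := hS.MAB_disj (hxy'.elim (fun h => hs.1 h.1) fun h => hs.2 h.1)
  have hyH : y ∉ S.H := hS.MAB_disj (hxy'.elim (fun h => hs.2 h.2) fun h => hs.1 h.2)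
  obtain ⟨⟨D, hD, hsee⟩, -⟩ := hS.pair_spot q hqM
  have cov := hS.sparse.bounded.spots_cover D hD
  have hUW : x ∈ D.U ∧ y ∈ D.W ∨ x ∈ D.W ∧ y ∈ D.U := by
    rcases hsee with ⟨h1, h2⟩ | ⟨h1, h2⟩ <;> rcases hxy' with ⟨h3, h4⟩ | ⟨h3, h4⟩
    exacts [Or.inl ⟨h1 h3, h2 h4⟩, Or.inr ⟨h2 h3, h1 h4⟩, Or.inr ⟨h1 h3, h2 h4⟩,
      Or.inl ⟨h2 h3, h1 h4⟩]
  rcases hUW with ⟨h1, h2⟩ | ⟨h1, h2⟩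
  · exact cov x h1 y h2 ⟨hxy, hxH, hyH⟩
  · exact (cov y h2 x h1 ⟨hxy.symm, hyH, hxH⟩).symm

/-- An edge of the cleaned spots is regular or has an end in `E`, and `E` is disjoint from the
clusters. -/
theorem adj_of_typeM2 (hS : S.CommonSetting) {M : Set (Set V × Set V)} (h : TypeM2 S M)
    (hC : vertsOf M ⊆ ⋃₀ S.clusters) :
    ∀ p ∈ M, ∀ x ∈ p.1, ∀ y ∈ p.2, S.G.Adj x y →
      S.Greg.Adj x y ∨ S.GD.Adj x y ∧ Matched S x y := by
  obtain ⟨-, 𝒟', hD, hadj, -⟩ := h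
  intro p hp x hx y hy hxy
  rcases hD.sub (hadj p hp x hx y hy hxy) with h | h
  · exact Or.inl h
  · have hxE : x ∉ S.E := fun h => hS.E_not_cluster h (hC (Or.inl ⟨p, hp, hx⟩))
    have hyE : y ∉ S.E := fun h => hS.E_not_cluster h (hC (Or.inr ⟨p, hp, hy⟩))
    rcases h.2 with h | h
    exacts [absurd h.1 hxE, absurd h.2 hyE]

theorem configurations_of_usableMatching [Nonempty V] {ξ ε d l d' : ℝ} {M : Set (Set V × Set V)}
    (hM : UsableMatching S T ε d l d' M) (sc : SmallConstants S.toConstants S.k ξ)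
    (hS : S.CommonSetting) (hT : SplittingSetting S T)
    (hadj : vertsOf M ⊆ ⋃₀ S.clusters → ∀ p ∈ M, ∀ x ∈ p.1, ∀ y ∈ p.2, S.G.Adj x y →
      S.Greg.Adj x y ∨ S.GD.Adj x y ∧ Matched S x y)
    (hcase : CaseA S T M ∨ CaseB S T M) :
    Conf6 S T (S.η ^ 3 * S.ρ ^ 4 / (10 ^ 12 * S.Ωs ^ 4)) (4 * S.π) d'
      (S.η ^ 2 * S.ν / (2 * 10 ^ 4)) (3 * S.η ^ 3 / 2000) (T.p 2 * (1 + S.η / 20) * S.k) ∨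
    Conf7 S T (S.η ^ 3 * S.γ ^ 3 * S.ρ / (10 ^ 12 * S.Ωs ^ 4)) (S.η * S.γ / 400) (4 * S.π) d'
      (S.η ^ 2 * S.ν / (2 * 10 ^ 4)) (3 * S.η ^ 3 / 2000) (T.p 2 * (1 + S.η / 20) * S.k) ∨
    Conf8 S T (S.η ^ 4 * S.γ ^ 4 * S.ρ / (10 ^ 15 * S.Ωs ^ 5)) (S.η * S.γ / 400)
      (400 * S.ε / S.η) (4 * S.π) (S.d / 2) d' (S.η * S.π * S.𝔠 / (200 * S.k))
      (S.η ^ 2 * S.ν / (2 * 10 ^ 4)) (T.p 1 * (1 + S.η / 20) * S.k)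
      (T.p 2 * (1 + S.η / 20) * S.k) ∨
    Conf9 S T (S.ρ * S.η ^ 8 / (10 ^ 27 * S.Ωs ^ 3)) (2 * S.η ^ 3 / 10 ^ 3)
      (T.p 1 * (1 + S.η / 40) * S.k) (T.p 2 * (1 + S.η / 20) * S.k)
      (400 * S.ε / S.η) (S.d / 2) (S.η * S.π * S.𝔠 / (200 * S.k)) (4 * S.π) d'
      (S.η ^ 2 * S.ν / (2 * 10 ^ 4)) ∨
    Conf10 S S.ε (S.γ ^ 2 * S.d / 2) (S.π * Real.sqrt S.εp * S.ν * S.k)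
      (S.Ωs ^ 2 * S.k / S.γ ^ 2) (S.η / 40) := by
  rcases hcase with ⟨hA, ht⟩ | ⟨hB1, hB2, ht⟩
  · have hex : Disjoint (verts1 M) T.exV := Set.disjoint_left.2 fun v hv hv' =>
      (hA (Or.inl hv)).2 (Or.inl (Or.inr hv'))
    have heart : ∀ V₀ V₁ : Set V, V₀.Nonempty → V₁.Nonempty → V₀ ⊆ verts2 M → V₁ ⊆ verts1 M →
        Heart1 S T (3 * S.η ^ 3 / 2000) (T.p 2 * (1 + S.η / 20) * S.k) V₀ V₁ ∨
        Heart2 S T (T.p 2 * (1 + S.η / 20) * S.k) V₀ V₁ := fun V₀ V₁ n0 n1 h0 h1 =>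
      Or.inr (heart2_of_caseA sc hS hT n0 n1 (Set.union_subset
        (fun v hv => hA (Or.inr (h0 hv))) fun v hv => hA (Or.inl (h1 hv))))
    rcases ht with ht | ht | ht | ht
    · exact Or.inl (conf6_of_expShadow hM sc hS hT hex ht heart)
    · exact Or.inr (Or.inl (conf7_of_VtoE hM sc hS hT hex ht heart))
    · exact Or.inr (Or.inr (Or.inl (conf8_of_RR hM sc hS hT hA ht)))
    · exact Or.inr (Or.inr (Or.inr (Or.inr (conf10_of_regular hM sc hS hA ht
        (hadj fun v hv => (ht hv).1)))))
  · have hex : Disjoint (verts1 M) T.exV := Set.disjoint_left.2 fun v hv hv' =>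
      (hB1 hv).2 (Or.inl (Or.inr hv'))
    have heart : ∀ V₀ V₁ : Set V, V₀.Nonempty → V₁.Nonempty → V₀ ⊆ verts2 M → V₁ ⊆ verts1 M →
        Heart1 S T (3 * S.η ^ 3 / 2000) (T.p 2 * (1 + S.η / 20) * S.k) V₀ V₁ ∨
        Heart2 S T (T.p 2 * (1 + S.η / 20) * S.k) V₀ V₁ := fun V₀ V₁ n0 n1 h0 h1 => by
      -- Here the vertices may see `E` strongly, so the cover is taken without the sides in `E`; the
      -- bound $\frac{3\eta^3}{2000}$ leaves $\frac{\eta^3}{2000}$ for $\sqrt\gamma$.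
      refine Or.inl ⟨coverFamily S ∅, heart1_of_caseB sc hS hT ∅ n0 n1 (h1.trans hB1)
        (h0.trans hB2) fun v _ => ?_⟩
      have e1 := mul_le_mul_of_nonneg_right sc.sqrt_γ_le sc.k_pos.le
      have e2 : deg S.Gcap v ∅ = 0 := by simp [deg]
      have e3 : 0 < S.η ^ 3 * S.k := mul_pos (pow_pos sc.η_pos 3) sc.k_pos
      rw [e2, Nat.cast_zero]
      linarith
    rcases ht with ht | ht | ht
    · exact Or.inl (conf6_of_expShadow hM sc hS hT hex ht heart)
    · exact Or.inr (Or.inl (conf7_of_VtoE hM sc hS hT hex ht heart))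
    · exact Or.inr (Or.inr (Or.inr (Or.inl (conf9_of_caseB hM sc hS hT hB1 hB2 ht))))

end Conclusion

end LKS

theorem mainTheorem3 :
    ∃ c : ℝ, 0 < c ∧ ∃ f : (i : ℕ) → (Fin i → ℝ) → ℝ, LKS.ThresholdFamily c f ∧
      ∀ (V : Type*) [Finite V] [Nonempty V] (S : LKS.Setup V) (T : LKS.Splitting V)
        (M : Set (Set V × Set V)) (d' : ℝ),
        S.toConstants.Hierarchy c f → S.CommonSetting → LKS.SplittingSetting S T →
        LKS.vertsOf M ⊆ T.P 0 →
        S.ρ * S.n / S.Ωs ≤ ((LKS.vertsOf M).ncard : ℝ) →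
        ((LKS.TypeM1 S M ∧ d' = S.γ ^ 3 * S.ρ / (32 * S.Ωs)) ∨
          (LKS.TypeM2 S M ∧ d' = S.γ ^ 3 * S.ρ / (128 * S.Ωs))) →
        (LKS.CaseA S T M ∨ LKS.CaseB S T M) →
        LKS.Conf6 S T (S.η ^ 3 * S.ρ ^ 4 / (10 ^ 12 * S.Ωs ^ 4)) (4 * S.π) d'
            (S.η ^ 2 * S.ν / (2 * 10 ^ 4)) (3 * S.η ^ 3 / 2000)
            (T.p 2 * (1 + S.η / 20) * S.k) ∨
        LKS.Conf7 S T (S.η ^ 3 * S.γ ^ 3 * S.ρ / (10 ^ 12 * S.Ωs ^ 4)) (S.η * S.γ / 400)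
            (4 * S.π) d' (S.η ^ 2 * S.ν / (2 * 10 ^ 4)) (3 * S.η ^ 3 / 2000)
            (T.p 2 * (1 + S.η / 20) * S.k) ∨
        LKS.Conf8 S T (S.η ^ 4 * S.γ ^ 4 * S.ρ / (10 ^ 15 * S.Ωs ^ 5)) (S.η * S.γ / 400)
            (400 * S.ε / S.η) (4 * S.π) (S.d / 2) d' (S.η * S.π * S.𝔠 / (200 * S.k))
            (S.η ^ 2 * S.ν / (2 * 10 ^ 4)) (T.p 1 * (1 + S.η / 20) * S.k)
            (T.p 2 * (1 + S.η / 20) * S.k) ∨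
        LKS.Conf9 S T (S.ρ * S.η ^ 8 / (10 ^ 27 * S.Ωs ^ 3)) (2 * S.η ^ 3 / 10 ^ 3)
            (T.p 1 * (1 + S.η / 40) * S.k) (T.p 2 * (1 + S.η / 20) * S.k)
            (400 * S.ε / S.η) (S.d / 2) (S.η * S.π * S.𝔠 / (200 * S.k)) (4 * S.π) d'
            (S.η ^ 2 * S.ν / (2 * 10 ^ 4)) ∨
        LKS.Conf10 S S.ε (S.γ ^ 2 * S.d / 2) (S.π * Real.sqrt S.εp * S.ν * S.k)
            (S.Ωs ^ 2 * S.k / S.γ ^ 2) (S.η / 40) := by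
  refine ⟨1 / 10 ^ 40, by norm_num, LKS.thresholds, LKS.thresholdFamily_thresholds, ?_⟩
  intro V _ _ S T M d' hH hS hT hP hl hM hcase
  have sc := hH.smallConstants hS.k_ge
  rcases hM with ⟨hM, rfl⟩ | ⟨hM, rfl⟩
  · exact LKS.configurations_of_usableMatching (LKS.usableMatching_of_typeM1 sc hS hM hP hl) sc hS
      hT (fun _ => LKS.adj_of_typeM1 hS hM) hcase
  · exact LKS.configurations_of_usableMatching (LKS.usableMatching_of_typeM2 sc hM hP hl) sc hS
      hT (fun hC => LKS.adj_of_typeM2 hS hM hC) hcase
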